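/- Let $\mathbb F\subseteq\mathbb C$ be a subfield that is closed under complex conjugation and under taking square roots. Let $\mathrm{FLT}_{\mathbb F}$ be the set of fractional linear transformations $\beta(x)=(ax+b)/(cx+d)$ with $a,b,c,d\in\mathbb F$, $(c,d)\neq(0,0)$ (constants included), considered as rational functions, and let $\Sigma\subset\mathrm{FLT}_{\mathbb F}$ be finite. For a word $w=a_1\ldots a_n$ let $L_w(z)$ be the hyperlogarithm determined by $L_{e}=1$ for the empty word $e$, $\partial_zL_{wa}(z)=L_w(z)/(z-a)$, $L_{0^{\{n\}}}(z)=(\log z)^n/n!$ ($0^{\{n\}}$ is the word of $n$ letters $0$), and $L_w(z)\to0$ for $z\to0$ if $w$ has a non-zero letter. The variables $z$ and $\overline z$ are treated as independent. Functions of $(z,\overline z)$ are (branches of) multivalued analytic functions near $z=\overline z=0$; a function is identified with its germ in the region $|z|\ll|\overline z|\ll1$, $z,\overline z\notin(-\infty,0]$, where logarithms are principal and $L_w(z)$ is integrated along the straight path from $0$ to $z$. * $\mathcal O_\Sigma$ is the $\mathbb C$-algebra generated by $z$, $(z-\beta(\overline z))^{-1}$ for $\beta\in\Sigma$, $\overline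 z$, and $(\overline z-\overline b)^{-1}$ for constants $b\in\Sigma$. * $\mathcal{GH}_\Sigma$ is the $\mathcal O_\Sigma$-span, and $\mathcal{GH}_\Sigma^{\mathbb C}$ the $\mathbb C$-span, of the products $L_v(\overline z)L_{w(\overline z)}(z)$, where $v$ is a word in the letters $\overline b$ for constants $b\in\Sigma$, and $w(\overline z)$ is a word in the letters $\beta(\overline z)$, $\beta\in\Sigma$. * $\mathcal O_{\mathbb F}$, $\mathcal{GH}_{\mathbb F}$, $\mathcal{GH}_{\mathbb F}^{\mathbb C}$ are the unions of $\mathcal O_\Sigma$, $\mathcal{GH}_\Sigma$, $\mathcal{GH}_\Sigma^{\mathbb C}$ over all finite $\Sigma\subset\mathrm{FLT}_{\mathbb F}$. * $\mathcal R^0$ is the set of functions with a simultaneous log-Laurent expansion $$f(z,\overline z)=\sum_{k,l=0}^{L}\ \sum_{m,n=M}^\infty c_{k,l,m,n}(\log z)^k(\log\overline z)^l z^m\overline z^n,\qquad 0\le L\in\mathbb Z,\ M\in\mathbb Z,\ c_{k,l,m,n}\in\mathbb C,$$ that converges in a neighborhood of $z=\overline z=0$. $\mathcal R^0(\overline z)$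 is the set of functions in $\mathcal R^0$ that depend only on $\overline z$. * $\mathcal S^0_\Sigma$ is the $\mathcal R^0(\overline z)$-span of the hyperlogarithms $L_{0^{\{\ell\}}\beta(\overline z)v(\overline z)}(z)$ with $\ell\ge0$, $\beta\in\Sigma$, $\beta\neq0=\beta(0)$, and $v$ a word in $\Sigma$. * For a ring $\mathcal O$ and a set $\mathcal X$ of functions, $\mathcal O\,\mathcal X$ is the set of finite sums $\sum_i\phi_ix_i$ with $\phi_i\in\mathcal O$, $x_i\in\mathcal X$. Then the following holds. 1. Every $f\in\mathcal{GH}_\Sigma$ has a unique decomposition $f=f_{\mathrm r}+f_{\mathrm s}$ into a regular part $f_{\mathrm r}\in\mathcal O_\Sigma\mathcal R^0\cap\mathcal{GH}_{\mathbb F}$ and a singular part $f_{\mathrm s}\in\mathcal O_\Sigma\mathcal S^0_\Sigma\cap\mathcal{GH}_{\mathbb F}$. 2. If $f\in\mathcal{GH}^{\mathbb C}_\Sigma$, then $f_{\mathrm r}\in\mathcal R^0\cap\mathcal{GH}^{\mathbb C}_{\mathbb F}$ and $f_{\mathrm s}\in\mathcal S^0_\Sigma\cap\mathcal{GH}^{\mathbb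 C}_{\mathbb F}$. 3. $\mathcal O_{\mathbb F}\mathcal S^0_\Sigma\cap\mathcal O_{\mathbb F}\mathcal R^0\cap\mathcal{GH}_{\mathbb F}=\{0\}$. -/

import Mathlib

namespace GenHyp

noncomputable section

open Filter Topology

/-! ### Functions of `z` and `z̄`

The variables `z` and `z̄` are treated as independent complex variables; a point is `p = (z, z̄)`,
so `p.1` is `z` and `p.2` is `z̄`. Multivalued analytic functions are represented by a germ: the
branch in which `log z` and `log z̄` are principal, in the regime `z̄ → 0`, `z / z̄ → 0`
(that is `|z| ≪ |z̄| ≪ 1`). Sets of this filter contain the connected open sets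
`{z, z̄ ∈ ℂ ∖ (-∞, 0], |z̄| < ε, |z| < ε |z̄|}`; there the straight path from `0` to `z` avoids every
letter `β(z̄)` with `β ≠ 0`, including those with `β(0) = 0`. -/

/-- The filter of the regime `z̄ → 0`, `z / z̄ → 0` with `z` and `z̄` in the slit plane. -/
def baseFilter : Filter (ℂ × ℂ) :=
  comap (fun p => (p.2, p.1 / p.2)) (𝓝 (0, 0)) ⊓
    𝓟 {p | p.1 ∈ Complex.slitPlane ∧ p.2 ∈ Complex.slitPlane}

/-- Germs of functions of `(z, z̄)`. -/
abbrev BiGerm : Type := Germ baseFilter ℂ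

instance instAlgebraBiGerm : Algebra ℂ BiGerm :=
  Algebra.ofModule
    (fun r x y => by
      induction x using Germ.inductionOn with
      | _ f =>
      induction y using Germ.inductionOn with
      | _ g =>
      refine congrArg (fun h : ℂ × ℂ → ℂ => (h : BiGerm)) ?_
      exact smul_mul_assoc r f g)
    (fun r x y => by
      induction x using Germ.inductionOn with
      | _ f =>
      induction y using Germ.inductionOn with
      | _ g =>
      refine congrArg (fun h : ℂ × ℂ → ℂ => (h : BiGerm)) ?_
      exact mul_smul_comm r f g)

/-- The germ of a function of `(z, z̄)`. -/
def toGerm (f : ℂ × ℂ → ℂ) : BiGerm := (f : BiGerm)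

/-! ### Hyperlogarithms -/

open Classical in
/-- The hyperlogarithm of a word that is written in reversed order (last letter first). A word
`0…0` of length `n` gives `(log z)^n / n!`. For every other word the outermost integration
`∫₀^z L_w(s) ds / (s - a)` converges at `0` and is taken along the straight path `s = t z`. -/
def hyperlogRev : List ℂ → ℂ → ℂ
  | [], _ => 1
  | a :: w, z =>
      if ∀ b ∈ a :: w, b = 0 then
        Complex.log z ^ (w.length + 1) / ((w.length + 1).factorial : ℂ)
      else ∫ t in (0 : ℝ)..1, hyperlogRev w (t * z) * (z / (t * z - a))

/-- The hyperlogarithm `L_w(z)`, with `∂_z L_{wa}(z) = L_w(z) / (z - a)`, regularized at `0`. -/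
def hyperlog (w : List ℂ) (z : ℂ) : ℂ := hyperlogRev w.reverse z

/-! ### Fractional linear transformations -/

/-- Fractional linear transformations with coefficients in `F`, constants included, as rational
functions. -/
def FLT (F : Subfield ℂ) : Set (RatFunc ℂ) :=
  {β | ∃ a ∈ F, ∃ b ∈ F, ∃ c ∈ F, ∃ d ∈ F, (c ≠ 0 ∨ d ≠ 0) ∧
    β = (RatFunc.C a * RatFunc.X + RatFunc.C b) / (RatFunc.C c * RatFunc.X + RatFunc.C d)}

/-- The value `β(x)` of a rational function away from its poles. -/
def valueAt (β : RatFunc ℂ) (x : ℂ) : ℂ := RatFunc.eval (RingHom.id ℂ) x β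

/-- `β ≠ 0 = β(0)`. The numerator is that of the reduced fraction, so `0` is not a pole of `β`. -/
def VanishesAtZero (β : RatFunc ℂ) : Prop := β ≠ 0 ∧ β.num.eval 0 = 0

/-- `L_{w(z̄)}(z)` for a word `w` of rational functions. -/
def hyperlogZ (w : List (RatFunc ℂ)) : BiGerm :=
  toGerm fun p => hyperlog (w.map fun β => valueAt β p.2) p.1

/-- `L_v(z̄)` for a word `v` of constants. -/
def hyperlogZbar (v : List ℂ) : BiGerm := toGerm fun p => hyperlog v p.2

/-! ### Generalized hyperlogarithms -/

/-- The ring `O_Σ(z, z̄)`, generated over `ℂ` by `z`, `1 / (z - β(z̄))` for `β ∈ Σ`, `z̄`, and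
`1 / (z̄ - b̄)` for the constants `b ∈ Σ`. -/
def regularRing (S : Set (RatFunc ℂ)) : Subalgebra ℂ BiGerm :=
  Algebra.adjoin ℂ
    ({toGerm fun p => p.1} ∪ {φ | ∃ β ∈ S, φ = toGerm fun p => (p.1 - valueAt β p.2)⁻¹} ∪
      {toGerm fun p => p.2} ∪
      {φ | ∃ b : ℂ, RatFunc.C b ∈ S ∧ φ = toGerm fun p => (p.2 - starRingEnd ℂ b)⁻¹})

/-- The functions `L_v(z̄) L_{w(z̄)}(z)`, where `v` has letters `b̄` for constants `b ∈ Σ` and `w`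
has letters in `Σ`. -/
def hyperlogProducts (S : Set (RatFunc ℂ)) : Set BiGerm :=
  {f | ∃ (v : List ℂ) (w : List (RatFunc ℂ)),
    (∀ x ∈ v, ∃ b : ℂ, RatFunc.C b ∈ S ∧ x = starRingEnd ℂ b) ∧ (∀ β ∈ w, β ∈ S) ∧
      f = hyperlogZbar v * hyperlogZ w}

/-- `GH_Σ`: generalized hyperlogarithms with coefficients in `O_Σ(z, z̄)`. -/
def GH (S : Set (RatFunc ℂ)) : Submodule (regularRing S) BiGerm :=
  Submodule.span (regularRing S) (hyperlogProducts S)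

/-- `GH_Σ^ℂ`: generalized hyperlogarithms with coefficients in `ℂ`. -/
def GHC (S : Set (RatFunc ℂ)) : Submodule ℂ BiGerm :=
  Submodule.span ℂ (hyperlogProducts S)

/-- `O_F(z, z̄)`: the union of `O_Σ(z, z̄)` over all finite `Σ ⊆ FLT_F`. -/
def regularRingUnion (F : Subfield ℂ) : Set BiGerm :=
  {φ | ∃ S : Set (RatFunc ℂ), S.Finite ∧ S ⊆ FLT F ∧ φ ∈ regularRing S}

/-- `GH_F`: the union of `GH_Σ` over all finite `Σ ⊆ FLT_F`. -/
def GHUnion (F : Subfield ℂ) : Set BiGerm :=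
  {f | ∃ S : Set (RatFunc ℂ), S.Finite ∧ S ⊆ FLT F ∧ f ∈ GH S}

/-- `GH_F^ℂ`: the union of `GH_Σ^ℂ` over all finite `Σ ⊆ FLT_F`. -/
def GHCUnion (F : Subfield ℂ) : Set BiGerm :=
  {f | ∃ S : Set (RatFunc ℂ), S.Finite ∧ S ⊆ FLT F ∧ f ∈ GHC S}

/-! ### Regular and singular functions at `0` -/

/-- `R⁰`: functions with a simultaneous log-Laurent expansion
`∑_{k, l ≤ L} ∑_{m, n ≥ M} c_{k, l, m, n} (log z)^k (log z̄)^l z^m z̄^n`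
which converges in a full neighborhood of `z = z̄ = 0` (up to the cuts of the logarithms).
Here `m` and `n` are written as `M + i` and `M + j` with natural numbers `i` and `j`. -/
def R0 : Set BiGerm :=
  {f | ∃ (L : ℕ) (M : ℤ) (c : Fin (L + 1) → Fin (L + 1) → ℕ → ℕ → ℂ) (ε : ℝ) (g : ℂ × ℂ → ℂ),
    0 < ε ∧ f = toGerm g ∧
    ∀ z ∈ Complex.slitPlane, ∀ y ∈ Complex.slitPlane, ‖z‖ < ε → ‖y‖ < ε →
      HasSum (fun q : Fin (L + 1) × Fin (L + 1) × ℕ × ℕ =>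
        c q.1 q.2.1 q.2.2.1 q.2.2.2 * Complex.log z ^ (q.1 : ℕ) * Complex.log y ^ (q.2.1 : ℕ) *
          z ^ (M + (q.2.2.1 : ℤ)) * y ^ (M + (q.2.2.2 : ℤ))) (g (z, y))}

/-- `R⁰(z̄)`: the functions in `R⁰` that depend only on `z̄`. -/
def R0bar : Set BiGerm :=
  {f | f ∈ R0 ∧ ∃ h : ℂ → ℂ, f = toGerm fun p => h p.2}

/-- `S⁰_Σ`: the `R⁰(z̄)`-span of the hyperlogarithms `L_{0…0 β(z̄) v(z̄)}(z)` with any number of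
leading zeros, `β ∈ Σ`, `β ≠ 0 = β(0)`, and `v` a word with letters in `Σ`. -/
def S0 (S : Set (RatFunc ℂ)) : Submodule ℂ BiGerm :=
  Submodule.span ℂ {f | ∃ r ∈ R0bar, ∃ (l : ℕ) (β : RatFunc ℂ) (v : List (RatFunc ℂ)),
    β ∈ S ∧ VanishesAtZero β ∧ (∀ γ ∈ v, γ ∈ S) ∧
      f = r * hyperlogZ (List.replicate l 0 ++ β :: v)}

/-- The finite sums `∑ φ x` with `φ ∈ A` and `x ∈ X`; for a ring `A` and `X` a set this is the
`A`-module that `X` generates (for `A` containing `ℂ`). -/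
def prodSpan (A X : Set BiGerm) : Submodule ℂ BiGerm :=
  Submodule.span ℂ {f | ∃ φ ∈ A, ∃ x ∈ X, f = φ * x}

/-- `(r, s)` is a decomposition of `f` into a regular part
`r ∈ O_Σ(z, z̄) R⁰ ∩ GH_F` and a singular part `s ∈ O_Σ(z, z̄) S⁰_Σ ∩ GH_F`. -/
def IsDecomposition (F : Subfield ℂ) (S : Set (RatFunc ℂ)) (f r s : BiGerm) : Prop :=
  f = r + s ∧
    (r ∈ prodSpan (regularRing S : Set BiGerm) R0 ∧ r ∈ GHUnion F) ∧
    (s ∈ prodSpan (regularRing S : Set BiGerm) (S0 S : Set BiGerm) ∧ s ∈ GHUnion F)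

end

end GenHyp

/-! Write `y` for `z̄`. Existence comes from subtracting, before each integration in `z`, the value
of the integrand on the curve of the new letter. Let `f` be analytic at the origin of `ℂ²`. If `β(0)
= 0`, then `(f - f(β(y), y)) / (z - β(y))` is again analytic at the origin (Hadamard's lemma after a
shear); if the curve `z = β(y)` misses the origin, `f / (z - β(y))` already is (`exists_isStep`).
Iterating from `1` gives the functions `regHyp`, called `t_w` below, which are analytic at the
origin although letters collide there.

The subtracted term `t_w(β(y), y) (log z)^k / (z - β(y))` integrates to `k! t_w(β(y), y)
L_{0…0β}(z)`, a singular hyperlogarithm with a coefficient in `y`. The remainder `(log z)^k ∂_z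
t_{wβ}` is integrated by parts within products of powers of `log z` and regular functions. Further
letters appended to a singular word keep it singular. Induction over the letters gives
`hyperlogFun_decomposition`.

The parts must also be generalized hyperlogarithms over `F`, so the coefficients `t_w(γ(y), y)` must
be hyperlogarithms in `y` with letters in `F` (`regHyp_spec`). Their derivatives involve the letters
only through the logarithmic derivatives of differences `α - δ`. The zeros and poles of such a
difference solve quadratic or linear equations over `F`, hence lie in `F` because `F` is closed
under square roots. The shuffle product (`hyperlog_mul_hyperlog`) then linearizes products, and
closure under conjugation turns letters in `F` into letters of the form `b̄`. The regular part of a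
generator is the generator minus its singular part, so it is a generalized hyperlogarithm as well.

Uniqueness and the trivial intersection both follow from `singular_hyperlog_independent`, applied
for fixed small `y`. A regular function becomes a polynomial in `log z` whose coefficients are
meromorphic in a disc of radius `ε` independent of `y`; a singular one becomes a combination of
`L_{0…0βv}` with `0 < |β| < ε` and coefficients meromorphic in the plane. In a non-trivial relation
between the two, normalize the coefficient of a longest word to `1` and differentiate. Induction
makes all new coefficients vanish, and one of these identities has a non-zero residue at the last
letter of the chosen word, although derivatives of meromorphic functions have no residues. The
condition `|β| < ε` places this pole inside the disc where the regular side is meromorphic. -/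

namespace GenHyp

noncomputable section

open Filter Topology

/-! ### The slit disc -/

/-- The disc of radius `ρ` about `0`, slit along `(-∞, 0]`. -/
def slitBall (ρ : ℝ) : Set ℂ := Complex.slitPlane ∩ Metric.ball 0 ρ

lemma isOpen_slitBall (ρ : ℝ) : IsOpen (slitBall ρ) :=
  Complex.isOpen_slitPlane.inter Metric.isOpen_ball

lemma slitBall_ne_zero {ρ : ℝ} {z : ℂ} (hz : z ∈ slitBall ρ) : z ≠ 0 :=
  Complex.slitPlane_ne_zero hz.1

lemma slitBall_mono {ρ σ : ℝ} (h : ρ ≤ σ) : slitBall ρ ⊆ slitBall σ :=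
  Set.inter_subset_inter_right _ (Metric.ball_subset_ball h)

lemma norm_lt_of_mem_slitBall {ρ : ℝ} {z : ℂ} (hz : z ∈ slitBall ρ) : ‖z‖ < ρ := by
  simpa using hz.2

lemma slitBall_mem_nhdsWithin {ρ : ℝ} (hρ : 0 < ρ) :
    slitBall ρ ∈ 𝓝[Complex.slitPlane] (0 : ℂ) :=
  inter_mem_nhdsWithin _ (Metric.ball_mem_nhds _ hρ)

lemma mem_nhdsWithin_slitPlane_iff {s : Set ℂ} :
    s ∈ 𝓝[Complex.slitPlane] (0 : ℂ) ↔ ∃ ρ > 0, slitBall ρ ⊆ s := by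
  rw [Metric.mem_nhdsWithin_iff]
  simp only [slitBall, Set.inter_comm]

lemma ofReal_mul_mem_slitPlane {t : ℝ} (ht : 0 < t) {z : ℂ} (hz : z ∈ Complex.slitPlane) :
    (t : ℂ) * z ∈ Complex.slitPlane := by
  rw [Complex.mem_slitPlane_iff] at hz ⊢
  rcases hz with h | h
  · left; simpa using mul_pos ht h
  · right; simpa using ⟨ht.ne', h⟩

lemma ofReal_mul_mem_slitBall {ρ t : ℝ} (ht : 0 < t) (ht1 : t ≤ 1) {z : ℂ} (hz : z ∈ slitBall ρ) :
    (t : ℂ) * z ∈ slitBall ρ := by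
  refine ⟨ofReal_mul_mem_slitPlane ht hz.1, ?_⟩
  have := norm_lt_of_mem_slitBall hz
  simp only [Metric.mem_ball, dist_zero_right, norm_mul, Complex.norm_real, Real.norm_eq_abs,
    abs_of_pos ht]
  nlinarith [norm_nonneg z]

lemma isPreconnected_slitBall {ρ : ℝ} (hρ : 0 < ρ) : IsPreconnected (slitBall ρ) := by
  have hmem : ((ρ / 2 : ℝ) : ℂ) ∈ slitBall ρ := by
    refine ⟨Complex.ofReal_mem_slitPlane.2 (by positivity), ?_⟩
    rw [Metric.mem_ball, dist_zero_right, Complex.norm_real, Real.norm_eq_abs,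
      abs_of_pos (by positivity)]
    linarith
  have hstar : StarConvex ℝ ((ρ / 2 : ℝ) : ℂ) (slitBall ρ) :=
    (Complex.starConvex_ofReal_slitPlane (by positivity)).inter
      ((convex_ball (0 : ℂ) ρ).starConvex hmem.2)
  exact (hstar.isPathConnected hmem).isConnected.isPreconnected

instance neBot_nhdsWithin_slitPlane : (𝓝[Complex.slitPlane] (0 : ℂ)).NeBot := by
  rw [← mem_closure_iff_nhdsWithin_neBot, Metric.mem_closure_iff]
  intro ε hε
  refine ⟨((ε / 2 : ℝ) : ℂ), Complex.ofReal_mem_slitPlane.2 (by positivity), ?_⟩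
  rw [dist_zero_left, Complex.norm_real, Real.norm_eq_abs, abs_of_pos (by positivity)]
  linarith

/-- Two functions on the slit disc with the same derivative differ by a constant. -/
lemma exists_sub_eq_const_of_hasDerivAt {ρ : ℝ} (hρ : 0 < ρ) {f g f' : ℂ → ℂ}
    (hf : ∀ z ∈ slitBall ρ, HasDerivAt f (f' z) z) (hg : ∀ z ∈ slitBall ρ, HasDerivAt g (f' z) z) :
    ∃ c, ∀ z ∈ slitBall ρ, f z - g z = c := by
  have h : ∀ z ∈ slitBall ρ, HasDerivAt (fun z => f z - g z) 0 z := fun z hz => by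
    simpa using! (hf z hz).sub (hg z hz)
  exact (isOpen_slitBall ρ).exists_is_const_of_deriv_eq_zero (isPreconnected_slitBall hρ)
    (fun z hz => (h z hz).differentiableAt.differentiableWithinAt) (fun z hz => (h z hz).deriv)

lemma eqOn_slitBall_of_hasDerivAt {ρ : ℝ} (hρ : 0 < ρ) {f g f' : ℂ → ℂ}
    (hf : ∀ z ∈ slitBall ρ, HasDerivAt f (f' z) z) (hg : ∀ z ∈ slitBall ρ, HasDerivAt g (f' z) z)
    (hf0 : Tendsto f (𝓝[Complex.slitPlane] 0) (𝓝 0))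
    (hg0 : Tendsto g (𝓝[Complex.slitPlane] 0) (𝓝 0)) : ∀ z ∈ slitBall ρ, f z = g z := by
  obtain ⟨c, hc⟩ := exists_sub_eq_const_of_hasDerivAt hρ hf hg
  have h1 : Tendsto (fun z => f z - g z) (𝓝[Complex.slitPlane] 0) (𝓝 0) := by
    simpa using hf0.sub hg0
  have h2 : Tendsto (fun z => f z - g z) (𝓝[Complex.slitPlane] 0) (𝓝 c) :=
    tendsto_const_nhds.congr' (by
      filter_upwards [slitBall_mem_nhdsWithin hρ] with z hz using (hc z hz).symm)
  have : c = 0 := tendsto_nhds_unique h2 h1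
  exact fun z hz => sub_eq_zero.1 ((hc z hz).trans this)

/-! ### Growth of the logarithm -/

lemma norm_log_mul_rpow_le {s R : ℝ} (hs : 0 < s) (hR : 0 < R) :
    ∃ C, 0 ≤ C ∧ ∀ z : ℂ, z ≠ 0 → ‖z‖ ≤ R → ‖Complex.log z‖ * ‖z‖ ^ s ≤ C := by
  refine ⟨1 / s + (R ^ s / s) * R ^ s + Real.pi * R ^ s, by positivity, fun z hz hzR => ?_⟩
  have hz0 : 0 < ‖z‖ := norm_pos_iff.2 hz
  have h1 : ‖Complex.log z‖ ≤ |Real.log ‖z‖| + Real.pi := by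
    refine (Complex.norm_le_abs_re_add_abs_im _).trans ?_
    rw [Complex.log_re, Complex.log_im]
    gcongr
    exact Complex.abs_arg_le_pi z
  have hp : ‖z‖ ^ s ≤ R ^ s := Real.rpow_le_rpow hz0.le hzR hs.le
  have h2 : |Real.log ‖z‖| * ‖z‖ ^ s ≤ 1 / s + (R ^ s / s) * R ^ s := by
    rcases le_total ‖z‖ 1 with h | h
    · have := Real.abs_log_mul_self_rpow_lt ‖z‖ s hz0 h hs
      rw [abs_mul, abs_of_nonneg (Real.rpow_nonneg hz0.le s)] at this
      have h3 : 0 ≤ (R ^ s / s) * R ^ s := by positivity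
      linarith
    · rw [abs_of_nonneg (Real.log_nonneg h)]
      have h3 : Real.log ‖z‖ ≤ R ^ s / s :=
        (Real.log_le_rpow_div hz0.le hs).trans (by gcongr)
      have h4 : Real.log ‖z‖ * ‖z‖ ^ s ≤ (R ^ s / s) * R ^ s := by gcongr
      have h5 : 0 < 1 / s := by positivity
      linarith
  calc ‖Complex.log z‖ * ‖z‖ ^ s ≤ (|Real.log ‖z‖| + Real.pi) * ‖z‖ ^ s := by gcongr
    _ = |Real.log ‖z‖| * ‖z‖ ^ s + Real.pi * ‖z‖ ^ s := by ring
    _ ≤ _ := by gcongr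

/-- An exponent `s < 1` makes powers of the logarithm integrable at `0` along rays, and makes `(log
z)^k z` tend to `0`. -/
lemma norm_log_pow_le (k : ℕ) {R : ℝ} (hR : 0 < R) :
    ∃ C s : ℝ, 0 ≤ C ∧ 0 < s ∧ s < 1 ∧
      ∀ z : ℂ, z ≠ 0 → ‖z‖ ≤ R → ‖Complex.log z‖ ^ k ≤ C * ‖z‖ ^ (-s) := by
  have hk : (0 : ℝ) < k + 2 := by positivity
  obtain ⟨C, hC, h⟩ := norm_log_mul_rpow_le (s := 1 / (k + 2)) (by positivity) hR
  -- Each of the `k` logarithms costs `|z|^(-1/(k+2))`. One more such factor, bounded through `R`,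
  -- makes the exponent positive also for `k = 0`.
  refine ⟨C ^ k * R ^ (1 / ((k : ℝ) + 2)), (k + 1) / (k + 2), by positivity, by positivity,
    (div_lt_one hk).2 (by linarith), fun z hz hzR => ?_⟩
  have hz0 : 0 < ‖z‖ := norm_pos_iff.2 hz
  have h1 := pow_le_pow_left₀ (by positivity) (h z hz hzR) k
  have h2 : ‖z‖ ^ (1 / ((k : ℝ) + 2)) ≤ R ^ (1 / ((k : ℝ) + 2)) :=
    Real.rpow_le_rpow hz0.le hzR (by positivity)
  rw [Real.rpow_neg hz0.le, ← div_eq_mul_inv, le_div_iff₀ (by positivity)]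
  have h3 : ‖z‖ ^ (((k : ℝ) + 1) / (k + 2)) =
      (‖z‖ ^ (1 / ((k : ℝ) + 2))) ^ k * ‖z‖ ^ (1 / ((k : ℝ) + 2)) := by
    rw [← Real.rpow_natCast, ← Real.rpow_mul hz0.le, ← Real.rpow_add hz0]
    congr 1; field_simp
  rw [h3, ← mul_assoc, ← mul_pow]
  gcongr

lemma tendsto_log_pow_mul_self (k : ℕ) :
    Tendsto (fun z : ℂ => Complex.log z ^ k * z) (𝓝[Complex.slitPlane] 0) (𝓝 0) := by
  obtain ⟨C, s, hC, hs, hs1, h⟩ := norm_log_pow_le k one_pos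
  have h1 : Tendsto (fun z : ℂ => C * ‖z‖ ^ (1 - s)) (𝓝[Complex.slitPlane] 0) (𝓝 0) := by
    have : Tendsto (fun z : ℂ => C * ‖z‖ ^ (1 - s)) (𝓝 0) (𝓝 (C * ‖(0 : ℂ)‖ ^ (1 - s))) := by
      refine Tendsto.const_mul _ (Tendsto.rpow_const (continuous_norm.tendsto _) ?_)
      right; linarith
    rw [norm_zero, Real.zero_rpow (by linarith), mul_zero] at this
    exact this.mono_left nhdsWithin_le_nhds
  refine squeeze_zero_norm' ?_ h1
  filter_upwards [slitBall_mem_nhdsWithin one_pos] with z hz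
  have hz0 : 0 < ‖z‖ := norm_pos_iff.2 (slitBall_ne_zero hz)
  rw [norm_mul, norm_pow]
  calc ‖Complex.log z‖ ^ k * ‖z‖ ≤ C * ‖z‖ ^ (-s) * ‖z‖ := by
        gcongr; exact h z (slitBall_ne_zero hz) (norm_lt_of_mem_slitBall hz).le
    _ = C * ‖z‖ ^ (1 - s) := by
        rw [mul_assoc]; congr 1
        rw [sub_eq_neg_add, Real.rpow_add hz0, Real.rpow_one]

/-! ### Functions with a log-holomorphic expansion in one variable -/

/-- `f = ∑ (log z)^k h_k(z)` on the slit disc, with finitely many `h_k`, holomorphic on the disc. -/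
def IsLogHol (ρ : ℝ) (f : ℂ → ℂ) : Prop :=
  ∃ (N : ℕ) (h : ℕ → ℂ → ℂ), (∀ k, DifferentiableOn ℂ (h k) (Metric.ball 0 ρ)) ∧
    (∀ k, N ≤ k → h k = 0) ∧
    ∀ z ∈ slitBall ρ, f z = ∑ k ∈ Finset.range N, Complex.log z ^ k * h k z

/-- A log-holomorphic function all of whose coefficients vanish at `0`. -/
def IsLogHolZero (ρ : ℝ) (f : ℂ → ℂ) : Prop :=
  ∃ (N : ℕ) (h : ℕ → ℂ → ℂ), (∀ k, DifferentiableOn ℂ (h k) (Metric.ball 0 ρ)) ∧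
    (∀ k, N ≤ k → h k = 0) ∧ (∀ k, h k 0 = 0) ∧
    ∀ z ∈ slitBall ρ, f z = ∑ k ∈ Finset.range N, Complex.log z ^ k * h k z

lemma IsLogHolZero.isLogHol {ρ : ℝ} {f : ℂ → ℂ} (hf : IsLogHolZero ρ f) : IsLogHol ρ f := by
  obtain ⟨N, h, h1, h2, -, h3⟩ := hf
  exact ⟨N, h, h1, h2, h3⟩

lemma isLogHolZero_zero (ρ : ℝ) : IsLogHolZero ρ 0 :=
  ⟨0, 0, fun _ => differentiableOn_const _, fun _ _ => rfl, fun _ => rfl, by simp⟩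

lemma IsLogHolZero.add {ρ : ℝ} {f g : ℂ → ℂ} (hf : IsLogHolZero ρ f) (hg : IsLogHolZero ρ g) :
    IsLogHolZero ρ (f + g) := by
  obtain ⟨N, h, h1, h2, h3, h4⟩ := hf
  obtain ⟨M, k, k1, k2, k3, k4⟩ := hg
  refine ⟨max N M, fun j => h j + k j, fun j => (h1 j).add (k1 j), fun j hj => ?_, fun j => ?_,
    fun z hz => ?_⟩
  · change h j + k j = 0
    rw [h2 j ((le_max_left _ _).trans hj), k2 j ((le_max_right _ _).trans hj), add_zero]
  · simp [h3, k3]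
  · have e1 : ∑ j ∈ Finset.range N, Complex.log z ^ j * h j z =
        ∑ j ∈ Finset.range (max N M), Complex.log z ^ j * h j z :=
      Finset.sum_subset (Finset.range_mono (le_max_left _ _)) fun j _ hj => by
        rw [h2 j (by simpa using hj)]; simp
    have e2 : ∑ j ∈ Finset.range M, Complex.log z ^ j * k j z =
        ∑ j ∈ Finset.range (max N M), Complex.log z ^ j * k j z :=
      Finset.sum_subset (Finset.range_mono (le_max_right _ _)) fun j _ hj => by
        rw [k2 j (by simpa using hj)]; simp
    simp only [Pi.add_apply, h4 z hz, k4 z hz, e1, e2, mul_add, Finset.sum_add_distrib]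

lemma exists_dslope_zero {ρ : ℝ} (hρ : 0 < ρ) {h : ℂ → ℂ}
    (hh : DifferentiableOn ℂ h (Metric.ball 0 ρ)) (h0 : h 0 = 0) :
    ∃ q : ℂ → ℂ, DifferentiableOn ℂ q (Metric.ball 0 ρ) ∧ ∀ z, h z = z * q z := by
  refine ⟨dslope h 0, (Complex.differentiableOn_dslope (Metric.ball_mem_nhds _ hρ)).2 hh,
    fun z => ?_⟩
  have := sub_smul_dslope h 0 z
  simpa [h0] using this.symm

lemma exists_primitive_ball {ρ : ℝ} {h : ℂ → ℂ}
    (hh : DifferentiableOn ℂ h (Metric.ball 0 ρ)) :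
    ∃ H : ℂ → ℂ, DifferentiableOn ℂ H (Metric.ball 0 ρ) ∧ H 0 = 0 ∧
      ∀ z ∈ Metric.ball 0 ρ, HasDerivAt H (h z) z := by
  obtain ⟨H, hH⟩ := hh.isExactOn_ball
  have : ∀ z ∈ Metric.ball 0 ρ, HasDerivAt (fun z => H z - H 0) (h z) z := fun z hz =>
    (hH z hz).sub_const _
  exact ⟨fun z => H z - H 0, fun z hz => (this z hz).differentiableAt.differentiableWithinAt,
    sub_self _, this⟩

/-- A primitive of `(log z)^k h(z)`. -/
lemma exists_primitive_log_pow_mul {ρ : ℝ} (hρ : 0 < ρ) (k : ℕ) {h : ℂ → ℂ}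
    (hh : DifferentiableOn ℂ h (Metric.ball 0 ρ)) :
    ∃ G : ℂ → ℂ, IsLogHolZero ρ G ∧
      ∀ z ∈ slitBall ρ, HasDerivAt G (Complex.log z ^ k * h z) z := by
  induction k generalizing h with
  | zero =>
    obtain ⟨H, H1, H2, H3⟩ := exists_primitive_ball hh
    refine ⟨H, ⟨1, fun j => if j = 0 then H else 0, fun j => ?_, fun j hj => ?_, fun j => ?_,
      fun z _ => by simp⟩, fun z hz => by simpa using H3 z hz.2⟩
    · by_cases hj : j = 0
      · simpa [hj] using H1
      · simp [hj]
    · simp [show j ≠ 0 by omega]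
    · by_cases hj : j = 0 <;> simp [hj, H2]
  | succ k ih =>
    obtain ⟨H, H1, H2, H3⟩ := exists_primitive_ball hh
    obtain ⟨q, q1, q2⟩ := exists_dslope_zero hρ H1 H2
    -- Integration by parts: `∫ (log z)^(k+1) h = (log z)^(k+1) H - (k+1) ∫ (log z)^k H/z`, where
    -- `H/z = q` is holomorphic since `H(0) = 0`.
    obtain ⟨G, G1, G2⟩ := ih (h := fun z => -((k : ℂ) + 1) * q z) (q1.const_mul _)
    have hL : IsLogHolZero ρ (fun z => Complex.log z ^ (k + 1) * H z) := by
      refine ⟨k + 2, fun j => if j = k + 1 then H else 0, fun j => ?_, fun j hj => ?_, fun j => ?_,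
        fun z _ => ?_⟩
      · by_cases hj : j = k + 1
        · simpa [hj] using H1
        · simp [hj]
      · simp [show j ≠ k + 1 by omega]
      · by_cases hj : j = k + 1 <;> simp [hj, H2]
      · rw [Finset.sum_range_succ, Finset.sum_eq_zero fun j hj => ?_]
        · simp
        · rw [Finset.mem_range] at hj
          simp [show j ≠ k + 1 by omega]
    refine ⟨_, hL.add G1, fun z hz => ?_⟩
    have hz0 := slitBall_ne_zero hz
    have d1 := ((Complex.hasDerivAt_log hz.1).pow (k + 1)).mul (H3 z hz.2)
    refine (d1.add (G2 z hz)).congr_deriv ?_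
    rw [q2 z, Pi.pow_apply]
    push_cast
    field_simp
    ring

lemma IsLogHol.exists_primitive {ρ : ℝ} (hρ : 0 < ρ) {f : ℂ → ℂ} (hf : IsLogHol ρ f) :
    ∃ G : ℂ → ℂ, IsLogHolZero ρ G ∧ ∀ z ∈ slitBall ρ, HasDerivAt G (f z) z := by
  obtain ⟨N, h, h1, -, h3⟩ := hf
  suffices H : ∃ G : ℂ → ℂ, IsLogHolZero ρ G ∧ ∀ z ∈ slitBall ρ,
      HasDerivAt G (∑ k ∈ Finset.range N, Complex.log z ^ k * h k z) z by
    obtain ⟨G, G1, G2⟩ := H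
    exact ⟨G, G1, fun z hz => (G2 z hz).congr_deriv (h3 z hz).symm⟩
  clear h3
  induction N with
  | zero => exact ⟨0, isLogHolZero_zero ρ, fun z _ => by simp⟩
  | succ N ih =>
    obtain ⟨G, G1, G2⟩ := ih
    obtain ⟨K, K1, K2⟩ := exists_primitive_log_pow_mul hρ N (h1 N)
    refine ⟨G + K, G1.add K1, fun z hz => ?_⟩
    rw [Finset.sum_range_succ]
    exact (G2 z hz).add (K2 z hz)

lemma IsLogHolZero.tendsto {ρ : ℝ} (hρ : 0 < ρ) {f : ℂ → ℂ} (hf : IsLogHolZero ρ f) :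
    Tendsto f (𝓝[Complex.slitPlane] 0) (𝓝 0) := by
  obtain ⟨N, h, h1, -, h3, h4⟩ := hf
  have : Tendsto (fun z => ∑ k ∈ Finset.range N, Complex.log z ^ k * h k z)
      (𝓝[Complex.slitPlane] 0) (𝓝 0) := by
    rw [show (0 : ℂ) = ∑ _k ∈ Finset.range N, (0 : ℂ) by simp]
    rw [show (𝓝[Complex.slitPlane] (∑ _k ∈ Finset.range N, (0 : ℂ))) =
        𝓝[Complex.slitPlane] 0 by simp]
    refine tendsto_finsetSum _ fun k _ => ?_
    obtain ⟨q, q1, q2⟩ := exists_dslope_zero hρ (h1 k) (h3 k)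
    have hq : Tendsto q (𝓝[Complex.slitPlane] 0) (𝓝 (q 0)) :=
      ((q1.differentiableAt (Metric.ball_mem_nhds _ hρ)).continuousAt).mono_left nhdsWithin_le_nhds
    have := (tendsto_log_pow_mul_self k).mul hq
    rw [zero_mul] at this
    exact this.congr fun z => by rw [q2 z]; ring
  refine this.congr' ?_
  filter_upwards [slitBall_mem_nhdsWithin hρ] with z hz using (h4 z hz).symm

lemma IsLogHol.intervalIntegrable {ρ : ℝ} {f : ℂ → ℂ} (hf : IsLogHol ρ f) {z : ℂ}
    (hz : z ∈ slitBall ρ) :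
    IntervalIntegrable (fun t : ℝ => f (t * z)) MeasureTheory.volume 0 1 := by
  obtain ⟨N, h, h1, -, h4⟩ := hf
  have hz0 : 0 < ‖z‖ := norm_pos_iff.2 (slitBall_ne_zero hz)
  have key : IntervalIntegrable (fun t : ℝ => ∑ k ∈ Finset.range N,
      Complex.log (t * z) ^ k * h k (t * z)) MeasureTheory.volume 0 1 := by
    have : (fun t : ℝ => ∑ k ∈ Finset.range N, Complex.log (t * z) ^ k * h k (t * z)) =
        ∑ k ∈ Finset.range N, fun t : ℝ => Complex.log (t * z) ^ k * h k (t * z) := by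
      ext t; simp
    rw [this]
    refine IntervalIntegrable.sum _ fun k _ => ?_
    have hc : ContinuousOn (fun t : ℝ => h k (t * z)) (Set.uIcc 0 1) := by
      refine (h1 k).continuousOn.comp (by fun_prop) fun t ht => ?_
      rw [Set.uIcc_of_le zero_le_one] at ht
      have := norm_lt_of_mem_slitBall hz
      simp only [Metric.mem_ball, dist_zero_right, norm_mul, Complex.norm_real, Real.norm_eq_abs,
        abs_of_nonneg ht.1]
      nlinarith [ht.1, ht.2]
    refine IntervalIntegrable.mul_continuousOn ?_ hc
    obtain ⟨C, s, hC, hs, hs1, hb⟩ := norm_log_pow_le k hz0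
    refine IntervalIntegrable.mono_fun'
      (g := fun t : ℝ => C * ‖z‖ ^ (-s) * t ^ (-s))
      ((intervalIntegral.intervalIntegrable_rpow' (by linarith)).const_mul _) ?_ ?_
    · rw [Set.uIoc_of_le zero_le_one]
      refine ContinuousOn.aestronglyMeasurable ?_ measurableSet_Ioc
      refine ContinuousOn.pow (ContinuousOn.clog (by fun_prop) fun t ht => ?_) _
      exact ofReal_mul_mem_slitPlane ht.1 hz.1
    · rw [Set.uIoc_of_le zero_le_one]
      refine (MeasureTheory.ae_restrict_iff' measurableSet_Ioc).2 (Eventually.of_forall ?_)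
      intro t ht
      have e : ‖(t : ℂ) * z‖ = t * ‖z‖ := by
        rw [norm_mul, Complex.norm_real, Real.norm_eq_abs, abs_of_pos ht.1]
      have h5 := hb (t * z) (mul_ne_zero (by exact_mod_cast ht.1.ne') (slitBall_ne_zero hz)) (by
        rw [e]; nlinarith [ht.2])
      beta_reduce
      rw [norm_pow]
      refine h5.trans (le_of_eq ?_)
      rw [e, Real.mul_rpow ht.1.le hz0.le]
      ring
  refine key.congr fun t ht => ?_
  rw [Set.uIoc_of_le zero_le_one] at ht
  exact (h4 _ (ofReal_mul_mem_slitBall ht.1 ht.2 hz)).symm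

lemma IsLogHol.integral_eq {ρ : ℝ} (hρ : 0 < ρ) {f G : ℂ → ℂ} (hf : IsLogHol ρ f)
    (hG : IsLogHolZero ρ G) (hd : ∀ z ∈ slitBall ρ, HasDerivAt G (f z) z) {z : ℂ}
    (hz : z ∈ slitBall ρ) : ∫ t in (0 : ℝ)..1, f (t * z) * z = G z := by
  have hder : ∀ t : ℝ, 0 < t → t ≤ 1 → HasDerivAt (fun t : ℝ => G (t * z)) (f (t * z) * z) t := by
    intro t ht ht1
    have h1 := hd _ (ofReal_mul_mem_slitBall ht ht1 hz)
    have h2 : HasDerivAt (fun t : ℝ => (t : ℂ) * z) z t := by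
      simpa using (Complex.ofRealCLM.hasDerivAt (x := t)).mul_const z
    exact h1.comp t h2
  have h0 : Tendsto (fun t : ℝ => (t : ℂ) * z) (𝓝[>] 0) (𝓝[Complex.slitPlane] 0) := by
    refine tendsto_nhdsWithin_iff.2 ⟨?_, ?_⟩
    · have : Tendsto (fun t : ℝ => (t : ℂ) * z) (𝓝 0) (𝓝 (((0 : ℝ) : ℂ) * z)) :=
        Continuous.tendsto (by fun_prop) _
      simpa using this.mono_left nhdsWithin_le_nhds
    · filter_upwards [self_mem_nhdsWithin] with t ht using ofReal_mul_mem_slitPlane ht hz.1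
  have := intervalIntegral.integral_eq_sub_of_hasDerivAt_of_tendsto (zero_lt_one' ℝ)
    (fun t ht => hder t ht.1 ht.2.le) ((hf.intervalIntegrable hz).mul_const z)
    ((hG.tendsto hρ).comp h0)
    ((hder 1 one_pos le_rfl).continuousAt.tendsto.mono_left nhdsWithin_le_nhds)
  simpa using this

lemma IsLogHol.mul_holomorphic {ρ : ℝ} {f g : ℂ → ℂ} (hf : IsLogHol ρ f)
    (hg : DifferentiableOn ℂ g (Metric.ball 0 ρ)) : IsLogHol ρ (fun z => f z * g z) := by
  obtain ⟨N, h, h1, h2, h4⟩ := hf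
  refine ⟨N, fun k z => h k z * g z, fun k => (h1 k).mul hg, fun k hk => ?_, fun z hz => ?_⟩
  · ext z; simp [h2 k hk]
  · beta_reduce
    rw [h4 z hz, Finset.sum_mul]
    exact Finset.sum_congr rfl fun k _ => by ring

/-- This is why vanishing of the coefficients at `0` is tracked: the letter `0` divides by `z`,
which must not create a pole. -/
lemma IsLogHolZero.div_self {ρ : ℝ} (hρ : 0 < ρ) {f : ℂ → ℂ} (hf : IsLogHolZero ρ f) :
    IsLogHol ρ (fun z => f z / z) := by
  obtain ⟨N, h, h1, h2, h3, h4⟩ := hf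
  refine ⟨N, fun k => dslope (h k) 0,
    fun k => (Complex.differentiableOn_dslope (Metric.ball_mem_nhds _ hρ)).2 (h1 k),
    fun k hk => ?_, fun z hz => ?_⟩
  · beta_reduce
    rw [h2 k hk]; ext z
    by_cases hz : z = 0
    · subst hz; simp [dslope_same]
    · simp [dslope_of_ne _ hz, slope_def_field]
  · have hz0 := slitBall_ne_zero hz
    beta_reduce
    rw [h4 z hz, Finset.sum_div]
    refine Finset.sum_congr rfl fun k _ => ?_
    simp [dslope_of_ne _ hz0, slope_def_field, h3]
    ring

lemma isLogHol_log_pow (ρ : ℝ) (n : ℕ) (c : ℂ) : IsLogHol ρ (fun z => Complex.log z ^ n * c) := by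
  refine ⟨n + 1, fun k _ => if k = n then c else 0, fun k => differentiableOn_const _,
    fun k hk => ?_, fun z _ => ?_⟩
  · ext; simp [show k ≠ n by omega]
  · simp

/-! ### Hyperlogarithms: expansion, derivative and limit -/

lemma hyperlogRev_of_forall_eq_zero {w : List ℂ} (hw : ∀ b ∈ w, b = 0) (z : ℂ) :
    hyperlogRev w z = Complex.log z ^ w.length / (w.length.factorial : ℂ) := by
  cases w with
  | nil => simp [hyperlogRev]
  | cons a w => rw [hyperlogRev, if_pos hw]; rfl

/-- The three claims support one another. The expansion of the inner word makes the next integrand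
log-holomorphic: a non-zero letter contributes a factor holomorphic on the disc, while a letter `0`
after a non-zero one needs the vanishing coefficients. The integral is then the log-holomorphic
primitive that vanishes at `0`, and the derivative can be read off. -/
lemma hyperlogRev_spec {ρ : ℝ} (hρ : 0 < ρ) (w : List ℂ) (hw : ∀ b ∈ w, b ≠ 0 → ρ ≤ ‖b‖) :
    IsLogHol ρ (hyperlogRev w) ∧ ((∃ b ∈ w, b ≠ 0) → IsLogHolZero ρ (hyperlogRev w)) ∧
      ∀ a v, w = a :: v → ∀ z ∈ slitBall ρ,
        HasDerivAt (hyperlogRev w) (hyperlogRev v z / (z - a)) z := by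
  induction w with
  | nil =>
    refine ⟨?_, by simp, by simp⟩
    have := isLogHol_log_pow ρ 0 1
    simpa [hyperlogRev] using this
  | cons a v ih =>
    obtain ⟨ih1, ih2, -⟩ := ih fun b hb => hw b (List.mem_cons_of_mem _ hb)
    by_cases h0 : ∀ b ∈ a :: v, b = 0
    · have e : hyperlogRev (a :: v) = fun z => Complex.log z ^ (a :: v).length *
          ((a :: v).length.factorial : ℂ)⁻¹ := by
        ext z; rw [hyperlogRev_of_forall_eq_zero h0]; rfl
      refine ⟨?_, fun ⟨b, hb, hb0⟩ => absurd (h0 b hb) hb0, ?_⟩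
      · rw [e]; exact isLogHol_log_pow ρ _ _
      · rintro a' v' h z hz
        obtain ⟨rfl, rfl⟩ := List.cons.inj h
        rw [e, hyperlogRev_of_forall_eq_zero fun b hb => h0 b (List.mem_cons_of_mem _ hb),
          h0 a List.mem_cons_self]
        refine (((Complex.hasDerivAt_log hz.1).pow _).mul_const _).congr_deriv ?_
        have hz0 := slitBall_ne_zero hz
        have hf : (v.length.factorial : ℂ) ≠ 0 := by exact_mod_cast v.length.factorial_ne_zero
        have hl : (v.length : ℂ) + 1 ≠ 0 := by exact_mod_cast v.length.succ_ne_zero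
        simp only [List.length_cons, Nat.add_sub_cancel, Nat.factorial_succ]
        push_cast
        field_simp
        simp
    · have hf : IsLogHol ρ (fun z => hyperlogRev v z / (z - a)) := by
        by_cases ha : a = 0
        · subst ha
          have : ∃ b ∈ v, b ≠ 0 := by
            by_contra! hcon
            exact h0 (by simpa using hcon)
          simpa using (ih2 this).div_self hρ
        · have hne : ∀ z ∈ Metric.ball (0 : ℂ) ρ, z - a ≠ 0 := by
            intro z hz hza
            have h1 := hw a List.mem_cons_self ha
            rw [sub_eq_zero.1 hza] at hz
            simp only [Metric.mem_ball, dist_zero_right] at hz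
            linarith
          have := ih1.mul_holomorphic (g := fun z => (z - a)⁻¹)
            (((differentiableOn_id).sub_const a).inv hne)
          simpa [div_eq_mul_inv] using this
      obtain ⟨G, G1, G2⟩ := hf.exists_primitive hρ
      have heq : ∀ z ∈ slitBall ρ, hyperlogRev (a :: v) z = G z := by
        intro z hz
        rw [hyperlogRev, if_neg h0, ← hf.integral_eq hρ G1 G2 hz]
        congr 1; ext t; ring
      have hz : IsLogHolZero ρ (hyperlogRev (a :: v)) := by
        obtain ⟨N, h, h1, h2, h3, h4⟩ := G1
        exact ⟨N, h, h1, h2, h3, fun z hz => (heq z hz).trans (h4 z hz)⟩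
      refine ⟨hz.isLogHol, fun _ => hz, ?_⟩
      rintro a' v' h z hz
      obtain ⟨rfl, rfl⟩ := List.cons.inj h
      refine (G2 z hz).congr_of_eventuallyEq ?_
      filter_upwards [(isOpen_slitBall ρ).mem_nhds hz] with x hx using heq x hx

lemma isLogHol_hyperlog {ρ : ℝ} (hρ : 0 < ρ) {w : List ℂ} (hw : ∀ b ∈ w, b ≠ 0 → ρ ≤ ‖b‖) :
    IsLogHol ρ (hyperlog w) :=
  (hyperlogRev_spec hρ w.reverse (by simpa using hw)).1

lemma isLogHolZero_hyperlog {ρ : ℝ} (hρ : 0 < ρ) {w : List ℂ} (hw : ∀ b ∈ w, b ≠ 0 → ρ ≤ ‖b‖)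
    (h : ∃ b ∈ w, b ≠ 0) : IsLogHolZero ρ (hyperlog w) :=
  (hyperlogRev_spec hρ w.reverse (by simpa using hw)).2.1 (by simpa using h)

lemma hasDerivAt_hyperlog {ρ : ℝ} (hρ : 0 < ρ) {w : List ℂ} {a : ℂ}
    (hw : ∀ b ∈ w ++ [a], b ≠ 0 → ρ ≤ ‖b‖) {z : ℂ} (hz : z ∈ slitBall ρ) :
    HasDerivAt (hyperlog (w ++ [a])) (hyperlog w z / (z - a)) z :=
  (hyperlogRev_spec hρ (w ++ [a]).reverse
    (fun b hb => hw b (List.mem_reverse.1 hb))).2.2 a w.reverse (by simp) z hz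

lemma tendsto_hyperlog {w : List ℂ} (h : ∃ b ∈ w, b ≠ 0) :
    Tendsto (hyperlog w) (𝓝[Complex.slitPlane] 0) (𝓝 0) := by
  obtain ⟨ρ, hρ, hw⟩ : ∃ ρ > 0, ∀ b ∈ w, b ≠ 0 → ρ ≤ ‖b‖ := by
    clear h
    induction w with
    | nil => exact ⟨1, one_pos, by simp⟩
    | cons a w ih =>
      obtain ⟨ρ, h1, h2⟩ := ih
      by_cases ha : a = 0
      · exact ⟨ρ, h1, by simpa [ha] using h2⟩
      · refine ⟨min ρ ‖a‖, lt_min h1 (norm_pos_iff.2 ha), ?_⟩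
        simp only [List.mem_cons, forall_eq_or_imp]
        exact ⟨fun _ => min_le_right _ _, fun b hb hb0 => (min_le_left _ _).trans (h2 b hb hb0)⟩
  exact (isLogHolZero_hyperlog hρ hw h).tendsto hρ

lemma hyperlog_nil (z : ℂ) : hyperlog [] z = 1 := rfl

lemma hyperlog_replicate_zero (n : ℕ) (z : ℂ) :
    hyperlog (List.replicate n 0) z = Complex.log z ^ n / (n.factorial : ℂ) := by
  rw [hyperlog, hyperlogRev_of_forall_eq_zero (by simp +contextual [List.mem_replicate])]
  simp

lemma exists_radius (w : List ℂ) : ∃ ρ > 0, ∀ b ∈ w, b ≠ 0 → ρ ≤ ‖b‖ := by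
  induction w with
  | nil => exact ⟨1, one_pos, by simp⟩
  | cons a w ih =>
    obtain ⟨ρ, h1, h2⟩ := ih
    by_cases ha : a = 0
    · exact ⟨ρ, h1, by simpa [ha] using h2⟩
    · refine ⟨min ρ ‖a‖, lt_min h1 (norm_pos_iff.2 ha), ?_⟩
      simp only [List.mem_cons, forall_eq_or_imp]
      exact ⟨fun _ => min_le_right _ _, fun b hb hb0 => (min_le_left _ _).trans (h2 b hb hb0)⟩

/-! ### Meromorphic functions: identity theorem and residues -/

lemma nhdsWithin_slitPlane_le : 𝓝[Complex.slitPlane] (0 : ℂ) ≤ 𝓝[≠] 0 :=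
  nhdsWithin_mono _ fun _ hz => Complex.slitPlane_ne_zero hz

/-- On a connected set the order of a meromorphic function is infinite everywhere or nowhere. This
transports identities found near `0` to the letters where residues are taken. -/
lemma MeromorphicOn.eventually_eq_zero {f : ℂ → ℂ} {U : Set ℂ} (hf : MeromorphicOn f U)
    (hU : IsPreconnected U) {x y : ℂ} (hx : x ∈ U) (hy : y ∈ U)
    (h : ∀ᶠ z in 𝓝[≠] x, f z = 0) : ∀ᶠ z in 𝓝[≠] y, f z = 0 := by
  rw [← meromorphicOrderAt_eq_top_iff] at h ⊢
  by_contra hcon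
  exact hf.meromorphicOrderAt_ne_top_of_isPreconnected hU hy hx hcon h

/-- Differentiation lowers a finite non-zero order by one, so a vanishing derivative forces order
`0` or `∞`. In the case of order `0`, subtract the limit: the difference has positive order. -/
lemma eventually_eq_const_of_deriv_eq_zero {f : ℂ → ℂ} {x : ℂ} (hf : MeromorphicAt f x)
    (h : ∀ᶠ z in 𝓝[≠] x, deriv f z = 0) : ∃ c, ∀ᶠ z in 𝓝[≠] x, f z = c := by
  have key : ∀ g : ℂ → ℂ, (∀ᶠ z in 𝓝[≠] x, deriv g z = 0) → meromorphicOrderAt g x ≠ 0 →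
      ∀ᶠ z in 𝓝[≠] x, g z = 0 := by
    intro g hg h0
    rw [← meromorphicOrderAt_eq_top_iff] at hg ⊢
    by_contra hcon
    obtain ⟨n, hn⟩ := WithTop.ne_top_iff_exists.1 hcon
    have hn0 : (n : ℂ) ≠ 0 := by
      rintro h
      rw [Int.cast_eq_zero.1 h] at hn
      exact h0 hn.symm
    rw [meromorphicOrderAt_deriv_eq_sub_one hn0 hn.symm] at hg
    exact WithTop.coe_ne_top hg
  by_cases h0 : meromorphicOrderAt f x = 0
  · obtain ⟨c, hc⟩ := (tendsto_nhds_iff_meromorphicOrderAt_nonneg hf).2 h0.ge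
    refine ⟨c, ?_⟩
    have h1 : MeromorphicAt (fun z => f z - c) x := hf.sub (MeromorphicAt.const c x)
    have h2 : 0 < meromorphicOrderAt (fun z => f z - c) x :=
      (tendsto_zero_iff_meromorphicOrderAt_pos h1).1 (by simpa using hc.sub_const c)
    filter_upwards [key (fun z => f z - c) (by simpa using h) h2.ne'] with z hz
    exact sub_eq_zero.1 hz
  · exact ⟨0, key f h h0⟩

/-- The derivative of a meromorphic function has no residue. -/
lemma residue_eq_zero {h r : ℂ → ℂ} {a c : ℂ} (hh : MeromorphicAt h a) (hr : AnalyticAt ℂ r a)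
    (e : ∀ᶠ z in 𝓝[≠] a, deriv h z + r z + c / (z - a) = 0) : c = 0 := by
  obtain ⟨R, hR, h1⟩ := Metric.mem_nhdsWithin_iff.1 (e.and hh.eventually_analyticAt)
  obtain ⟨R', hR', h2⟩ := Metric.eventually_nhds_iff_ball.1 hr.eventually_analyticAt
  have hd : DifferentiableOn ℂ r (Metric.ball a R') := fun z hz =>
    (h2 z hz).differentiableAt.differentiableWithinAt
  obtain ⟨G, hG⟩ := hd.isExactOn_ball
  have hs : 0 < min R R' / 2 := by positivity
  -- With `G` a primitive of `r`, the function `-(h + G)` is a primitive of `c / (z - a)` on a small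
  -- circle around `a`. The integral is therefore `0`, but it also equals `2πi c`.
  have := circleIntegral.integral_eq_zero_of_hasDerivWithinAt (c := a) (R := min R R' / 2)
    (f := fun z => -(h z + G z)) (f' := fun z => c * (z - a)⁻¹) hs.le (fun z hz => by
      have hza : dist z a = min R R' / 2 := hz
      have hlt : min R R' / 2 < min R R' := by linarith
      have hzne : z ≠ a := by
        rintro rfl
        rw [dist_self] at hza
        linarith
      have h3 := h1 ⟨by rw [Metric.mem_ball, hza]; exact hlt.trans_le (min_le_left _ _), hzne⟩
      have h4 := hG z (by rw [Metric.mem_ball, hza]; exact hlt.trans_le (min_le_right _ _))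
      refine ((h3.2.differentiableAt.hasDerivAt.add h4).neg.congr_deriv ?_).hasDerivWithinAt
      have h5 := h3.1
      rw [div_eq_mul_inv] at h5
      linear_combination -h5)
  rw [circleIntegral.integral_const_mul, circleIntegral.integral_sub_center_inv _ hs.ne'] at this
  simpa [Real.pi_ne_zero] using this

/-- Only the term `i₀` has a pole at `a i₀`: the other numerators are constant there and their poles
lie elsewhere, so these terms join the analytic part. The residue would be `κ ≠ 0`. -/
lemma residue_sum_ne_zero {ι : Type*} [DecidableEq ι] (T : Finset ι) (i₀ : ι) (hi₀ : i₀ ∈ T)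
    (a : ι → ℂ) (ha : ∀ i ∈ T, i ≠ i₀ → a i ≠ a i₀) (ψ : ι → ℂ → ℂ)
    (hψ : ∀ i ∈ T, i ≠ i₀ → ∃ c, ∀ᶠ z in 𝓝[≠] (a i₀), ψ i z = c) (hψ₀ : ψ i₀ = fun _ => 1)
    {κ : ℂ} (hκ : κ ≠ 0) {h r : ℂ → ℂ} (hh : MeromorphicAt h (a i₀)) (hr : AnalyticAt ℂ r (a i₀))
    (e : ∀ᶠ z in 𝓝[≠] (a i₀), deriv h z + r z + κ * ∑ i ∈ T, ψ i z / (z - a i) = 0) : False := by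
  choose! c hc using hψ
  have h1 : ∀ᶠ z in 𝓝[≠] (a i₀), ∀ i ∈ T, i ≠ i₀ → ψ i z = c i :=
    (Finset.eventually_all T).2 fun i hi => by
      by_cases hne : i = i₀
      · exact Eventually.of_forall fun _ h => absurd hne h
      · filter_upwards [hc i hi hne] with z hz _ using hz
  refine hκ (residue_eq_zero (h := h)
    (r := fun z => r z + κ * ∑ i ∈ T.erase i₀, c i / (z - a i)) (c := κ) hh ?_ ?_)
  · refine hr.add (analyticAt_const.mul ?_)
    refine Finset.analyticAt_fun_sum _ fun i hi => ?_
    refine analyticAt_const.div (analyticAt_id.sub analyticAt_const) ?_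
    exact sub_ne_zero.2 (ha i (Finset.mem_of_mem_erase hi) (Finset.ne_of_mem_erase hi)).symm
  · filter_upwards [e, h1] with z hz hz1
    rw [← Finset.add_sum_erase T _ hi₀, hψ₀] at hz
    rw [Finset.sum_congr rfl fun i hi => by
      rw [← hz1 i (Finset.mem_of_mem_erase hi) (Finset.ne_of_mem_erase hi)]]
    linear_combination hz

/-! ### Independence of the powers of the logarithm -/

lemma eventually_eventuallyEq_of_slit {f g : ℂ → ℂ}
    (h : ∀ᶠ z in 𝓝[Complex.slitPlane] 0, f z = g z) :
    ∀ᶠ z in 𝓝[Complex.slitPlane] 0, f =ᶠ[𝓝 z] g := by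
  filter_upwards [eventually_eventually_nhdsWithin.2 h, self_mem_nhdsWithin] with z hz hz1
  rwa [Complex.isOpen_slitPlane.nhdsWithin_eq hz1] at hz

lemma MeromorphicAt.eventually_hasDerivAt_slit {f : ℂ → ℂ} (hf : MeromorphicAt f 0) :
    ∀ᶠ z in 𝓝[Complex.slitPlane] 0, HasDerivAt f (deriv f z) z := by
  filter_upwards [nhdsWithin_slitPlane_le hf.eventually_analyticAt] with z hz
  exact hz.differentiableAt.hasDerivAt

lemma eventually_hasDerivAt_logSum (N : ℕ) (g : ℕ → ℂ → ℂ) (hg : ∀ k, MeromorphicAt (g k) 0)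
    (hN : g N = 0) :
    ∀ᶠ z in 𝓝[Complex.slitPlane] 0,
      HasDerivAt (fun z => ∑ k ∈ Finset.range N, Complex.log z ^ k * g k z)
        (∑ k ∈ Finset.range N, Complex.log z ^ k * (deriv (g k) z + (k + 1) * g (k + 1) z / z))
        z := by
  have h1 : ∀ᶠ z in 𝓝[Complex.slitPlane] 0, ∀ k ∈ Finset.range N,
      HasDerivAt (g k) (deriv (g k) z) z :=
    (Finset.eventually_all _).2 fun k _ => MeromorphicAt.eventually_hasDerivAt_slit (hg k)
  filter_upwards [h1, self_mem_nhdsWithin] with z hz hz1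
  have h2 := HasDerivAt.fun_sum fun k hk =>
    ((Complex.hasDerivAt_log hz1).fun_pow k).fun_mul (hz k hk)
  refine h2.congr_deriv ?_
  -- Index shift in the terms where a logarithm is differentiated: the term `k = 0` vanishes, and `g
  -- N = 0` supplies the missing last term.
  have h3 : ∑ k ∈ Finset.range N, (k : ℂ) * Complex.log z ^ (k - 1) * z⁻¹ * g k z =
      ∑ k ∈ Finset.range N, ((k + 1 : ℕ) : ℂ) * Complex.log z ^ k * z⁻¹ * g (k + 1) z := by
    have h4 := Finset.sum_range_succ
      (fun k => (k : ℂ) * Complex.log z ^ (k - 1) * z⁻¹ * g k z) N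
    rw [Finset.sum_range_succ'] at h4
    simpa [hN] using h4.symm
  rw [Finset.sum_add_distrib, h3, ← Finset.sum_add_distrib]
  refine Finset.sum_congr rfl fun k _ => ?_
  push_cast
  ring

/-- Normalize the top coefficient to `1` and differentiate; the top power disappears and induction
kills the other coefficients. The coefficient of `(log z)^(N-1)` then reads `u' + N/z = 0`, which
contradicts the absence of residues in derivatives. -/
lemma log_pow_independent (N : ℕ) (g : ℕ → ℂ → ℂ) (hg : ∀ k, MeromorphicAt (g k) 0)
    (h : ∀ᶠ z in 𝓝[Complex.slitPlane] 0, ∑ k ∈ Finset.range N, Complex.log z ^ k * g k z = 0) :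
    ∀ k < N, ∀ᶠ z in 𝓝[≠] 0, g k z = 0 := by
  induction N generalizing g with
  | zero => simp
  | succ N ih =>
    rcases (hg N).eventually_eq_zero_or_eventually_ne_zero with h0 | h0
    · have := ih g hg (by
        filter_upwards [h, nhdsWithin_slitPlane_le h0] with z hz hz0
        simpa [Finset.sum_range_succ, hz0] using hz)
      intro k hk
      rcases Nat.lt_succ_iff_lt_or_eq.1 hk with hk | rfl
      · exact this k hk
      · exact h0
    · exfalso
      set u : ℕ → ℂ → ℂ := fun k =>
        if k < N then fun z => g k z / g N z else if k = N then fun _ => 1 else 0 with hu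
      have humer : ∀ k, MeromorphicAt (u k) 0 := by
        intro k
        simp only [hu]
        split_ifs
        · exact (hg k).fun_div (hg N)
        · exact MeromorphicAt.const 1 0
        · exact MeromorphicAt.const 0 0
      have huN : u N = fun _ => 1 := by simp [hu]
      have hrel : ∀ᶠ z in 𝓝[Complex.slitPlane] 0,
          ∑ k ∈ Finset.range (N + 1), Complex.log z ^ k * u k z = (fun _ => (0 : ℂ)) z := by
        filter_upwards [h, nhdsWithin_slitPlane_le h0] with z hz hz0
        have : ∑ k ∈ Finset.range (N + 1), Complex.log z ^ k * u k z =
            (∑ k ∈ Finset.range (N + 1), Complex.log z ^ k * g k z) / g N z := by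
          rw [Finset.sum_div]
          refine Finset.sum_congr rfl fun k hk => ?_
          rcases Nat.lt_succ_iff_lt_or_eq.1 (Finset.mem_range.1 hk) with hk | rfl
          · simp [hu, hk, mul_div_assoc]
          · simp [hu, hz0]
        rw [this, hz, zero_div]
      have hder := eventually_hasDerivAt_logSum (N + 1) u humer (by simp [hu])
      have hrel' : ∀ᶠ z in 𝓝[Complex.slitPlane] 0, ∑ k ∈ Finset.range N,
          Complex.log z ^ k * (deriv (u k) z + (k + 1) * u (k + 1) z / z) = 0 := by
        filter_upwards [hder, eventually_eventuallyEq_of_slit hrel] with z hz hz1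
        have h3 := (hz.congr_of_eventuallyEq hz1.symm).unique (hasDerivAt_const z (0 : ℂ))
        rw [Finset.sum_range_succ, huN] at h3
        simpa [hu] using h3
      have hcoef := ih (fun k z => deriv (u k) z + (k + 1) * u (k + 1) z / z) (fun k =>
        (humer k).deriv.fun_add ((MeromorphicAt.fun_mul (MeromorphicAt.const _ _)
          (humer _)).fun_div (MeromorphicAt.id 0))) hrel'
      rcases Nat.eq_zero_or_pos N with rfl | hN
      · obtain ⟨z, hz⟩ := hrel.exists
        simp [hu] at hz
      · have h4 := hcoef (N - 1) (by omega)
        rw [Nat.sub_add_cancel hN, huN] at h4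
        have := residue_eq_zero (h := u (N - 1)) (r := fun _ => 0) (c := N) (a := 0) (humer _)
          analyticAt_const (by
            filter_upwards [h4] with z hz
            rw [Nat.cast_sub hN] at hz
            simpa using hz)
        exact hN.ne' (by exact_mod_cast this)

/-! ### Linear independence of singular hyperlogarithms modulo regular functions -/

/-- Words `0…0 β v` with `0 < |β| < ε`. -/
def IsSingWord (ε : ℝ) (w : List ℂ) : Prop :=
  ∃ (l : ℕ) (β : ℂ) (v : List ℂ), w = List.replicate l 0 ++ β :: v ∧ β ≠ 0 ∧ ‖β‖ < ε

lemma IsSingWord.ne_nil {ε : ℝ} {w : List ℂ} (hw : IsSingWord ε w) : w ≠ [] := by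
  obtain ⟨l, β, v, rfl, -⟩ := hw
  simp

lemma dropLast_append_getLastD {w : List ℂ} (hw : w ≠ []) : w.dropLast ++ [w.getLastD 0] = w := by
  obtain ⟨v, a, rfl⟩ := (List.eq_nil_or_concat' w).resolve_left hw
  simp

lemma eq_of_dropLast_eq {v w : List ℂ} (hv : v ≠ []) (hw : w ≠ [])
    (h : v.dropLast = w.dropLast) (h' : v.getLastD 0 = w.getLastD 0) : v = w := by
  rw [← dropLast_append_getLastD hv, ← dropLast_append_getLastD hw, h, h']

/-- The two fates of a term under differentiation: it stays among the singular hyperlogarithms, or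
it becomes a power of the logarithm over `z - β` with `0 < |β| < ε` and moves to the regular side.
-/
lemma IsSingWord.dropLast_cases {ε : ℝ} {w : List ℂ} (hw : IsSingWord ε w) :
    IsSingWord ε w.dropLast ∨ (w.dropLast = List.replicate (w.length - 1) 0 ∧
      w.getLastD 0 ≠ 0 ∧ ‖w.getLastD 0‖ < ε) := by
  obtain ⟨l, β, v, rfl, h0, h1⟩ := hw
  rcases List.eq_nil_or_concat' v with rfl | ⟨v, a, rfl⟩
  · right
    simp [h0, h1]
  · left
    refine ⟨l, β, v, ?_, h0, h1⟩
    rw [← List.cons_append, ← List.append_assoc, List.dropLast_concat]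

lemma eventually_hasDerivAt_hyperlog {w : List ℂ} (hw : w ≠ []) :
    ∀ᶠ z in 𝓝[Complex.slitPlane] 0,
      HasDerivAt (hyperlog w) (hyperlog w.dropLast z / (z - w.getLastD 0)) z := by
  obtain ⟨ρ, hρ, h⟩ := exists_radius w
  filter_upwards [slitBall_mem_nhdsWithin hρ] with z hz
  have := hasDerivAt_hyperlog hρ (w := w.dropLast) (a := w.getLastD 0)
    (by rwa [dropLast_append_getLastD hw]) hz
  rwa [dropLast_append_getLastD hw] at this

/-- The independence statement for words of length at most `n`, at most `m` of them of length
`n`. -/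
def SingIndep (ε : ℝ) (n m : ℕ) : Prop :=
  ∀ (W : Finset (List ℂ)) (φ : List ℂ → ℂ → ℂ) (N : ℕ) (g : ℕ → ℂ → ℂ),
    (∀ w ∈ W, IsSingWord ε w) → (∀ w, Meromorphic (φ w)) → (∀ w ∈ W, w.length ≤ n) →
    (W.filter fun w => w.length = n).card ≤ m →
    (∀ k, MeromorphicOn (g k) (Metric.ball 0 ε)) → (∀ k, N ≤ k → g k = 0) →
    (∀ᶠ z in 𝓝[Complex.slitPlane] 0, ∑ w ∈ W, φ w z * hyperlog w z =
      ∑ k ∈ Finset.range N, Complex.log z ^ k * g k z) →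
    ∀ w ∈ W, ∀ᶠ z in 𝓝[≠] 0, φ w z = 0

lemma Meromorphic.fun_sum_div {ι : Type*} (T : Finset ι) {ψ : ι → ℂ → ℂ}
    (hψ : ∀ i, Meromorphic (ψ i)) (a : ι → ℂ) :
    Meromorphic fun z => ∑ i ∈ T, ψ i z / (z - a i) := fun x =>
  MeromorphicAt.fun_sum fun i _ => (hψ i x).fun_div ((MeromorphicAt.id x).fun_sub (.const _ _))

-- The inductive step of independence. Differentiating a relation with top coefficient `1` yields a
-- smaller relation, in which all coefficients vanish by induction. The residue at the last letter
-- of `w₀` contradicts one of the resulting identities.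
open Classical in
lemma not_normalized_relation {ε : ℝ} (hε : 0 < ε) {n m : ℕ} (ih : SingIndep ε n m)
    (W : Finset (List ℂ)) (ψ : List ℂ → ℂ → ℂ) (N : ℕ) (g : ℕ → ℂ → ℂ) (w₀ : List ℂ)
    (hW : ∀ w ∈ W, IsSingWord ε w) (hψ : ∀ w, Meromorphic (ψ w)) (hlen : ∀ w ∈ W, w.length ≤ n)
    (hcard : (W.filter fun w => w.length = n).card ≤ m + 1)
    (hg : ∀ k, MeromorphicOn (g k) (Metric.ball 0 ε)) (hgN : ∀ k, N ≤ k → g k = 0)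
    (hrel : ∀ᶠ z in 𝓝[Complex.slitPlane] 0, ∑ w ∈ W, ψ w z * hyperlog w z =
      ∑ k ∈ Finset.range N, Complex.log z ^ k * g k z)
    (hw₀ : w₀ ∈ W) (hw₀n : w₀.length = n) (hψ₀ : ψ w₀ = fun _ => 1) : False := by
  have h0ε : (0 : ℂ) ∈ Metric.ball 0 ε := Metric.mem_ball_self hε
  have hn : 0 < n := by
    rw [← hw₀n]; exact List.length_pos_iff.2 (hW w₀ hw₀).ne_nil
  -- the differentiated relation
  set V : Finset (List ℂ) := W.erase w₀ ∪ (W.image List.dropLast).filter (IsSingWord ε) with hV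
  set χ : List ℂ → ℂ → ℂ := fun u z => deriv (if u ∈ W.erase w₀ then ψ u else 0) z +
    ∑ w ∈ W.filter (fun w => w.dropLast = u), ψ w z / (z - w.getLastD 0) with hχ
  set g' : ℕ → ℂ → ℂ := fun k z => deriv (g k) z + (k + 1) * g (k + 1) z / z -
    (k.factorial : ℂ)⁻¹ * ∑ w ∈ W.filter (fun w => ¬ IsSingWord ε w.dropLast ∧ w.length = k + 1),
      ψ w z / (z - w.getLastD 0) with hg'
  have hdl : ∀ w ∈ W, w.dropLast.length < n := fun w hw => by
    have := List.length_pos_iff.2 (hW w hw).ne_nil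
    have := hlen w hw
    rw [List.length_dropLast]; omega
  have hχmer : ∀ u, Meromorphic (χ u) := by
    intro u x
    refine MeromorphicAt.fun_add (MeromorphicAt.deriv ?_) (Meromorphic.fun_sum_div _ hψ _ x)
    split_ifs
    · exact hψ u x
    · exact MeromorphicAt.const 0 x
  have hg'mer : ∀ k, MeromorphicOn (g' k) (Metric.ball 0 ε) := by
    intro k x hx
    refine MeromorphicAt.fun_sub (((hg k) x hx).deriv.fun_add
      (((MeromorphicAt.const _ _).fun_mul (hg _ x hx)).fun_div (MeromorphicAt.id x))) ?_
    exact (MeromorphicAt.const _ _).fun_mul (Meromorphic.fun_sum_div _ hψ _ x)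
  have hg'N : ∀ k, max N n ≤ k → g' k = 0 := by
    intro k hk
    have hf : W.filter (fun w => ¬ IsSingWord ε w.dropLast ∧ w.length = k + 1) = ∅ := by
      refine Finset.filter_eq_empty_iff.2 fun w hw h => ?_
      have := hlen w hw
      have := (le_max_right N n).trans hk
      omega
    ext z
    simp only [hg', hf, hgN k ((le_max_left _ _).trans hk),
      hgN (k + 1) (((le_max_left N n).trans hk).trans (Nat.le_succ k))]
    simp
  have hrel' : ∀ᶠ z in 𝓝[Complex.slitPlane] 0, ∑ u ∈ V, χ u z * hyperlog u z =
      ∑ k ∈ Finset.range (max N n), Complex.log z ^ k * g' k z := by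
    have hd1 : ∀ᶠ z in 𝓝[Complex.slitPlane] 0, ∀ w ∈ W, HasDerivAt (ψ w) (deriv (ψ w) z) z :=
      (Finset.eventually_all _).2 fun w _ =>
        MeromorphicAt.eventually_hasDerivAt_slit (hψ w 0)
    have hd2 : ∀ᶠ z in 𝓝[Complex.slitPlane] 0, ∀ w ∈ W,
        HasDerivAt (hyperlog w) (hyperlog w.dropLast z / (z - w.getLastD 0)) z :=
      (Finset.eventually_all _).2 fun w hw => eventually_hasDerivAt_hyperlog (hW w hw).ne_nil
    have hd3 := eventually_hasDerivAt_logSum N g (fun k => hg k 0 h0ε) (hgN N le_rfl)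
    filter_upwards [hd1, hd2, hd3, eventually_eventuallyEq_of_slit hrel] with z h1 h2 h3 h4
    have h5 := HasDerivAt.fun_sum fun w hw => (h1 w hw).fun_mul (h2 w hw)
    have h6 := (h3.congr_of_eventuallyEq h4).unique h5
    rw [Finset.sum_add_distrib] at h6
    have e1 : ∑ w ∈ W, deriv (ψ w) z * hyperlog w z =
        ∑ u ∈ V, deriv (if u ∈ W.erase w₀ then ψ u else 0) z * hyperlog u z := by
      rw [← Finset.add_sum_erase W _ hw₀, hψ₀]
      simp only [deriv_const, zero_mul, zero_add]
      rw [← Finset.sum_subset (s₁ := W.erase w₀) Finset.subset_union_left fun u _ hu => by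
        rw [if_neg hu]; simp]
      exact Finset.sum_congr rfl fun u hu => by rw [if_pos hu]
    have e2 : ∑ w ∈ W.filter (fun w => IsSingWord ε w.dropLast),
        ψ w z * (hyperlog w.dropLast z / (z - w.getLastD 0)) =
        ∑ u ∈ V, (∑ w ∈ W.filter (fun w => w.dropLast = u), ψ w z / (z - w.getLastD 0)) *
          hyperlog u z := by
      rw [← Finset.sum_fiberwise_of_maps_to (g := List.dropLast) (t := V) fun w hw => by
        rw [Finset.mem_filter] at hw
        exact Finset.mem_union_right _ (Finset.mem_filter.2
          ⟨Finset.mem_image_of_mem _ hw.1, hw.2⟩)]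
      refine Finset.sum_congr rfl fun u hu => ?_
      have hus : IsSingWord ε u := by
        rcases Finset.mem_union.1 hu with h | h
        · exact hW u (Finset.mem_of_mem_erase h)
        · exact (Finset.mem_filter.1 h).2
      rw [Finset.sum_mul, Finset.filter_filter]
      refine Finset.sum_congr ?_ fun w hw => ?_
      · refine Finset.filter_congr fun w _ => ⟨fun h => h.2, fun h => ⟨by rwa [h], h⟩⟩
      · rw [← (Finset.mem_filter.1 hw).2]; ring
    have e3 : ∑ w ∈ W.filter (fun w => ¬ IsSingWord ε w.dropLast),
        ψ w z * (hyperlog w.dropLast z / (z - w.getLastD 0)) =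
        ∑ k ∈ Finset.range (max N n), Complex.log z ^ k * ((k.factorial : ℂ)⁻¹ *
          ∑ w ∈ W.filter (fun w => ¬ IsSingWord ε w.dropLast ∧ w.length = k + 1),
            ψ w z / (z - w.getLastD 0)) := by
      rw [← Finset.sum_fiberwise_of_maps_to (g := fun w => w.length - 1)
        (t := Finset.range (max N n)) fun w hw => by
          have h7 := hdl w (Finset.mem_filter.1 hw).1
          rw [List.length_dropLast] at h7
          exact Finset.mem_range.2 (h7.trans_le (le_max_right _ _))]
      refine Finset.sum_congr rfl fun k _ => ?_
      rw [Finset.mul_sum, Finset.mul_sum, Finset.filter_filter]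
      refine Finset.sum_congr ?_ fun w hw => ?_
      · refine Finset.filter_congr fun w hw => and_congr_right fun _ => ?_
        have := List.length_pos_iff.2 (hW w hw).ne_nil
        omega
      · obtain ⟨hw1, hw2, hw3⟩ := Finset.mem_filter.1 hw
        have h8 := ((hW w hw1).dropLast_cases.resolve_left hw2).1
        rw [h8, hyperlog_replicate_zero, hw3, Nat.add_sub_cancel]
        ring
    rw [e1, ← Finset.sum_filter_add_sum_filter_not W (fun w => IsSingWord ε w.dropLast), e2,
      e3] at h6
    have h7 : ∑ u ∈ V, χ u z * hyperlog u z =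
        ∑ u ∈ V, deriv (if u ∈ W.erase w₀ then ψ u else 0) z * hyperlog u z +
        ∑ u ∈ V, (∑ w ∈ W.filter (fun w => w.dropLast = u), ψ w z / (z - w.getLastD 0)) *
          hyperlog u z := by
      rw [← Finset.sum_add_distrib]
      exact Finset.sum_congr rfl fun u _ => by simp only [hχ]; ring
    have h8 : ∑ k ∈ Finset.range N, Complex.log z ^ k *
        (deriv (g k) z + (k + 1) * g (k + 1) z / z) =
        ∑ k ∈ Finset.range (max N n), Complex.log z ^ k *
        (deriv (g k) z + (k + 1) * g (k + 1) z / z) := by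
      refine Finset.sum_subset (Finset.range_mono (le_max_left _ _)) fun k _ hk => ?_
      rw [Finset.mem_range, not_lt] at hk
      rw [hgN k hk, hgN (k + 1) (hk.trans (Nat.le_succ k))]
      simp
    rw [h7]
    simp only [hg', mul_sub, Finset.sum_sub_distrib]
    rw [← h8, h6]
    ring
  have hVlen : ∀ u ∈ V, u.length ≤ n := by
    intro u hu
    rcases Finset.mem_union.1 hu with h | h
    · exact hlen u (Finset.mem_of_mem_erase h)
    · obtain ⟨w, hw, rfl⟩ := Finset.mem_image.1 (Finset.mem_filter.1 h).1
      exact (hdl w hw).le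
  have hVsing : ∀ u ∈ V, IsSingWord ε u := by
    intro u hu
    rcases Finset.mem_union.1 hu with h | h
    · exact hW u (Finset.mem_of_mem_erase h)
    · exact (Finset.mem_filter.1 h).2
  -- The coefficient `1` of `w₀` has derivative `0` and shortened words are too short to count, so
  -- one top word is gone.
  have hVcard : (V.filter fun w => w.length = n).card ≤ m := by
    have hsub : (V.filter fun w => w.length = n) ⊆ (W.filter fun w => w.length = n).erase w₀ := by
      intro u hu
      obtain ⟨hu, hun⟩ := Finset.mem_filter.1 hu
      rcases Finset.mem_union.1 hu with h | h
      · exact Finset.mem_erase.2 ⟨Finset.ne_of_mem_erase h,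
          Finset.mem_filter.2 ⟨Finset.mem_of_mem_erase h, hun⟩⟩
      · obtain ⟨w, hw, rfl⟩ := Finset.mem_image.1 (Finset.mem_filter.1 h).1
        exact absurd hun (hdl w hw).ne
    have := Finset.card_le_card hsub
    rw [Finset.card_erase_of_mem (Finset.mem_filter.2 ⟨hw₀, hw₀n⟩)] at this
    omega
  have hχ0 := ih V χ (max N n) g' hVsing hχmer hVlen hVcard hg'mer hg'N hrel'
  have hg'0 : ∀ k, ∀ᶠ z in 𝓝[≠] 0, g' k z = 0 := by
    intro k
    rcases lt_or_ge k (max N n) with hk | hk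
    · refine log_pow_independent (max N n) g' (fun k => hg'mer k 0 h0ε) ?_ k hk
      have : ∀ᶠ z in 𝓝[Complex.slitPlane] 0, ∀ u ∈ V, χ u z = 0 :=
        (Finset.eventually_all _).2 fun u hu => nhdsWithin_slitPlane_le (hχ0 u hu)
      filter_upwards [this, hrel'] with z h1 h2
      rw [← h2]
      exact Finset.sum_eq_zero fun u hu => by rw [h1 u hu, zero_mul]
    · rw [hg'N k hk]; simp
  -- the coefficients of the other top words are constant
  have hconst : ∀ w ∈ W, w.length = n → w ≠ w₀ → ∀ x, ∃ c, ∀ᶠ z in 𝓝[≠] x, ψ w z = c := by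
    intro w hw hwn hne x
    refine eventually_eq_const_of_deriv_eq_zero (hψ w x) ?_
    refine MeromorphicOn.eventually_eq_zero (U := Set.univ)
      (fun y _ => (hψ w y).deriv) isPreconnected_univ (Set.mem_univ 0) (Set.mem_univ x) ?_
    have hwe : w ∈ W.erase w₀ := Finset.mem_erase.2 ⟨hne, hw⟩
    filter_upwards [hχ0 w (Finset.mem_union_left _ hwe)] with z hz
    have hf : W.filter (fun v => v.dropLast = w) = ∅ := by
      refine Finset.filter_eq_empty_iff.2 fun v hv h => ?_
      have := hdl v hv
      rw [h] at this
      omega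
    simpa [hχ, hf, hne, hw] using hz
  -- If the shortened word `u` is singular, its coefficient is a derivative plus a sum over the
  -- words that extend `u` by one letter. These extensions have length `n`, so apart from `w₀` their
  -- coefficients are constant, and the residue at the last letter of `w₀` is `1`. This letter may
  -- lie anywhere, which is why the coefficients are meromorphic in the whole plane.
  by_cases hs : IsSingWord ε w₀.dropLast
  · set u := w₀.dropLast with hu
    have huV : u ∈ V := Finset.mem_union_right _
      (Finset.mem_filter.2 ⟨Finset.mem_image_of_mem _ hw₀, hs⟩)
    have h1 := MeromorphicOn.eventually_eq_zero (U := Set.univ) (fun y _ => hχmer u y)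
      isPreconnected_univ (Set.mem_univ 0) (Set.mem_univ (w₀.getLastD 0)) (hχ0 u huV)
    refine residue_sum_ne_zero (W.filter (fun w => w.dropLast = u)) w₀
      (Finset.mem_filter.2 ⟨hw₀, rfl⟩) (fun w => w.getLastD 0) ?_ ψ ?_ hψ₀ one_ne_zero
      (h := if u ∈ W.erase w₀ then ψ u else 0) (r := fun _ => 0) ?_ analyticAt_const ?_
    · intro w hw hne heq
      obtain ⟨hw1, hw2⟩ := Finset.mem_filter.1 hw
      exact hne (eq_of_dropLast_eq (hW w hw1).ne_nil (hW w₀ hw₀).ne_nil hw2 heq)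
    · intro w hw hne
      obtain ⟨hw1, hw2⟩ := Finset.mem_filter.1 hw
      refine hconst w hw1 ?_ hne _
      have h2 := congrArg List.length hw2
      rw [hu, List.length_dropLast, List.length_dropLast] at h2
      have := List.length_pos_iff.2 (hW w hw1).ne_nil
      omega
    · split_ifs
      · exact hψ u _
      · exact MeromorphicAt.const 0 _
    · filter_upwards [h1] with z hz
      simpa [hχ] using hz
  -- Here `w₀ = 0…0β`, and the contradiction comes from the coefficient of `(log z)^(n-1)` on the
  -- regular side. It can be examined at `β` because `|β| < ε`.
  · obtain ⟨hd, hb0, hbε⟩ := (hW w₀ hw₀).dropLast_cases.resolve_left hs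
    have hbm : w₀.getLastD 0 ∈ Metric.ball (0 : ℂ) ε := by simpa using hbε
    have hpre : IsPreconnected (Metric.ball (0 : ℂ) ε) := (convex_ball _ _).isPreconnected
    have hfil : ∀ k, n ≤ k →
        W.filter (fun w => ¬ IsSingWord ε w.dropLast ∧ w.length = k + 1) = ∅ := fun k hk => by
      refine Finset.filter_eq_empty_iff.2 fun w hw h => ?_
      have := hlen w hw
      omega
    -- Descending induction. For `k ≥ n` the differentiated relation reads `g_k' + (k+1) g_{k+1}/z =
    -- 0`. If `g_{k+1}` is constant, the residue at `0` forces the second term to vanish. In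
    -- particular `g_n` is constant, so `n g_n / z` is analytic at `β ≠ 0`.
    have hdz : ∀ k, n ≤ k → ∀ᶠ z in 𝓝[≠] 0, deriv (g k) z = 0 := by
      intro k hk
      have hN : ∀ j, N ≤ j → ∀ᶠ z in 𝓝[≠] (0 : ℂ), deriv (g j) z = 0 := fun j hj => by
        rw [hgN j hj]; simp
      rcases le_total N k with hkN | hkN
      · exact hN k hkN
      · induction hkN using Nat.decreasingInduction with
        | self => exact hN N le_rfl
        | of_succ j hj ihj =>
          obtain ⟨c, hc⟩ := eventually_eq_const_of_deriv_eq_zero (hg (j + 1) 0 h0ε)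
            (ihj (hk.trans (Nat.le_succ j)))
          have hj0 := hg'0 j
          have h2 : ∀ᶠ z in 𝓝[≠] (0 : ℂ), deriv (g j) z + (j + 1) * c / z = 0 := by
            filter_upwards [hj0, hc] with z hz hzc
            simpa [hg', hfil j hk, hzc] using hz
          have h3 := residue_eq_zero (h := g j) (r := fun _ => 0) (c := (j + 1) * c) (a := 0)
            (hg j 0 h0ε) analyticAt_const (by simpa using h2)
          filter_upwards [h2] with z hz
          simpa [h3] using hz
    obtain ⟨c, hc⟩ := eventually_eq_const_of_deriv_eq_zero (hg n _ hbm)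
      (MeromorphicOn.eventually_eq_zero (fun y hy => (hg n y hy).deriv) hpre h0ε hbm
        (hdz n le_rfl))
    have h1 := MeromorphicOn.eventually_eq_zero (hg'mer (n - 1)) hpre h0ε hbm (hg'0 (n - 1))
    have hn1 : n - 1 + 1 = n := Nat.sub_add_cancel hn
    refine residue_sum_ne_zero
      (W.filter (fun w => ¬ IsSingWord ε w.dropLast ∧ w.length = n - 1 + 1)) w₀
      (Finset.mem_filter.2 ⟨hw₀, hs, by omega⟩) (fun w => w.getLastD 0) ?_ ψ ?_ hψ₀
      (κ := -((n - 1).factorial : ℂ)⁻¹) (by simp [Nat.factorial_ne_zero])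
      (h := g (n - 1)) (r := fun z => (((n - 1 : ℕ) : ℂ) + 1) * c / z)
      (hg _ _ hbm) (analyticAt_const.div analyticAt_id hb0) ?_
    · intro w hw hne heq
      obtain ⟨hw1, hw2, hw3⟩ := Finset.mem_filter.1 hw
      refine hne (eq_of_dropLast_eq (hW w hw1).ne_nil (hW w₀ hw₀).ne_nil ?_ heq)
      rw [((hW w hw1).dropLast_cases.resolve_left hw2).1, hd, hw3, hw₀n, hn1]
    · intro w hw hne
      obtain ⟨hw1, hw2, hw3⟩ := Finset.mem_filter.1 hw
      exact hconst w hw1 (by omega) hne _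
    · filter_upwards [h1, hc] with z hz hzc
      simp only [hg'] at hz
      rw [hn1, hzc] at hz
      rw [hn1]
      linear_combination hz

-- Outer induction on the maximal length, inner induction on the number of words of that length. A
-- top coefficient that vanishes near `0` allows its word to be discarded; otherwise dividing by it
-- produces the normalized relation that cannot exist.
open Classical in
lemma singIndep {ε : ℝ} (hε : 0 < ε) (n m : ℕ) : SingIndep ε n m := by
  induction n generalizing m with
  | zero =>
    intro W φ N g hW _ hlen _ _ _ _ w hw
    exact absurd (List.length_eq_zero_iff.1 (Nat.le_zero.1 (hlen w hw))) (hW w hw).ne_nil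
  | succ n ihn =>
    have low : ∀ (W : Finset (List ℂ)), (∀ w ∈ W, w.length ≤ n + 1) →
        (W.filter fun w => w.length = n + 1) = ∅ → ∀ w ∈ W, w.length ≤ n := by
      intro W h1 h2 w hw
      have := Finset.filter_eq_empty_iff.1 h2 hw
      have := h1 w hw
      omega
    induction m with
    | zero =>
      intro W φ N g hW hφ hlen hcard hg hgN hrel
      exact ihn _ W φ N g hW hφ (low W hlen (Finset.card_eq_zero.1 (Nat.le_zero.1 hcard))) le_rfl
        hg hgN hrel
    | succ m ihm =>
      intro W φ N g hW hφ hlen hcard hg hgN hrel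
      rcases Finset.eq_empty_or_nonempty (W.filter fun w => w.length = n + 1) with he | ⟨w₀, hw₀⟩
      · exact ihn _ W φ N g hW hφ (low W hlen he) le_rfl hg hgN hrel
      obtain ⟨hw₀, hw₀n⟩ := Finset.mem_filter.1 hw₀
      rcases (hφ w₀ 0).eventually_eq_zero_or_eventually_ne_zero with h0 | h0
      · have h1 := ihm (W.erase w₀) φ N g (fun w hw => hW w (Finset.mem_of_mem_erase hw)) hφ
          (fun w hw => hlen w (Finset.mem_of_mem_erase hw)) (by
            rw [Finset.filter_erase, Finset.card_erase_of_mem (Finset.mem_filter.2 ⟨hw₀, hw₀n⟩)]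
            omega) hg hgN (by
            filter_upwards [hrel, nhdsWithin_slitPlane_le h0] with z hz hz0
            rw [← hz, ← Finset.add_sum_erase W _ hw₀, hz0]
            ring)
        intro w hw
        by_cases hne : w = w₀
        · rw [hne]; exact h0
        · exact h1 w (Finset.mem_erase.2 ⟨hne, hw⟩)
      · exfalso
        refine not_normalized_relation hε ihm W
          (fun w => if w = w₀ then fun _ => 1 else fun z => φ w z / φ w₀ z) N
          (fun k z => g k z / φ w₀ z) w₀ hW (fun w => ?_) hlen hcard
          (fun k x hx => (hg k x hx).fun_div (hφ w₀ x)) (fun k hk => ?_) ?_ hw₀ hw₀n (by simp)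
        · by_cases h : w = w₀
          · rw [if_pos h]; exact Meromorphic.const 1
          · rw [if_neg h]; exact fun x => (hφ w x).fun_div (hφ w₀ x)
        · ext z; simp [hgN k hk]
        · filter_upwards [hrel, nhdsWithin_slitPlane_le h0] with z hz hz0
          have : ∀ w, (if w = w₀ then fun _ => 1 else fun z => φ w z / φ w₀ z : ℂ → ℂ) z =
              φ w z / φ w₀ z := by
            intro w
            split_ifs with h
            · rw [h, div_self hz0]
            · rfl
          simp only [this, mul_div_assoc']
          rw [← Finset.sum_div, ← hz, Finset.sum_div]
          exact Finset.sum_congr rfl fun w _ => by ring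

/-- Singular hyperlogarithms are independent over the meromorphic functions modulo
polynomials in the logarithm with coefficients that are meromorphic near `0`. -/
theorem singular_hyperlog_independent {ε : ℝ} (hε : 0 < ε) (W : Finset (List ℂ))
    (φ : List ℂ → ℂ → ℂ) (N : ℕ) (g : ℕ → ℂ → ℂ) (hW : ∀ w ∈ W, IsSingWord ε w)
    (hφ : ∀ w, Meromorphic (φ w)) (hg : ∀ k, MeromorphicOn (g k) (Metric.ball 0 ε))
    (hrel : ∀ᶠ z in 𝓝[Complex.slitPlane] 0, ∑ w ∈ W, φ w z * hyperlog w z =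
      ∑ k ∈ Finset.range N, Complex.log z ^ k * g k z) :
    ∀ w ∈ W, ∀ᶠ z in 𝓝[≠] 0, φ w z = 0 := by
  classical
  -- The induction refers to `g (k + 1)`, so the family is first cut off to vanish from `N` on; the
  -- given `g` is arbitrary there.
  refine singIndep hε (W.sup List.length) _ W φ N (fun k => if k < N then g k else 0) hW hφ
    (fun w hw => Finset.le_sup (f := List.length) hw) le_rfl (fun k => ?_) (fun k hk => ?_) ?_
  · split_ifs
    · exact hg k
    · exact MeromorphicOn.const 0
  · rw [if_neg (not_lt.2 hk)]
  · filter_upwards [hrel] with z hz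
    rw [hz]
    exact Finset.sum_congr rfl fun k hk => by rw [if_pos (Finset.mem_range.1 hk)]

/-! ### Values of rational functions near `0` -/

lemma eventually_eval_ne_zero {p : Polynomial ℂ} (hp : p ≠ 0) (x : ℂ) :
    ∀ᶠ y in 𝓝[≠] x, p.eval y ≠ 0 := by
  have hs : (p.rootSet ℂ \ {x}).Finite := (Polynomial.rootSet_finite p ℂ).subset sdiff_le
  filter_upwards [nhdsWithin_le_nhds (hs.isClosed.isOpen_compl.mem_nhds (by simp)),
    self_mem_nhdsWithin] with y hy hyx h
  exact hy ⟨by simp [Polynomial.mem_rootSet, hp, h], hyx⟩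

lemma analyticAt_eval (p : Polynomial ℂ) (x : ℂ) : AnalyticAt ℂ (fun y => p.eval y) x :=
  AnalyticOnNhd.eval_polynomial p x (Set.mem_univ x)

lemma valueAt_eq (β : RatFunc ℂ) (y : ℂ) : valueAt β y = β.num.eval y / β.denom.eval y := by
  simp [valueAt, RatFunc.eval]

@[simp]
lemma valueAt_zero (y : ℂ) : valueAt 0 y = 0 := by simp [valueAt]

lemma eventually_analyticAt_valueAt (β : RatFunc ℂ) :
    ∀ᶠ y in 𝓝[≠] (0 : ℂ), AnalyticAt ℂ (valueAt β) y := by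
  filter_upwards [eventually_eval_ne_zero β.denom_ne_zero 0] with y hy
  rw [show valueAt β = fun y => β.num.eval y / β.denom.eval y from funext (valueAt_eq β)]
  exact (analyticAt_eval β.num y).div (analyticAt_eval _ y) hy

lemma denom_eval_zero_ne {β : RatFunc ℂ} (h : β.num.eval 0 = 0) : β.denom.eval 0 ≠ 0 := by
  intro h'
  obtain ⟨u, v, huv⟩ := β.isCoprime_num_denom
  have := congrArg (Polynomial.eval 0) huv
  simp [h, h'] at this

lemma analyticAt_valueAt_zero {β : RatFunc ℂ} (h : β.num.eval 0 = 0) :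
    AnalyticAt ℂ (valueAt β) 0 := by
  rw [show valueAt β = fun y => β.num.eval y / β.denom.eval y from funext (valueAt_eq β)]
  exact (analyticAt_eval β.num 0).div (analyticAt_eval _ 0)
    (denom_eval_zero_ne h)

lemma valueAt_at_zero {β : RatFunc ℂ} (h : β.num.eval 0 = 0) : valueAt β 0 = 0 := by
  rw [valueAt_eq, h, zero_div]

/-- Working with `1/β` treats a finite non-zero value at `0` and a pole at `0` together. -/
lemma exists_analytic_inv_valueAt {β : RatFunc ℂ} (h : β.num.eval 0 ≠ 0) :
    ∃ k : ℂ → ℂ, AnalyticAt ℂ k 0 ∧ ∀ᶠ y in 𝓝[≠] (0 : ℂ), k y * valueAt β y = 1 := by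
  refine ⟨fun y => β.denom.eval y / β.num.eval y,
    (analyticAt_eval _ 0).div (analyticAt_eval _ 0) h, ?_⟩
  have hn : β.num ≠ 0 := by rintro h0; simp [h0] at h
  filter_upwards [eventually_eval_ne_zero hn 0, eventually_eval_ne_zero β.denom_ne_zero 0]
    with y h1 h2
  rw [valueAt_eq]
  field_simp

lemma eval_num_mul_eq {p q : Polynomial ℂ} (hq : q ≠ 0) (y : ℂ) :
    (algebraMap _ (RatFunc ℂ) p / algebraMap _ _ q).num.eval y * q.eval y =
      p.eval y * (algebraMap _ (RatFunc ℂ) p / algebraMap _ _ q).denom.eval y := by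
  have h := (RatFunc.num_mul_eq_mul_denom_iff (K := ℂ)
    (x := algebraMap _ _ p / algebraMap _ _ q) hq).2 rfl
  simpa using congrArg (Polynomial.eval y) h

lemma valueAt_div {p q : Polynomial ℂ} {y : ℂ} (hy : q.eval y ≠ 0) :
    valueAt (algebraMap _ _ p / algebraMap _ _ q) y = p.eval y / q.eval y := by
  have hq : q ≠ 0 := by rintro rfl; simp at hy
  have hd : (algebraMap _ (RatFunc ℂ) p / algebraMap _ _ q).denom.eval y ≠ 0 := by
    obtain ⟨r, hr⟩ := RatFunc.denom_div_dvd p q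
    intro h0
    rw [hr, Polynomial.eval_mul, h0, zero_mul] at hy
    exact hy rfl
  rw [valueAt_eq, div_eq_div_iff hd hy]
  exact eval_num_mul_eq hq y

/-- The polynomial `a X + b`. -/
def linPoly (a b : ℂ) : Polynomial ℂ := Polynomial.C a * Polynomial.X + Polynomial.C b

@[simp]
lemma linPoly_eval (a b y : ℂ) : (linPoly a b).eval y = a * y + b := by simp [linPoly]

lemma linPoly_ne_zero {a b : ℂ} (h : a ≠ 0 ∨ b ≠ 0) : linPoly a b ≠ 0 := by
  intro h0
  have h1 := congrArg (fun p => Polynomial.coeff p 0) h0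
  have h2 := congrArg (fun p => Polynomial.coeff p 1) h0
  simp [linPoly] at h1 h2
  tauto

lemma FLT.exists_linPoly {F : Subfield ℂ} {β : RatFunc ℂ} (hβ : β ∈ FLT F) :
    ∃ a ∈ F, ∃ b ∈ F, ∃ c ∈ F, ∃ d ∈ F, (c ≠ 0 ∨ d ≠ 0) ∧
      β = algebraMap _ _ (linPoly a b) / algebraMap _ _ (linPoly c d) := by
  obtain ⟨a, ha, b, hb, c, hc, d, hd, h, rfl⟩ := hβ
  refine ⟨a, ha, b, hb, c, hc, d, hd, h, ?_⟩
  simp [linPoly, RatFunc.algebraMap_C, RatFunc.algebraMap_X]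

lemma zero_mem_FLT (F : Subfield ℂ) : (0 : RatFunc ℂ) ∈ FLT F :=
  ⟨0, F.zero_mem, 0, F.zero_mem, 0, F.zero_mem, 1, F.one_mem, Or.inr one_ne_zero, by simp⟩

lemma C_mem_FLT {F : Subfield ℂ} {b : ℂ} (hb : b ∈ F) : RatFunc.C b ∈ FLT F :=
  ⟨0, F.zero_mem, b, hb, 0, F.zero_mem, 1, F.one_mem, Or.inr one_ne_zero, by simp⟩

lemma mem_of_C_mem_FLT {F : Subfield ℂ} {b : ℂ} (hb : RatFunc.C b ∈ FLT F) : b ∈ F := by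
  obtain ⟨a, ha, b', hb', c, hc, d, hd, h, e⟩ := FLT.exists_linPoly hb
  have hq := linPoly_ne_zero h
  rw [eq_div_iff (RatFunc.algebraMap_ne_zero hq), ← RatFunc.algebraMap_C, ← map_mul] at e
  have e' := RatFunc.algebraMap_injective ℂ e
  have h1 := congrArg (fun p => Polynomial.coeff p 0) e'
  have h2 := congrArg (fun p => Polynomial.coeff p 1) e'
  simp [linPoly] at h1 h2
  rcases h with h | h
  · rw [eq_div_of_mul_eq h h2]; exact F.div_mem ha hc
  · rw [eq_div_of_mul_eq h h1]; exact F.div_mem hb' hd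

/-- A non-zero fractional linear letter is bounded below by a multiple of `|y|`. -/
lemma FLT.exists_le_norm_valueAt {F : Subfield ℂ} {β : RatFunc ℂ} (hβ : β ∈ FLT F) (h0 : β ≠ 0) :
    ∃ c > 0, ∀ᶠ y in 𝓝[≠] (0 : ℂ), c * ‖y‖ ≤ ‖valueAt β y‖ := by
  by_cases hs : β.num.eval 0 = 0
  · obtain ⟨a, -, b, -, c, -, d, -, hcd, rfl⟩ := FLT.exists_linPoly hβ
    have hq := linPoly_ne_zero hcd
    have h1 := eval_num_mul_eq (p := linPoly a b) hq 0
    rw [hs, zero_mul] at h1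
    -- A letter that vanishes at `0` has the form `a y / (c y + d)` with `a ≠ 0`; for `|y| < 1` the
    -- denominator is at most `|c| + |d|`.
    have hb : b = 0 := by
      have := (mul_eq_zero.1 h1.symm).resolve_right (denom_eval_zero_ne hs)
      simpa using this
    subst hb
    have ha : a ≠ 0 := by
      rintro rfl
      exact h0 (by simp [linPoly])
    have hpos : 0 < ‖c‖ + ‖d‖ := by
      rcases hcd with h | h
      · have := norm_pos_iff.2 h; positivity
      · have := norm_pos_iff.2 h; positivity
    have ha' := norm_pos_iff.2 ha
    refine ⟨‖a‖ / (‖c‖ + ‖d‖), by positivity, ?_⟩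
    filter_upwards [eventually_eval_ne_zero hq 0,
      nhdsWithin_le_nhds (Metric.ball_mem_nhds (0 : ℂ) one_pos)] with y hy hy1
    rw [valueAt_div hy, norm_div, div_mul_eq_mul_div, ← norm_mul]
    simp only [linPoly_eval, add_zero] at hy ⊢
    have h2 : ‖c * y + d‖ ≤ ‖c‖ + ‖d‖ := by
      refine (norm_add_le _ _).trans ?_
      rw [norm_mul]
      have : ‖y‖ < 1 := by simpa using hy1
      nlinarith [norm_nonneg c]
    exact div_le_div_of_nonneg_left (norm_nonneg _) (norm_pos_iff.2 hy) h2
  · obtain ⟨k, hk, hk1⟩ := exists_analytic_inv_valueAt hs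
    have hb := hk.continuousAt.norm.eventually_lt_const (lt_add_one ‖k 0‖)
    have hp : 0 < ‖k 0‖ + 1 := by positivity
    refine ⟨1 / (‖k 0‖ + 1), by positivity, ?_⟩
    filter_upwards [hk1, nhdsWithin_le_nhds hb,
      nhdsWithin_le_nhds (Metric.ball_mem_nhds (0 : ℂ) one_pos)] with y h1 h2 h3
    have h4 : ‖y‖ < 1 := by simpa using h3
    have h5 : ‖k y‖ * ‖valueAt β y‖ = 1 := by rw [← norm_mul, h1, norm_one]
    rw [div_mul_eq_mul_div, one_mul, div_le_iff₀ hp]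
    nlinarith [norm_nonneg (valueAt β y), norm_nonneg y]

/-! ### Spans of functions up to eventual equality -/

/-- The filter of points of the slit plane near `0`. -/
abbrev slitNhds : Filter ℂ := 𝓝[Complex.slitPlane] 0

/-- `f` agrees along `l` with an element of the span of `X`. -/
def EvSpan {ι : Type*} (l : Filter ι) (X : Set (ι → ℂ)) (f : ι → ℂ) : Prop :=
  ∃ g ∈ Submodule.span ℂ X, f =ᶠ[l] g

lemma EvSpan.of_mem {ι : Type*} {l : Filter ι} {X : Set (ι → ℂ)} {f : ι → ℂ} (hf : f ∈ X) :
    EvSpan l X f :=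
  ⟨f, Submodule.subset_span hf, EventuallyEq.rfl⟩

lemma EvSpan.congr {ι : Type*} {l : Filter ι} {X : Set (ι → ℂ)} {f g : ι → ℂ} (hf : EvSpan l X f)
    (h : ∀ᶠ y in l, g y = f y) : EvSpan l X g := by
  obtain ⟨k, hk, e⟩ := hf
  exact ⟨k, hk, EventuallyEq.trans h e⟩

lemma EvSpan.add {ι : Type*} {l : Filter ι} {X : Set (ι → ℂ)} {f g : ι → ℂ} (hf : EvSpan l X f)
    (hg : EvSpan l X g) :
    EvSpan l X (fun y => f y + g y) := by
  obtain ⟨k, hk, e⟩ := hf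
  obtain ⟨l, hl, e'⟩ := hg
  exact ⟨k + l, add_mem hk hl, e.add e'⟩

lemma EvSpan.const_mul {ι : Type*} {l : Filter ι} {X : Set (ι → ℂ)} {f : ι → ℂ} (c : ℂ)
    (hf : EvSpan l X f) :
    EvSpan l X (fun y => c * f y) := by
  obtain ⟨k, hk, e⟩ := hf
  exact ⟨c • k, Submodule.smul_mem _ c hk, e.const_smul c⟩

lemma EvSpan.neg {ι : Type*} {l : Filter ι} {X : Set (ι → ℂ)} {f : ι → ℂ} (hf : EvSpan l X f) :
    EvSpan l X (fun y => -f y) := by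
  simpa using hf.const_mul (-1)

lemma EvSpan.sub {ι : Type*} {l : Filter ι} {X : Set (ι → ℂ)} {f g : ι → ℂ} (hf : EvSpan l X f)
    (hg : EvSpan l X g) :
    EvSpan l X (fun y => f y - g y) := by
  simpa [sub_eq_add_neg] using hf.add hg.neg

lemma EvSpan.zero {ι : Type*} (l : Filter ι) (X : Set (ι → ℂ)) : EvSpan l X (fun _ => 0) :=
  ⟨0, Submodule.zero_mem _, EventuallyEq.rfl⟩

lemma EvSpan.induction {ι : Type*} {l : Filter ι} {X : Set (ι → ℂ)} {P : (ι → ℂ) → Prop}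
    (congr : ∀ f g, P f → (∀ᶠ y in l, g y = f y) → P g)
    (mem : ∀ f ∈ X, P f) (zero : P fun _ => 0) (add : ∀ f g, P f → P g → P fun y => f y + g y)
    (smul : ∀ (c : ℂ) f, P f → P fun y => c * f y) {f : ι → ℂ} (hf : EvSpan l X f) : P f := by
  obtain ⟨k, hk, e⟩ := hf
  refine congr k f ?_ e
  clear e
  induction hk using Submodule.span_induction with
  | mem x hx => exact mem x hx
  | zero => exact zero
  | add x y _ _ hx hy => exact add x y hx hy
  | smul c x _ hx => exact smul c x hx

/-- If `m * x ∈ EvSpan l Y` for all `x ∈ X`, then `m` maps `EvSpan l X` to `EvSpan l Y`. -/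
lemma EvSpan.mul_of_forall {ι : Type*} {l : Filter ι} {X Y : Set (ι → ℂ)} {m : ι → ℂ}
    (h : ∀ x ∈ X, EvSpan l Y fun y => m y * x y) {f : ι → ℂ} (hf : EvSpan l X f) :
    EvSpan l Y fun y => m y * f y := by
  refine hf.induction (P := fun f => EvSpan l Y fun y => m y * f y) ?_ h ?_ ?_ ?_
  · intro f g hf hg
    exact hf.congr (by filter_upwards [hg] with y hy; rw [hy])
  · simpa using EvSpan.zero l Y
  · intro f g hf hg
    exact (hf.add hg).congr (Eventually.of_forall fun y => mul_add _ _ _)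
  · intro c f hf
    exact (hf.const_mul c).congr (Eventually.of_forall fun y => by ring)

/-! ### Hyperlogarithms in one variable with letters in a field -/

/-- Hyperlogarithms with letters in `F`. -/
def hyperlogs (F : Subfield ℂ) : Set (ℂ → ℂ) :=
  {f | ∃ v : List ℂ, (∀ b ∈ v, b ∈ F) ∧ f = hyperlog v}

/-- Quotients `L_v(y) / (y - b)`. -/
def hyperlogForms (F : Subfield ℂ) : Set (ℂ → ℂ) :=
  {f | ∃ v : List ℂ, (∀ b ∈ v, b ∈ F) ∧ ∃ b ∈ F, f = fun y => (y - b)⁻¹ * hyperlog v y}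

/-- Simple poles `1 / (y - b)`. -/
def simplePoles (F : Subfield ℂ) : Set (ℂ → ℂ) := {f | ∃ b ∈ F, f = fun y => (y - b)⁻¹}

lemma hyperlogs_const (F : Subfield ℂ) (c : ℂ) : EvSpan slitNhds (hyperlogs F) fun _ => c := by
  have h : EvSpan slitNhds (hyperlogs F) (hyperlog []) := EvSpan.of_mem ⟨[], by simp, rfl⟩
  simpa [hyperlog_nil] using h.const_mul c

/-- A primitive of `L_v(y)/(y - b)` is `L_{vb}(y)`. The constant of integration is a multiple of the
empty hyperlogarithm `1`, so the behaviour of `f` at `0` need not be known. -/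
lemma hyperlogs_primitive {F : Subfield ℂ} {f f' : ℂ → ℂ} (hf' :
    EvSpan slitNhds (hyperlogForms F) f')
    (hf : ∀ᶠ y in 𝓝[Complex.slitPlane] 0, HasDerivAt f (f' y) y) :
        EvSpan slitNhds (hyperlogs F) f := by
  have key : ∃ g, EvSpan slitNhds (hyperlogs F) g ∧
      ∀ᶠ y in 𝓝[Complex.slitPlane] 0, HasDerivAt g (f' y) y := by
    clear hf
    refine hf'.induction (P := fun f' => ∃ g, EvSpan slitNhds (hyperlogs F) g ∧
      ∀ᶠ y in 𝓝[Complex.slitPlane] 0, HasDerivAt g (f' y) y) ?_ ?_ ?_ ?_ ?_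
    · rintro f g ⟨k, h1, h2⟩ h3
      refine ⟨k, h1, ?_⟩
      filter_upwards [h2, h3] with y h2 h3 using h3 ▸ h2
    · rintro f ⟨v, hv, b, hb, rfl⟩
      refine ⟨hyperlog (v ++ [b]), EvSpan.of_mem ⟨v ++ [b], ?_, rfl⟩, ?_⟩
      · intro x hx
        rcases List.mem_append.1 hx with h | h
        · exact hv x h
        · rw [List.mem_singleton.1 h]; exact hb
      · obtain ⟨ρ, hρ, h⟩ := exists_radius (v ++ [b])
        filter_upwards [slitBall_mem_nhdsWithin hρ] with z hz
        exact (hasDerivAt_hyperlog hρ h hz).congr_deriv (div_eq_inv_mul _ _)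
    · exact ⟨fun _ => 0, EvSpan.zero _ _, Eventually.of_forall fun y => hasDerivAt_const y 0⟩
    · rintro f g ⟨k, h1, h2⟩ ⟨l, h3, h4⟩
      refine ⟨_, h1.add h3, ?_⟩
      filter_upwards [h2, h4] with y h2 h4 using h2.add h4
    · rintro c f ⟨k, h1, h2⟩
      refine ⟨_, h1.const_mul c, ?_⟩
      filter_upwards [h2] with y h2 using h2.const_mul c
  obtain ⟨g, hg, hg'⟩ := key
  obtain ⟨ρ, hρ, h⟩ := mem_nhdsWithin_slitPlane_iff.1 (hf.and hg')
  obtain ⟨c, hc⟩ := exists_sub_eq_const_of_hasDerivAt hρ (fun z hz => (h hz).1)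
    (fun z hz => (h hz).2)
  refine (hg.add (hyperlogs_const F c)).congr ?_
  filter_upwards [slitBall_mem_nhdsWithin hρ] with z hz
  rw [← hc z hz]; ring

lemma hyperlogForms_of_hyperlogs {F : Subfield ℂ} {f : ℂ → ℂ} {b : ℂ} (hb : b ∈ F)
    (hf : EvSpan slitNhds (hyperlogs F) f) :
        EvSpan slitNhds (hyperlogForms F) fun y => (y - b)⁻¹ * f y :=
  hf.mul_of_forall (by rintro _ ⟨v, hv, rfl⟩; exact EvSpan.of_mem ⟨v, hv, b, hb, rfl⟩)

/-- The shuffle product without its combinatorics: by Leibniz, the derivative of `L_{ua} L_{vb}` is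
`L_u L_{vb}/(y - a) + L_{ua} L_v/(y - b)`, and both products have smaller total length. -/
lemma hyperlog_mul_hyperlog {F : Subfield ℂ} (n : ℕ) (u v : List ℂ) (hn : u.length + v.length ≤ n)
    (hu : ∀ b ∈ u, b ∈ F) (hv : ∀ b ∈ v, b ∈ F) :
    EvSpan slitNhds (hyperlogs F) fun y => hyperlog u y * hyperlog v y := by
  induction n generalizing u v with
  | zero =>
    have h1 : u = [] := List.length_eq_zero_iff.1 (by omega)
    have h2 : v = [] := List.length_eq_zero_iff.1 (by omega)
    subst h1 h2
    simpa [hyperlog_nil] using hyperlogs_const F 1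
  | succ n ih =>
    rcases List.eq_nil_or_concat' u with rfl | ⟨u, a, rfl⟩
    · simpa [hyperlog_nil] using EvSpan.of_mem (show hyperlog v ∈ hyperlogs F from ⟨v, hv, rfl⟩)
    rcases List.eq_nil_or_concat' v with rfl | ⟨v, b, rfl⟩
    · simpa [hyperlog_nil] using
        EvSpan.of_mem (show hyperlog (u ++ [a]) ∈ hyperlogs F from ⟨_, hu, rfl⟩)
    have ha : a ∈ F := hu a (by simp)
    have hb : b ∈ F := hv b (by simp)
    have h1 := ih u (v ++ [b]) (by simp at hn ⊢; omega) (fun b hb => hu b (by simp [hb])) hv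
    have h2 := ih (u ++ [a]) v (by simp at hn ⊢; omega) hu (fun b hb => hv b (by simp [hb]))
    refine hyperlogs_primitive
      ((hyperlogForms_of_hyperlogs ha h1).add (hyperlogForms_of_hyperlogs hb h2)) ?_
    obtain ⟨ρ, hρ, h⟩ := exists_radius ((u ++ [a]) ++ (v ++ [b]))
    filter_upwards [slitBall_mem_nhdsWithin hρ] with z hz
    have d1 := hasDerivAt_hyperlog hρ (fun b hb => h b (List.mem_append_left _ hb)) hz
    have d2 := hasDerivAt_hyperlog hρ (fun b hb => h b (List.mem_append_right _ hb)) hz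
    refine (d1.fun_mul d2).congr_deriv ?_
    ring

lemma hyperlogs_mul {F : Subfield ℂ} {f g : ℂ → ℂ} (hf : EvSpan slitNhds (hyperlogs F) f)
    (hg : EvSpan slitNhds (hyperlogs F) g) : EvSpan slitNhds (hyperlogs F) fun y => f y * g y := by
  refine hg.mul_of_forall ?_
  rintro _ ⟨v, hv, rfl⟩
  have := hf.mul_of_forall (m := hyperlog v) (Y := hyperlogs F) (by
    rintro _ ⟨u, hu, rfl⟩
    exact hyperlog_mul_hyperlog _ v u le_rfl hv hu)
  simpa only [mul_comm] using this

lemma hyperlogForms_mul {F : Subfield ℂ} {f g : ℂ → ℂ} (hf : EvSpan slitNhds (hyperlogs F) f)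
    (hg : EvSpan slitNhds (hyperlogForms F) g) :
        EvSpan slitNhds (hyperlogForms F) fun y => f y * g y := by
  refine hg.mul_of_forall ?_
  rintro _ ⟨v, hv, b, hb, rfl⟩
  refine (hyperlogForms_of_hyperlogs hb
    (hyperlogs_mul hf (EvSpan.of_mem ⟨v, hv, rfl⟩))).congr (Eventually.of_forall fun y => ?_)
  ring

lemma simplePoles_mul {F : Subfield ℂ} {f g : ℂ → ℂ} (hf : EvSpan slitNhds (hyperlogs F) f)
    (hg : EvSpan slitNhds (simplePoles F) g) :
        EvSpan slitNhds (hyperlogForms F) fun y => f y * g y := by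
  refine hg.mul_of_forall ?_
  rintro _ ⟨b, hb, rfl⟩
  exact (hyperlogForms_of_hyperlogs hb hf).congr (Eventually.of_forall fun y => mul_comm _ _)

/-! ### Logarithmic derivatives of differences of letters -/

lemma mem_of_quadratic {F : Subfield ℂ} (hsqrt : ∀ x : ℂ, x ^ 2 ∈ F → x ∈ F) {a b c x : ℂ}
    (ha : a ∈ F) (hb : b ∈ F) (hc : c ∈ F) (h0 : a ≠ 0 ∨ b ≠ 0 ∨ c ≠ 0)
    (h : a * x ^ 2 + b * x + c = 0) : x ∈ F := by
  by_cases ha0 : a = 0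
  · subst ha0
    by_cases hb0 : b = 0
    · subst hb0; simp_all
    · have : x = -c / b := by rw [eq_div_iff hb0]; linear_combination h
      rw [this]
      exact F.div_mem (F.neg_mem hc) hb
  · have h2 : (2 : ℂ) ∈ F := ofNat_mem F 2
    have h4 : (4 : ℂ) ∈ F := ofNat_mem F 4
    -- The square is the discriminant, so `2ax + b` lies in `F` by closure under square roots.
    have hd : (2 * a * x + b) ^ 2 ∈ F := by
      rw [show (2 * a * x + b) ^ 2 = b ^ 2 - 4 * a * c by linear_combination 4 * a * h]
      exact F.sub_mem (F.pow_mem hb 2) (F.mul_mem (F.mul_mem h4 ha) hc)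
    have : x = ((2 * a * x + b) - b) / (2 * a) := by field_simp; ring
    rw [this]
    exact F.div_mem (F.sub_mem (hsqrt _ hd) hb) (F.mul_mem h2 ha)

/-- `p'/p` is the sum of `1/(y - b)` over the roots `b` with multiplicity. -/
lemma simplePoles_logDeriv {F : Subfield ℂ} (p : Polynomial ℂ) (hp : p ≠ 0)
    (hroots : ∀ x, p.eval x = 0 → x ∈ F) :
    EvSpan slitNhds (simplePoles F) (logDeriv fun y => p.eval y) := by
  have h1 : ∀ s : Multiset ℂ, (∀ x ∈ s, x ∈ F) →
      EvSpan slitNhds (simplePoles F) fun y => (s.map fun b => 1 / (y - b)).sum := by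
    intro s
    induction s using Multiset.induction_on with
    | empty => intro _; simpa using EvSpan.zero slitNhds (simplePoles F)
    | cons b s ih =>
      intro hs
      simp only [Multiset.map_cons, Multiset.sum_cons]
      refine EvSpan.add (EvSpan.of_mem ⟨b, hs b (by simp), ?_⟩)
        (ih fun x hx => hs x (by simp [hx]))
      ext; simp
  refine (h1 p.roots fun x hx => hroots x (Polynomial.isRoot_of_mem_roots hx)).congr ?_
  filter_upwards [nhdsWithin_slitPlane_le (eventually_eval_ne_zero hp 0)] with y hy
  rw [← (IsAlgClosed.splits p).eval_derivative_div_eval_of_ne_zero hy, logDeriv_apply,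
    Polynomial.deriv]

/-- `d log (α - δ)` has simple poles at points of `F`. -/
lemma simplePoles_logDeriv_valueAt_sub {F : Subfield ℂ} (hsqrt : ∀ x : ℂ, x ^ 2 ∈ F → x ∈ F)
    {α δ : RatFunc ℂ} (hα : α ∈ FLT F) (hδ : δ ∈ FLT F) (hne : α ≠ δ) :
    EvSpan slitNhds (simplePoles F)
      (fun y => (deriv (valueAt α) y - deriv (valueAt δ) y) / (valueAt α y - valueAt δ y)) ∧
    ∀ᶠ y in 𝓝[≠] (0 : ℂ), valueAt α y ≠ valueAt δ y := by
  obtain ⟨a, ha, b, hb, c, hc, d, hd, hcd, rfl⟩ := FLT.exists_linPoly hα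
  obtain ⟨a', ha', b', hb', c', hc', d', hd', hcd', rfl⟩ := FLT.exists_linPoly hδ
  have hq := linPoly_ne_zero hcd
  have hq' := linPoly_ne_zero hcd'
  set P := linPoly a b * linPoly c' d' - linPoly a' b' * linPoly c d with hP
  have hP0 : P ≠ 0 := by
    intro h
    refine hne ?_
    rw [div_eq_div_iff (RatFunc.algebraMap_ne_zero hq) (RatFunc.algebraMap_ne_zero hq'),
      ← map_mul, ← map_mul, sub_eq_zero.1 h]
  have hv : ∀ᶠ y in 𝓝[≠] (0 : ℂ), (linPoly c d).eval y ≠ 0 ∧ (linPoly c' d').eval y ≠ 0 ∧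
      P.eval y ≠ 0 :=
    (eventually_eval_ne_zero hq 0).and
      ((eventually_eval_ne_zero hq' 0).and (eventually_eval_ne_zero hP0 0))
  have hval : ∀ y, (linPoly c d).eval y ≠ 0 → (linPoly c' d').eval y ≠ 0 →
      valueAt (algebraMap _ _ (linPoly a b) / algebraMap _ _ (linPoly c d)) y -
      valueAt (algebraMap _ _ (linPoly a' b') / algebraMap _ _ (linPoly c' d')) y =
      P.eval y / (linPoly c d * linPoly c' d').eval y := by
    intro y h1 h2
    rw [valueAt_div h1, valueAt_div h2, div_sub_div _ _ h1 h2]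
    simp only [hP, Polynomial.eval_sub, Polynomial.eval_mul]
    ring
  have hlin : ∀ {a b x : ℂ}, a ∈ F → b ∈ F → a ≠ 0 ∨ b ≠ 0 → a * x + b = 0 → x ∈ F :=
    fun {a b x} ha hb h0 h => mem_of_quadratic hsqrt F.zero_mem ha hb (Or.inr h0)
      (by linear_combination h)
  -- The numerator of `α - δ` has degree at most two with coefficients in `F`. Closure under square
  -- roots is needed exactly here.
  have hPr : ∀ x, P.eval x = 0 → x ∈ F := by
    intro x hx
    have hPe : P = Polynomial.C (a * c' - a' * c) * Polynomial.X ^ 2 +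
        Polynomial.C (a * d' + b * c' - a' * d - b' * c) * Polynomial.X +
        Polynomial.C (b * d' - b' * d) := by
      simp only [hP, linPoly, Polynomial.C_sub, Polynomial.C_add, Polynomial.C_mul]
      ring
    refine mem_of_quadratic hsqrt (a := a * c' - a' * c) (b := a * d' + b * c' - a' * d - b' * c)
      (c := b * d' - b' * d)
      (F.sub_mem (F.mul_mem ha hc') (F.mul_mem ha' hc))
      (F.sub_mem (F.sub_mem (F.add_mem (F.mul_mem ha hd') (F.mul_mem hb hc')) (F.mul_mem ha' hd))
        (F.mul_mem hb' hc))
      (F.sub_mem (F.mul_mem hb hd') (F.mul_mem hb' hd)) ?_ ?_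
    · by_contra! h
      rw [h.1, h.2.1, h.2.2] at hPe
      exact hP0 (by simpa using hPe)
    · rw [hPe] at hx
      simpa using hx
  have hDr : ∀ x, (linPoly c d * linPoly c' d').eval x = 0 → x ∈ F := by
    intro x hx
    rw [Polynomial.eval_mul, mul_eq_zero, linPoly_eval, linPoly_eval] at hx
    rcases hx with h | h
    · exact hlin hc hd hcd h
    · exact hlin hc' hd' hcd' h
  constructor
  · refine ((simplePoles_logDeriv P hP0 hPr).sub
      (simplePoles_logDeriv _ (mul_ne_zero hq hq') hDr)).congr ?_
    filter_upwards [nhdsWithin_slitPlane_le (eventually_eventually_nhdsWithin.2 hv),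
      nhdsWithin_slitPlane_le (eventually_analyticAt_valueAt _),
      nhdsWithin_slitPlane_le (eventually_analyticAt_valueAt _), nhdsWithin_slitPlane_le hv,
      nhdsWithin_slitPlane_le self_mem_nhdsWithin] with y h1 h2 h3 h4 h5
    have hD : (linPoly c d * linPoly c' d').eval y ≠ 0 := by
      rw [Polynomial.eval_mul]; exact mul_ne_zero h4.1 h4.2.1
    rw [← logDeriv_div y h4.2.2 hD (Polynomial.differentiableAt _) (Polynomial.differentiableAt _),
      ← deriv_fun_sub h2.differentiableAt h3.differentiableAt, logDeriv_apply]
    rw [isOpen_compl_singleton.nhdsWithin_eq h5] at h1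
    have h6 : (fun z => P.eval z / (linPoly c d * linPoly c' d').eval z) =ᶠ[𝓝 y] fun z =>
        valueAt (algebraMap _ _ (linPoly a b) / algebraMap _ _ (linPoly c d)) z -
        valueAt (algebraMap _ _ (linPoly a' b') / algebraMap _ _ (linPoly c' d')) z := by
      filter_upwards [h1] with z hz using (hval z hz.1 hz.2.1).symm
    rw [h6.deriv_eq, hval y h4.1 h4.2.1]
  · filter_upwards [hv] with y hy
    have := hval y hy.1 hy.2.1
    intro h
    rw [h, sub_self] at this
    refine (div_ne_zero hy.2.2 ?_) this.symm
    rw [Polynomial.eval_mul]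
    exact mul_ne_zero hy.1 hy.2.1

/-! ### Analytic functions of two variables and double power series -/

lemma hasSum_antidiagonal {E : Type*} [NormedAddCommGroup E] {f : ℕ × ℕ → E} {a : E}
    (h : HasSum f a) : HasSum (fun n => ∑ ij ∈ Finset.HasAntidiagonal.antidiagonal n, f ij) a := by
  have h1 := (Finset.HasAntidiagonal.sigmaAntidiagonalEquivProd (A := ℕ)).hasSum_iff.2 h
  refine h1.sigma fun n => ?_
  have := (Finset.HasAntidiagonal.antidiagonal n).hasSum f
  exact this

/-- The monomial `z^i y^(n-i)` as a multilinear map. -/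
def monomialMap (n i : ℕ) : ContinuousMultilinearMap ℂ (fun _ : Fin n => ℂ × ℂ) ℂ :=
  (ContinuousMultilinearMap.mkPiAlgebra ℂ (Fin n) ℂ).compContinuousLinearMap fun k =>
    if (k : ℕ) < i then ContinuousLinearMap.fst ℂ ℂ ℂ else ContinuousLinearMap.snd ℂ ℂ ℂ

lemma norm_monomialMap_le (n i : ℕ) : ‖monomialMap n i‖ ≤ 1 := by
  refine (ContinuousMultilinearMap.norm_compContinuousLinearMap_le _ _).trans ?_
  rw [ContinuousMultilinearMap.norm_mkPiAlgebra, one_mul]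
  refine Finset.prod_le_one (fun _ _ => norm_nonneg _) fun k _ => ?_
  split_ifs
  · exact ContinuousLinearMap.norm_fst_le ℂ ℂ ℂ
  · exact ContinuousLinearMap.norm_snd_le ℂ ℂ ℂ

lemma monomialMap_apply {n i : ℕ} (hi : i ≤ n) (p : ℂ × ℂ) :
    monomialMap n i (fun _ => p) = p.1 ^ i * p.2 ^ (n - i) := by
  have h1 : monomialMap n i (fun _ => p) = ∏ k : Fin n, if (k : ℕ) < i then p.1 else p.2 := by
    simp only [monomialMap, ContinuousMultilinearMap.compContinuousLinearMap_apply,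
      ContinuousMultilinearMap.mkPiAlgebra_apply]
    refine Finset.prod_congr rfl fun k _ => ?_
    split_ifs <;> rfl
  rw [h1, Fin.prod_univ_eq_prod_range (fun k => if k < i then p.1 else p.2) n, Finset.prod_ite,
    Finset.prod_const, Finset.prod_const]
  congr 2
  · rw [show (Finset.range n).filter (fun k => k < i) = Finset.range i by
      ext k; simp; omega, Finset.card_range]
  · rw [show (Finset.range n).filter (fun k => ¬ k < i) = Finset.Ico i n by
      ext k; simp; omega, Nat.card_Ico]

/-- The sum of a double power series. -/
def doubleSeries (c : ℕ × ℕ → ℂ) (p : ℂ × ℂ) : ℂ := ∑' ij : ℕ × ℕ, c ij * (p.1 ^ ij.1 * p.2 ^ ij.2)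

lemma summable_doubleSeries {c : ℕ × ℕ → ℂ} {r : ℝ}
    (hc : Summable fun ij : ℕ × ℕ => ‖c ij‖ * r ^ (ij.1 + ij.2)) {p : ℂ × ℂ} (h1 : ‖p.1‖ ≤ r)
    (h2 : ‖p.2‖ ≤ r) : Summable fun ij : ℕ × ℕ => c ij * (p.1 ^ ij.1 * p.2 ^ ij.2) := by
  refine Summable.of_norm_bounded hc fun ij => ?_
  rw [norm_mul, norm_mul, norm_pow, norm_pow, pow_add]
  have hr := (norm_nonneg _).trans h1
  gcongr

lemma analyticAt_doubleSeries {c : ℕ × ℕ → ℂ} {r : ℝ} (hr : 0 < r)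
    (hc : Summable fun ij : ℕ × ℕ => ‖c ij‖ * r ^ (ij.1 + ij.2)) :
    AnalyticAt ℂ (doubleSeries c) (0, 0) := by
  let q : FormalMultilinearSeries ℂ (ℂ × ℂ) ℂ := fun n =>
    ∑ ij ∈ Finset.HasAntidiagonal.antidiagonal n, c ij • monomialMap n ij.1
  lift r to NNReal using hr.le
  have hq : ∀ n (p : ℂ × ℂ), q n (fun _ => p) =
      ∑ ij ∈ Finset.HasAntidiagonal.antidiagonal n, c ij * (p.1 ^ ij.1 * p.2 ^ ij.2) := by
    intro n p
    simp only [q, sum_apply, smul_apply,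
      smul_eq_mul]
    refine Finset.sum_congr rfl fun ij hij => ?_
    rw [Finset.HasAntidiagonal.mem_antidiagonal] at hij
    rw [monomialMap_apply (by omega), show n - ij.1 = ij.2 by omega]
  have hrad : (r : ENNReal) ≤ q.radius := by
    refine q.le_radius_of_summable_norm ?_
    have h1 := (hasSum_antidiagonal hc.hasSum).summable
    refine Summable.of_nonneg_of_le (fun n => by positivity) (fun n => ?_) h1
    calc ‖q n‖ * (r : ℝ) ^ n ≤
        (∑ ij ∈ Finset.HasAntidiagonal.antidiagonal n, ‖c ij‖) * (r : ℝ) ^ n := by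
          gcongr
          refine (norm_sum_le _ _).trans (Finset.sum_le_sum fun ij _ => ?_)
          rw [norm_smul]
          exact mul_le_of_le_one_right (norm_nonneg _) (norm_monomialMap_le _ _)
      _ = ∑ ij ∈ Finset.HasAntidiagonal.antidiagonal n, ‖c ij‖ * (r : ℝ) ^ (ij.1 + ij.2) := by
          rw [Finset.sum_mul]
          refine Finset.sum_congr rfl fun ij hij => ?_
          rw [Finset.HasAntidiagonal.mem_antidiagonal.1 hij]
  have hs : HasFPowerSeriesOnBall (doubleSeries c) q (0, 0) r := by
    refine ⟨hrad, by exact_mod_cast hr, fun {p} hp => ?_⟩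
    rw [show ((0 : ℂ), (0 : ℂ)) + p = p from zero_add p]
    simp only [hq]
    refine hasSum_antidiagonal (Summable.hasSum (summable_doubleSeries hc ?_ ?_))
    all_goals
      rw [mem_eball_zero_iff, enorm_eq_nnnorm] at hp
      have hp' : ‖p‖ < r := by exact_mod_cast hp
      first
        | exact (norm_fst_le p).trans hp'.le
        | exact (norm_snd_le p).trans hp'.le
  exact hs.analyticAt

lemma norm_piecewise_le (n : ℕ) (q : ContinuousMultilinearMap ℂ (fun _ : Fin n => ℂ × ℂ) ℂ)
    (s : Finset (Fin n)) : ‖q (s.piecewise (fun _ => (1, 0)) fun _ => (0, 1))‖ ≤ ‖q‖ := by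
  refine (q.le_opNorm _).trans (mul_le_of_le_one_right (norm_nonneg _) ?_)
  refine Finset.prod_le_one (fun _ _ => norm_nonneg _) fun i _ => ?_
  by_cases hi : i ∈ s <;> simp [hi, Prod.norm_def]

/-- A function analytic at the origin of `ℂ²` is the sum of a double power series. -/
lemma AnalyticAt.exists_doubleSeries {h : ℂ × ℂ → ℂ} (hh : AnalyticAt ℂ h (0, 0)) :
    ∃ (c : ℕ × ℕ → ℂ) (r : ℝ), 0 < r ∧
      (Summable fun ij : ℕ × ℕ => ‖c ij‖ * r ^ (ij.1 + ij.2)) ∧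
      ∀ p : ℂ × ℂ, ‖p.1‖ ≤ r → ‖p.2‖ ≤ r →
        HasSum (fun ij : ℕ × ℕ => c ij * (p.1 ^ ij.1 * p.2 ^ ij.2)) (h p) := by
  obtain ⟨q, R, hq⟩ := hh
  obtain ⟨r₀, hr₀, hr₀R⟩ := ENNReal.lt_iff_exists_nnreal_btwn.1 hq.r_pos
  have hr₀' : 0 < (r₀ : ℝ) := by exact_mod_cast hr₀
  obtain ⟨C, hC, hb⟩ := q.norm_mul_pow_le_of_lt_radius (hr₀R.trans_le hq.r_le)
  let d : ℕ → ℕ → ℂ := fun n i => ∑ s ∈ Finset.powersetCard i (Finset.univ : Finset (Fin n)),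
    q n (s.piecewise (fun _ => (1, 0)) fun _ => (0, 1))
  let c : ℕ × ℕ → ℂ := fun ij => d (ij.1 + ij.2) ij.1
  -- One factor `2` absorbs the at most `2^n` subsets of positions in degree `n`; the other leaves a
  -- geometric series in each index.
  set r : ℝ := r₀ / 4 with hr
  have hrpos : 0 < r := by positivity
  have hd : ∀ n i, ‖d n i‖ ≤ 2 ^ n * ‖q n‖ := by
    intro n i
    refine (norm_sum_le _ _).trans ?_
    refine (Finset.sum_le_sum fun s _ => norm_piecewise_le n (q n) s).trans ?_
    rw [Finset.sum_const, nsmul_eq_mul]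
    gcongr
    rw [Finset.card_powersetCard, Finset.card_univ, Fintype.card_fin]
    exact_mod_cast Nat.choose_le_two_pow n i
  have hc : Summable fun ij : ℕ × ℕ => ‖c ij‖ * r ^ (ij.1 + ij.2) := by
    have hgeo : Summable fun n : ℕ => (1 / 2 : ℝ) ^ n := summable_geometric_two
    refine Summable.of_nonneg_of_le (fun ij => by positivity) (fun ij => ?_)
      ((hgeo.mul_of_nonneg hgeo (fun n => by positivity) (fun n => by positivity)).mul_left C)
    set n := ij.1 + ij.2 with hn
    calc ‖c ij‖ * r ^ n ≤ 2 ^ n * ‖q n‖ * r ^ n := by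
          gcongr; exact hd _ _
      _ = (‖q n‖ * (r₀ : ℝ) ^ n) * (1 / 2) ^ n := by
          rw [hr, div_pow, show (4 : ℝ) ^ n = 2 ^ n * 2 ^ n by rw [← mul_pow]; norm_num]
          rw [div_pow, one_pow]; field_simp
      _ ≤ C * (1 / 2) ^ n := by gcongr; exact hb n
      _ = C * ((1 / 2) ^ ij.1 * (1 / 2) ^ ij.2) := by rw [hn, pow_add]
  refine ⟨c, r, hrpos, hc, fun p h1 h2 => ?_⟩
  have hs := summable_doubleSeries hc h1 h2
  have hq2 : HasSum (fun n => q n fun _ => p) (h p) := by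
    have := hq.hasSum (y := p) (by
      rw [mem_eball_zero_iff, enorm_eq_nnnorm]
      refine lt_trans ?_ hr₀R
      have : ‖p‖ < r₀ := lt_of_le_of_lt (max_le h1 h2) (by rw [hr]; linarith)
      exact_mod_cast this)
    rwa [show ((0 : ℂ), (0 : ℂ)) + p = p from zero_add p] at this
  have hterm : ∀ n, (q n fun _ => p) =
      ∑ ij ∈ Finset.HasAntidiagonal.antidiagonal n, c ij * (p.1 ^ ij.1 * p.2 ^ ij.2) := by
    intro n
    -- Expand the `n`-th multilinear term at `p = z (1,0) + y (0,1)` over the set of slots that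
    -- receive `(1,0)`. Grouping these sets by cardinality gives the coefficient of `z^i y^(n-i)`.
    have e0 : (fun _ : Fin n => p) =
        (fun _ => p.1 • ((1 : ℂ), (0 : ℂ))) + fun _ => p.2 • ((0 : ℂ), (1 : ℂ)) := by
      ext <;> simp
    have e1 : ∀ s : Finset (Fin n),
        q n (s.piecewise (fun _ => p.1 • ((1 : ℂ), (0 : ℂ))) fun _ => p.2 • ((0 : ℂ), (1 : ℂ))) =
        p.1 ^ s.card * p.2 ^ (n - s.card) *
          q n (s.piecewise (fun _ => (1, 0)) fun _ => (0, 1)) := by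
      intro s
      have e2 : (s.piecewise (fun _ => p.1 • ((1 : ℂ), (0 : ℂ))) fun _ =>
          p.2 • ((0 : ℂ), (1 : ℂ))) = fun k =>
          (if k ∈ s then p.1 else p.2) • (s.piecewise (fun _ => ((1 : ℂ), (0 : ℂ))) fun _ =>
          ((0 : ℂ), (1 : ℂ))) k := by
        ext k <;> by_cases hk : k ∈ s <;> simp [hk]
      rw [e2, ContinuousMultilinearMap.map_smul_univ, smul_eq_mul]
      congr 1
      rw [Finset.prod_ite, Finset.prod_const, Finset.prod_const]
      congr 2
      · rw [Finset.filter_mem_eq_inter, Finset.univ_inter]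
      · rw [Finset.filter_not, Finset.filter_mem_eq_inter, Finset.univ_inter,
          ← Finset.compl_eq_univ_sdiff, Finset.card_compl, Fintype.card_fin]
    rw [e0, ContinuousMultilinearMap.map_add_univ, Finset.sum_congr rfl fun s _ => e1 s,
      ← Finset.powerset_univ, Finset.sum_powerset, Finset.card_univ, Fintype.card_fin]
    have e3 : ∀ ij ∈ Finset.HasAntidiagonal.antidiagonal n, c ij * (p.1 ^ ij.1 * p.2 ^ ij.2) =
        d n ij.1 * (p.1 ^ ij.1 * p.2 ^ ij.2) := by
      intro ij hij
      rw [Finset.HasAntidiagonal.mem_antidiagonal] at hij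
      simp only [c, hij]
    rw [Finset.sum_congr rfl e3, Finset.Nat.sum_antidiagonal_eq_sum_range_succ
      (fun i j => d n i * (p.1 ^ i * p.2 ^ j)) n]
    refine Finset.sum_congr rfl fun i _ => ?_
    simp only [d, Finset.sum_mul]
    refine Finset.sum_congr rfl fun s hs => ?_
    rw [(Finset.mem_powersetCard.1 hs).2]
    ring
  have h3 := hasSum_antidiagonal hs.hasSum
  simp only [← hterm] at h3
  rw [hq2.unique h3]
  exact hs.hasSum

/-- A function analytic at the origin of `ℂ²` has a primitive in the first variable that vanishes
for `z = 0`. -/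
lemma AnalyticAt.exists_primitive_fst {h : ℂ × ℂ → ℂ} (hh : AnalyticAt ℂ h (0, 0)) :
    ∃ Q : ℂ × ℂ → ℂ, AnalyticAt ℂ Q (0, 0) ∧
      ∀ᶠ p in 𝓝 ((0 : ℂ), (0 : ℂ)), HasDerivAt (fun z => z * Q (z, p.2)) (h p) p.1 := by
  obtain ⟨c, r, hr, hc, hs⟩ := AnalyticAt.exists_doubleSeries hh
  have hc' : Summable fun ij : ℕ × ℕ => ‖c ij / ((ij.1 : ℂ) + 1)‖ * r ^ (ij.1 + ij.2) := by
    refine Summable.of_nonneg_of_le (fun ij => by positivity) (fun ij => ?_) hc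
    gcongr
    rw [norm_div]
    refine div_le_self (norm_nonneg _) ?_
    rw [show ((ij.1 : ℂ) + 1) = ((ij.1 + 1 : ℕ) : ℂ) by push_cast; rfl, Complex.norm_natCast]
    exact_mod_cast Nat.succ_pos _
  refine ⟨doubleSeries fun ij => c ij / ((ij.1 : ℂ) + 1), analyticAt_doubleSeries hr hc', ?_⟩
  have hmem : Metric.ball ((0 : ℂ), (0 : ℂ)) r ∈ 𝓝 ((0 : ℂ), (0 : ℂ)) := Metric.ball_mem_nhds _ hr
  filter_upwards [hmem] with p hp
  have hp' : ‖p‖ < r := by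
    have := mem_ball_iff_norm.1 hp
    rwa [show p - ((0 : ℂ), (0 : ℂ)) = p from sub_zero p] at this
  have hp1 : ‖p.1‖ < r := (norm_fst_le p).trans_lt hp'
  have hp2 : ‖p.2‖ < r := (norm_snd_le p).trans_lt hp'
  have key := hasDerivAt_tsum_of_isPreconnected (𝕜 := ℂ) (t := Metric.ball (0 : ℂ) r) (y₀ := 0)
    (y := p.1) (g := fun (ij : ℕ × ℕ) z => z * (c ij / ((ij.1 : ℂ) + 1) * (z ^ ij.1 * p.2 ^ ij.2)))
    (g' := fun (ij : ℕ × ℕ) z => c ij * (z ^ ij.1 * p.2 ^ ij.2)) hc Metric.isOpen_ball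
    (convex_ball _ _).isPreconnected (fun ij z _ => ?_) (fun ij z hz => ?_)
    (Metric.mem_ball_self hr) (by simp) (by simpa using hp1)
  · simp only [doubleSeries, ← tsum_mul_left]
    exact key.congr_deriv (hs p hp1.le hp2.le).tsum_eq
  · have h1 := (hasDerivAt_pow (ij.1 + 1) z).const_mul (c ij / ((ij.1 : ℂ) + 1) * p.2 ^ ij.2)
    have h2 : (ij.1 : ℂ) + 1 ≠ 0 := by exact_mod_cast ij.1.succ_ne_zero
    refine (h1.congr_of_eventuallyEq (Eventually.of_forall fun w => ?_)).congr_deriv ?_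
    · simp only; ring
    · push_cast
      field_simp
  · have hz' : ‖z‖ ≤ r := by simpa using (Metric.mem_ball.1 hz).le
    rw [norm_mul, norm_mul, norm_pow, norm_pow, pow_add]
    gcongr

/-! ### Partial derivatives -/

/-- The partial derivative in the first variable. -/
def dz (f : ℂ × ℂ → ℂ) (p : ℂ × ℂ) : ℂ := deriv (fun z => f (z, p.2)) p.1

/-- The partial derivative in the second variable. -/
def dy (f : ℂ × ℂ → ℂ) (p : ℂ × ℂ) : ℂ := deriv (fun y => f (p.1, y)) p.2

lemma hasDerivAt_fst {f : ℂ × ℂ → ℂ} {p : ℂ × ℂ} (hf : DifferentiableAt ℂ f p) :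
    HasDerivAt (fun z => f (z, p.2)) (fderiv ℂ f p (1, 0)) p.1 := by
  have h1 : HasDerivAt (fun z : ℂ => (z, p.2)) ((1 : ℂ), (0 : ℂ)) p.1 :=
    (hasDerivAt_id p.1).prodMk (hasDerivAt_const _ _)
  exact (hf.hasFDerivAt (x := p)).comp_hasDerivAt (f := fun z : ℂ => (z, p.2)) p.1 h1

lemma hasDerivAt_snd {f : ℂ × ℂ → ℂ} {p : ℂ × ℂ} (hf : DifferentiableAt ℂ f p) :
    HasDerivAt (fun y => f (p.1, y)) (fderiv ℂ f p (0, 1)) p.2 := by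
  have h1 : HasDerivAt (fun y : ℂ => (p.1, y)) ((0 : ℂ), (1 : ℂ)) p.2 :=
    (hasDerivAt_const _ _).prodMk (hasDerivAt_id p.2)
  exact (hf.hasFDerivAt (x := p)).comp_hasDerivAt (f := fun y : ℂ => (p.1, y)) p.2 h1

lemma dz_eq {f : ℂ × ℂ → ℂ} {p : ℂ × ℂ} (hf : DifferentiableAt ℂ f p) :
    dz f p = fderiv ℂ f p (1, 0) := (hasDerivAt_fst hf).deriv

lemma dy_eq {f : ℂ × ℂ → ℂ} {p : ℂ × ℂ} (hf : DifferentiableAt ℂ f p) :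
    dy f p = fderiv ℂ f p (0, 1) := (hasDerivAt_snd hf).deriv

lemma AnalyticAt.dz {f : ℂ × ℂ → ℂ} {p : ℂ × ℂ} (hf : AnalyticAt ℂ f p) :
    AnalyticAt ℂ (dz f) p := by
  have h1 : AnalyticAt ℂ (fun q => fderiv ℂ f q (1, 0)) p :=
    (ContinuousLinearMap.apply ℂ ℂ ((1, 0) : ℂ × ℂ)).analyticAt _ |>.comp hf.fderiv
  refine h1.congr ?_
  filter_upwards [hf.eventually_analyticAt] with q hq using (dz_eq hq.differentiableAt).symm

lemma AnalyticAt.dy {f : ℂ × ℂ → ℂ} {p : ℂ × ℂ} (hf : AnalyticAt ℂ f p) :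
    AnalyticAt ℂ (dy f) p := by
  have h1 : AnalyticAt ℂ (fun q => fderiv ℂ f q (0, 1)) p :=
    (ContinuousLinearMap.apply ℂ ℂ ((0, 1) : ℂ × ℂ)).analyticAt _ |>.comp hf.fderiv
  refine h1.congr ?_
  filter_upwards [hf.eventually_analyticAt] with q hq using (dy_eq hq.differentiableAt).symm

/-- The chain rule along a curve `y ↦ (γ(y), y)`. -/
lemma hasDerivAt_comp_curve {f : ℂ × ℂ → ℂ} {γ : ℂ → ℂ} {γ' y : ℂ}
    (hf : DifferentiableAt ℂ f (γ y, y)) (hγ : HasDerivAt γ γ' y) :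
    HasDerivAt (fun y => f (γ y, y)) (dy f (γ y, y) + γ' * dz f (γ y, y)) y := by
  have h1 : HasDerivAt (fun y : ℂ => (γ y, y)) (γ', (1 : ℂ)) y := hγ.prodMk (hasDerivAt_id y)
  refine ((hf.hasFDerivAt (x := (γ y, y))).comp_hasDerivAt (f := fun y : ℂ => (γ y, y))
    y h1).congr_deriv ?_
  rw [dy_eq hf, dz_eq hf, show ((γ', (1 : ℂ)) : ℂ × ℂ) = (0, 1) + γ' • (1, 0) by simp, map_add,
    map_smul, smul_eq_mul]

/-- Symmetry of the second partial derivatives. -/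
lemma dz_dy_comm {f : ℂ × ℂ → ℂ} {p : ℂ × ℂ} (hf : AnalyticAt ℂ f p) :
    dz (dy f) p = dy (dz f) p := by
  have h1 : ∀ᶠ q in 𝓝 p, AnalyticAt ℂ f q := hf.eventually_analyticAt
  have e1 : dz f =ᶠ[𝓝 p] fun q => fderiv ℂ f q (1, 0) := by
    filter_upwards [h1] with q hq using dz_eq hq.differentiableAt
  have e2 : dy f =ᶠ[𝓝 p] fun q => fderiv ℂ f q (0, 1) := by
    filter_upwards [h1] with q hq using dy_eq hq.differentiableAt
  have hd : DifferentiableAt ℂ (fderiv ℂ f) p := hf.fderiv.differentiableAt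
  rw [dz_eq (AnalyticAt.dy hf).differentiableAt, dy_eq (AnalyticAt.dz hf).differentiableAt,
    e2.fderiv_eq, e1.fderiv_eq, fderiv_clm_apply hd (differentiableAt_const _),
    fderiv_clm_apply hd (differentiableAt_const _)]
  have hsym : IsSymmSndFDerivAt ℂ f p :=
    (hf.contDiffAt (n := ⊤)).isSymmSndFDerivAt (by simp)
  simpa using hsym (1, 0) (0, 1)

/-! ### Hadamard's lemma -/

lemma eventually_nhds_zero_iff {P : ℂ × ℂ → Prop} :
    (∀ᶠ p in 𝓝 ((0 : ℂ), (0 : ℂ)), P p) ↔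
      ∃ r > 0, ∀ z y : ℂ, ‖z‖ < r → ‖y‖ < r → P (z, y) := by
  rw [Metric.eventually_nhds_iff_ball]
  refine exists_congr fun r => and_congr_right fun _ => ?_
  constructor
  · intro h z y hz hy
    exact h _ (by simp [← ball_prod_same, hz, hy])
  · rintro h ⟨z, y⟩ hp
    rw [← ball_prod_same] at hp
    exact h z y (by simpa using hp.1) (by simpa using hp.2)

/-- The primitive of `∂_z h` that vanishes for `z = 0` is `h(z, y) - h(0, y)`, and termwise
integration of the double series exhibits the factor `z`. -/
lemma AnalyticAt.exists_quotient_fst {h : ℂ × ℂ → ℂ} (hh : AnalyticAt ℂ h (0, 0)) :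
    ∃ Q : ℂ × ℂ → ℂ, AnalyticAt ℂ Q (0, 0) ∧
      ∀ᶠ p in 𝓝 ((0 : ℂ), (0 : ℂ)), h p - h (0, p.2) = p.1 * Q p := by
  obtain ⟨Q, hQ, hd⟩ := AnalyticAt.exists_primitive_fst (AnalyticAt.dz hh)
  refine ⟨Q, hQ, ?_⟩
  obtain ⟨r, hr, H⟩ := eventually_nhds_zero_iff.1 (hd.and hh.eventually_analyticAt)
  refine eventually_nhds_zero_iff.2 ⟨r, hr, fun z y hz hy => ?_⟩
  have h1 : ∀ x ∈ Metric.ball (0 : ℂ) r,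
      HasDerivAt (fun z => h (z, y) - z * Q (z, y)) 0 x := by
    intro x hx
    have hx' : ‖x‖ < r := by simpa using hx
    have h2 := hasDerivAt_fst (p := (x, y)) (H x y hx' hy).2.differentiableAt
    have h3 := (H x y hx' hy).1
    rw [dz_eq (H x y hx' hy).2.differentiableAt] at h3
    simpa using h2.fun_sub h3
  have h2 := Metric.isOpen_ball.is_const_of_deriv_eq_zero (convex_ball (0 : ℂ) r).isPreconnected
    (fun x hx => (h1 x hx).differentiableAt.differentiableWithinAt) (fun x hx => (h1 x hx).deriv)
    (show z ∈ Metric.ball (0 : ℂ) r by simpa using hz) (Metric.mem_ball_self hr)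
  simp only [zero_mul, sub_zero] at h2
  linear_combination h2

/-! ### The strip -/

/-- The filter of points `(z, y)` near the origin with `y` in the slit plane. -/
abbrev strip : Filter (ℂ × ℂ) := 𝓝 0 ×ˢ slitNhds

lemma eventually_strip_iff {P : ℂ × ℂ → Prop} :
    (∀ᶠ p in strip, P p) ↔ ∃ r > 0, ∀ z y : ℂ, ‖z‖ < r → y ∈ slitBall r → P (z, y) := by
  constructor
  · intro h
    obtain ⟨pa, ha, pb, hb, H⟩ := eventually_prod_iff.1 h
    obtain ⟨r, hr, h1⟩ := Metric.eventually_nhds_iff_ball.1 ha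
    obtain ⟨r', hr', h2⟩ := mem_nhdsWithin_slitPlane_iff.1 hb
    refine ⟨min r r', lt_min hr hr', fun z y hz hy => H (h1 z ?_) (h2 ?_)⟩
    · simpa using hz.trans_le (min_le_left _ _)
    · exact slitBall_mono (min_le_right _ _) hy
  · rintro ⟨r, hr, h⟩
    have h1 : ∀ᶠ z in 𝓝 (0 : ℂ), ‖z‖ < r := by
      filter_upwards [Metric.ball_mem_nhds (0 : ℂ) hr] with z hz using by simpa using hz
    have h2 : ∀ᶠ y in slitNhds, y ∈ slitBall r := slitBall_mem_nhdsWithin hr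
    filter_upwards [h1.prod_mk h2] with p hp using h p.1 p.2 hp.1 hp.2

lemma strip_le : strip ≤ 𝓝 ((0 : ℂ), (0 : ℂ)) := by
  rw [nhds_prod_eq]
  exact prod_mono le_rfl nhdsWithin_le_nhds

lemma eventually_strip_of_snd {P : ℂ → Prop} (h : ∀ᶠ y in slitNhds, P y) :
    ∀ᶠ p in strip, P p.2 := tendsto_snd.eventually h

/-- Letters with a pole at `0` have a meaningless value for `y = 0`, so relations are only known for
`y ≠ 0`. Over the slit plane this is an open condition, and the relations may be differentiated. -/
lemma eventually_strip_of_punctured {P : ℂ × ℂ → Prop}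
    (h : ∀ᶠ p in 𝓝 ((0 : ℂ), (0 : ℂ)), p.2 ≠ 0 → P p) :
    ∀ᶠ p in strip, ∀ᶠ q in 𝓝 p, P q := by
  have h1 := strip_le (eventually_eventually_nhds.2 h)
  have h2 : ∀ᶠ p in strip, p.2 ∈ Complex.slitPlane :=
    eventually_strip_of_snd self_mem_nhdsWithin
  filter_upwards [h1, h2] with p hp hp2
  have h3 : ∀ᶠ q in 𝓝 p, q.2 ≠ 0 :=
    continuous_snd.continuousAt.eventually_ne (Complex.slitPlane_ne_zero hp2)
  filter_upwards [hp, h3] with q hq hq2 using hq hq2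

lemma tendsto_curve_strip {γ : RatFunc ℂ} (hγ : γ.num.eval 0 = 0) :
    Tendsto (fun y => (valueAt γ y, y)) slitNhds strip := by
  refine Tendsto.prodMk ?_ tendsto_id
  have := (analyticAt_valueAt_zero hγ).continuousAt.tendsto
  rw [valueAt_at_zero hγ] at this
  exact this.mono_left nhdsWithin_le_nhds

/-! ### The regularized integration operator -/

open Classical in
/-- The value of `f` on the curve `z = β(y)` if this curve passes through the origin. -/
def evalAt (β : RatFunc ℂ) (f : ℂ × ℂ → ℂ) (y : ℂ) : ℂ :=
  if β.num.eval 0 = 0 then f (valueAt β y, y) else 0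

lemma evalAt_of_small {β : RatFunc ℂ} (hβ : β.num.eval 0 = 0) (f : ℂ × ℂ → ℂ) (y : ℂ) :
    evalAt β f y = f (valueAt β y, y) := if_pos hβ

lemma evalAt_of_not_small {β : RatFunc ℂ} (hβ : β.num.eval 0 ≠ 0) (f : ℂ × ℂ → ℂ) (y : ℂ) :
    evalAt β f y = 0 := if_neg hβ

/-- `G` is the primitive of `(f - f(β(y), y)) / (z - β(y))` that vanishes for `z = 0`. -/
structure IsStep (β : RatFunc ℂ) (f G : ℂ × ℂ → ℂ) : Prop where
  analyticAt : AnalyticAt ℂ G (0, 0)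
  apply_zero : ∀ y, G (0, y) = 0
  dz_eq : ∀ᶠ p in 𝓝 ((0 : ℂ), (0 : ℂ)), p.2 ≠ 0 →
    (p.1 - valueAt β p.2) * dz G p = f p - evalAt β f p.2

/-- The solution is written as `z Q`, so it vanishes on `z = 0` for every `y` and not only for small
`y`. -/
lemma exists_isStep_of_quotient {β : RatFunc ℂ} {f q : ℂ × ℂ → ℂ} (hq : AnalyticAt ℂ q (0, 0))
    (h : ∀ᶠ p in 𝓝 ((0 : ℂ), (0 : ℂ)), p.2 ≠ 0 →
      (p.1 - valueAt β p.2) * q p = f p - evalAt β f p.2) : ∃ G, IsStep β f G := by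
  obtain ⟨Q, hQ, hd⟩ := AnalyticAt.exists_primitive_fst hq
  refine ⟨fun p => p.1 * Q p, analyticAt_fst.mul hQ, fun y => by simp, ?_⟩
  filter_upwards [h, hd] with p hp hd hp2
  rw [← hp hp2]
  congr 1
  exact hd.deriv

/-- If `z = β(y)` passes through the origin, shear it onto `z = 0`, apply Hadamard's lemma and shear
back. Otherwise `1/(z - β) = k/(z k - 1)` with `k = 1/β` analytic, and the denominator is `-1` at
the origin. -/
lemma exists_isStep (β : RatFunc ℂ) {f : ℂ × ℂ → ℂ} (hf : AnalyticAt ℂ f (0, 0)) :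
    ∃ G, IsStep β f G := by
  by_cases hβ : β.num.eval 0 = 0
  · have hb := analyticAt_valueAt_zero hβ
    have hb0 := valueAt_at_zero hβ
    have hb2 : AnalyticAt ℂ (fun p : ℂ × ℂ => valueAt β p.2) (0, 0) :=
      AnalyticAt.fun_comp (g := valueAt β) hb analyticAt_snd
    have hplus : AnalyticAt ℂ (fun p : ℂ × ℂ => (p.1 + valueAt β p.2, p.2)) (0, 0) :=
      (analyticAt_fst.add hb2).prod analyticAt_snd
    have hminus : AnalyticAt ℂ (fun p : ℂ × ℂ => (p.1 - valueAt β p.2, p.2)) (0, 0) :=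
      (analyticAt_fst.sub hb2).prod analyticAt_snd
    have h1 : AnalyticAt ℂ (fun p : ℂ × ℂ => f (p.1 + valueAt β p.2, p.2)) (0, 0) :=
      AnalyticAt.fun_comp (g := f) (by simpa [hb0] using hf) hplus
    obtain ⟨Q, hQ, hQe⟩ := AnalyticAt.exists_quotient_fst h1
    refine exists_isStep_of_quotient (q := fun p => Q (p.1 - valueAt β p.2, p.2))
      (AnalyticAt.fun_comp (g := Q) (by simpa [hb0] using hQ) hminus) ?_
    have ht : Tendsto (fun p : ℂ × ℂ => (p.1 - valueAt β p.2, p.2)) (𝓝 (0, 0)) (𝓝 (0, 0)) := by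
      simpa [hb0] using hminus.continuousAt.tendsto
    filter_upwards [ht.eventually hQe] with p hp _
    rw [evalAt_of_small hβ]
    simpa using hp.symm
  · obtain ⟨k, hk, hk1⟩ := exists_analytic_inv_valueAt hβ
    have hk2 : AnalyticAt ℂ (fun p : ℂ × ℂ => k p.2) (0, 0) :=
      AnalyticAt.fun_comp (g := k) hk analyticAt_snd
    have hden : AnalyticAt ℂ (fun p : ℂ × ℂ => p.1 * k p.2 - 1) (0, 0) :=
      (analyticAt_fst.mul hk2).sub analyticAt_const
    have hden0 : ∀ᶠ p in 𝓝 ((0 : ℂ), (0 : ℂ)), p.1 * k p.2 - 1 ≠ 0 :=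
      hden.continuousAt.eventually_ne (by simp)
    refine exists_isStep_of_quotient (q := fun p => f p * k p.2 / (p.1 * k p.2 - 1))
      ((hf.mul hk2).div hden (by simp)) ?_
    have hk3 : ∀ᶠ p in 𝓝 ((0 : ℂ), (0 : ℂ)), p.2 ≠ 0 → k p.2 * valueAt β p.2 = 1 := by
      have := eventually_nhdsWithin_iff.1 hk1
      exact (continuous_snd.tendsto ((0 : ℂ), (0 : ℂ))).eventually this
    filter_upwards [hden0, hk3] with p h1 h2 h3
    rw [evalAt_of_not_small hβ, sub_zero, mul_div_assoc', div_eq_iff h1]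
    linear_combination (-f p) * h2 h3

/-- The regular hyperlogarithm of a word of letters, written in reversed order. -/
def regHyp : List (RatFunc ℂ) → ℂ × ℂ → ℂ
  | [] => fun _ => 1
  | β :: w => Classical.epsilon (IsStep β (regHyp w))

lemma analyticAt_regHyp (w : List (RatFunc ℂ)) : AnalyticAt ℂ (regHyp w) (0, 0) := by
  induction w with
  | nil => exact analyticAt_const
  | cons β w ih => exact (Classical.epsilon_spec (exists_isStep β ih)).analyticAt

lemma isStep_regHyp (β : RatFunc ℂ) (w : List (RatFunc ℂ)) :
    IsStep β (regHyp w) (regHyp (β :: w)) :=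
  Classical.epsilon_spec (exists_isStep β (analyticAt_regHyp w))

lemma regHyp_cons_zero (β : RatFunc ℂ) (w : List (RatFunc ℂ)) (y : ℂ) :
    regHyp (β :: w) (0, y) = 0 := (isStep_regHyp β w).apply_zero y

lemma eventually_strip_regHyp (w : List (RatFunc ℂ)) :
    ∀ᶠ p in strip, AnalyticAt ℂ (regHyp w) p :=
  strip_le (analyticAt_regHyp w).eventually_analyticAt

lemma eventually_strip_dz_regHyp (β : RatFunc ℂ) (w : List (RatFunc ℂ)) :
    ∀ᶠ p in strip, ∀ᶠ q in 𝓝 p,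
      (q.1 - valueAt β q.2) * dz (regHyp (β :: w)) q = regHyp w q - evalAt β (regHyp w) q.2 :=
  eventually_strip_of_punctured (isStep_regHyp β w).dz_eq

lemma analyticAt_evalAt {β : RatFunc ℂ} {f : ℂ × ℂ → ℂ} (hf : AnalyticAt ℂ f (0, 0)) :
    AnalyticAt ℂ (evalAt β f) 0 := by
  by_cases hβ : β.num.eval 0 = 0
  · rw [show evalAt β f = fun y => f (valueAt β y, y) from funext (evalAt_of_small hβ f)]
    have hb := analyticAt_valueAt_zero hβ
    exact AnalyticAt.fun_comp (g := f) (by simpa [valueAt_at_zero hβ] using hf)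
      (hb.prod analyticAt_id)
  · rw [show evalAt β f = fun _ => 0 from funext (evalAt_of_not_small hβ f)]
    exact analyticAt_const

/-! ### The differential equation in the second variable -/

/-- The derivative `∂_y + α'(y) ∂_z`. -/
def alongDeriv (α : RatFunc ℂ) (f : ℂ × ℂ → ℂ) (p : ℂ × ℂ) : ℂ :=
  dy f p + deriv (valueAt α) p.2 * dz f p

lemma eventually_hasDerivAt_evalAt (α : RatFunc ℂ) {f : ℂ × ℂ → ℂ}
    (hf : AnalyticAt ℂ f (0, 0)) :
    ∀ᶠ y in slitNhds, HasDerivAt (evalAt α f) (evalAt α (alongDeriv α f) y) y := by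
  by_cases hα : α.num.eval 0 = 0
  · have h1 := (tendsto_curve_strip hα).eventually (strip_le hf.eventually_analyticAt)
    filter_upwards [h1, nhdsWithin_slitPlane_le (eventually_analyticAt_valueAt α)] with y hy hy2
    rw [show evalAt α f = fun y => f (valueAt α y, y) from funext (evalAt_of_small hα f),
      evalAt_of_small hα]
    exact hasDerivAt_comp_curve hy.differentiableAt hy2.differentiableAt.hasDerivAt
  · refine Eventually.of_forall fun y => ?_
    rw [show evalAt α f = fun _ => 0 from funext (evalAt_of_not_small hα f),
      evalAt_of_not_small hα]
    exact hasDerivAt_const y 0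

/-- `(z - α) ∂_z (D_α G) = D_α f - (D_α f)(α(y), y)` if `G` is the integral of `f`. -/
lemma dz_alongDeriv_step {α : RatFunc ℂ} {f G : ℂ × ℂ → ℂ} (hf : AnalyticAt ℂ f (0, 0))
    (hG : IsStep α f G) :
    ∀ᶠ p in strip, (p.1 - valueAt α p.2) * dz (alongDeriv α G) p =
      alongDeriv α f p - evalAt α (alongDeriv α f) p.2 := by
  filter_upwards [strip_le hf.eventually_analyticAt, strip_le hG.analyticAt.eventually_analyticAt,
    eventually_strip_of_punctured hG.dz_eq,
    eventually_strip_of_snd (eventually_hasDerivAt_evalAt α hf),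
    eventually_strip_of_snd (nhdsWithin_slitPlane_le (eventually_analyticAt_valueAt α))]
    with p h1 h2 h3 h4 h5
  have hdz := AnalyticAt.dz h2
  have hdy := AnalyticAt.dy h2
  have c1 : Tendsto (fun z : ℂ => (z, p.2)) (𝓝 p.1) (𝓝 p) :=
    Continuous.tendsto (by fun_prop : Continuous fun z : ℂ => (z, p.2)) p.1
  have c2 : Tendsto (fun y : ℂ => (p.1, y)) (𝓝 p.2) (𝓝 p) :=
    Continuous.tendsto (by fun_prop : Continuous fun y : ℂ => (p.1, y)) p.2
  -- the derivative in `z` of the defining relation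
  have e1 : dz G p + (p.1 - valueAt α p.2) * dz (dz G) p = dz f p := by
    have d1 := ((hasDerivAt_id p.1).sub_const (valueAt α p.2)).fun_mul
      (hasDerivAt_fst hdz.differentiableAt)
    have d2 := (hasDerivAt_fst h1.differentiableAt).sub_const (evalAt α f p.2)
    have := (d1.congr_of_eventuallyEq (c1.eventually h3 |>.mono fun z hz => hz.symm)).unique d2
    rw [← dz_eq hdz.differentiableAt, ← dz_eq h1.differentiableAt] at this
    simpa using this
  -- the derivative in `y` of the defining relation
  have e2 : -deriv (valueAt α) p.2 * dz G p + (p.1 - valueAt α p.2) * dy (dz G) p =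
      dy f p - evalAt α (alongDeriv α f) p.2 := by
    have d1 := (h5.differentiableAt.hasDerivAt.const_sub p.1).fun_mul
      (hasDerivAt_snd hdz.differentiableAt)
    have d2 := (hasDerivAt_snd h1.differentiableAt).fun_sub h4
    have := (d1.congr_of_eventuallyEq (c2.eventually h3 |>.mono fun z hz => hz.symm)).unique d2
    rw [← dy_eq hdz.differentiableAt, ← dy_eq h1.differentiableAt] at this
    simpa using this
  have e3 : dz (alongDeriv α G) p = dz (dy G) p + deriv (valueAt α) p.2 * dz (dz G) p := by
    have d1 := (hasDerivAt_fst hdy.differentiableAt).fun_add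
      ((hasDerivAt_fst hdz.differentiableAt).const_mul (deriv (valueAt α) p.2))
    rw [← dz_eq hdz.differentiableAt, ← dz_eq hdy.differentiableAt] at d1
    exact d1.deriv
  -- Adding `α'` times the `z`-derivative of the defining relation to its `y`-derivative cancels the
  -- terms `±α' ∂_z G`: the field `∂_y + α' ∂_z` annihilates `z - α`.
  rw [e3, dz_dy_comm h2]
  simp only [alongDeriv] at *
  linear_combination e2 + deriv (valueAt α) p.2 * e1

/-! ### The derivative in the second variable stays in the span -/

lemma evalAt_coeff_mul (γ : RatFunc ℂ) (c : ℂ → ℂ) (f : ℂ × ℂ → ℂ) (y : ℂ) :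
    evalAt γ (fun p => c p.2 * f p) y = c y * evalAt γ f y := by
  by_cases h : γ.num.eval 0 = 0
  · simp [evalAt_of_small h]
  · simp [evalAt_of_not_small h]

lemma evalAt_add (γ : RatFunc ℂ) (f g : ℂ × ℂ → ℂ) (y : ℂ) :
    evalAt γ (fun p => f p + g p) y = evalAt γ f y + evalAt γ g y := by
  by_cases h : γ.num.eval 0 = 0
  · simp [evalAt_of_small h]
  · simp [evalAt_of_not_small h]

lemma evalAt_zero (γ : RatFunc ℂ) (y : ℂ) : evalAt γ (fun _ => 0) y = 0 := by
  simpa using evalAt_coeff_mul γ (fun _ => 0) (fun _ => 0) y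

lemma evalAt_congr (γ : RatFunc ℂ) {f g : ℂ × ℂ → ℂ} (h : ∀ᶠ p in strip, f p = g p) :
    ∀ᶠ y in slitNhds, evalAt γ f y = evalAt γ g y := by
  by_cases hγ : γ.num.eval 0 = 0
  · simpa only [evalAt_of_small hγ] using (tendsto_curve_strip hγ).eventually h
  · exact Eventually.of_forall fun y => by simp only [evalAt_of_not_small hγ]

/-- `B` is the regularized integral of `Y` for the letter `α`. -/
def Integrates (α : RatFunc ℂ) (Y B : ℂ × ℂ → ℂ) : Prop :=
  ∀ᶠ p in strip, DifferentiableAt ℂ (fun z => B (z, p.2)) p.1 ∧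
    (p.1 - valueAt α p.2) * dz B p = Y p - evalAt α Y p.2 ∧ B (0, p.2) = 0

lemma Integrates.congr {α : RatFunc ℂ} {Y Z B : ℂ × ℂ → ℂ} (h : Integrates α Y B)
    (e : ∀ᶠ p in strip, Z p = Y p) : Integrates α Z B := by
  filter_upwards [h, e, eventually_strip_of_snd (evalAt_congr α e)] with p h1 h2 h3
  rwa [h2, h3]

lemma Integrates.add {α : RatFunc ℂ} {Y Z B C : ℂ × ℂ → ℂ} (h : Integrates α Y B)
    (h' : Integrates α Z C) : Integrates α (fun p => Y p + Z p) (fun p => B p + C p) := by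
  filter_upwards [h, h'] with p h1 h2
  refine ⟨h1.1.fun_add h2.1, ?_, by rw [h1.2.2, h2.2.2, add_zero]⟩
  have : dz (fun p => B p + C p) p = dz B p + dz C p := deriv_fun_add h1.1 h2.1
  rw [this, evalAt_add]
  linear_combination h1.2.1 + h2.2.1

lemma Integrates.coeff_mul {α : RatFunc ℂ} {Y B : ℂ × ℂ → ℂ} (c : ℂ → ℂ) (h : Integrates α Y B) :
    Integrates α (fun p => c p.2 * Y p) (fun p => c p.2 * B p) := by
  filter_upwards [h] with p h1
  refine ⟨h1.1.const_mul _, ?_, by rw [h1.2.2, mul_zero]⟩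
  have : dz (fun p => c p.2 * B p) p = c p.2 * dz B p := deriv_const_mul (c p.2) h1.1
  rw [this, evalAt_coeff_mul]
  linear_combination c p.2 * h1.2.1

lemma integrates_regHyp (α : RatFunc ℂ) (w : List (RatFunc ℂ)) :
    Integrates α (regHyp w) (regHyp (α :: w)) := by
  filter_upwards [eventually_strip_regHyp (α :: w), eventually_strip_dz_regHyp α w] with p h1 h2
  exact ⟨(hasDerivAt_fst h1.differentiableAt).differentiableAt, h2.self_of_nhds,
    regHyp_cons_zero α w p.2⟩

/-- A regularized integral is determined by its value at `z = 0`. -/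
lemma Integrates.eq_add {α : RatFunc ℂ} {Y A B : ℂ × ℂ → ℂ} (h : Integrates α Y B)
    (hA : ∀ᶠ p in strip, DifferentiableAt ℂ (fun z => A (z, p.2)) p.1 ∧
      (p.1 - valueAt α p.2) * dz A p = Y p - evalAt α Y p.2) :
    ∀ᶠ p in strip, A p = B p + A (0, p.2) := by
  obtain ⟨r, hr, H⟩ := eventually_strip_iff.1 (h.and hA)
  refine eventually_strip_iff.2 ⟨r, hr, fun z y hz hy => ?_⟩
  set D : ℂ → ℂ := fun x => A (x, y) - B (x, y) with hD
  have hdiff : ∀ x ∈ Metric.ball (0 : ℂ) r, DifferentiableAt ℂ D x := fun x hx => by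
    have := H x y (by simpa using hx) hy
    exact this.2.1.fun_sub this.1.1
  have hder : ∀ x ∈ Metric.ball (0 : ℂ) r, (x - valueAt α y) * deriv D x = 0 := fun x hx => by
    have := H x y (by simpa using hx) hy
    have e : deriv D x = dz A (x, y) - dz B (x, y) := deriv_fun_sub this.2.1 this.1.1
    rw [e]
    linear_combination this.2.2 - this.1.2.1
  have hdo : DifferentiableOn ℂ D (Metric.ball 0 r) :=
    fun x hx => (hdiff x hx).differentiableWithinAt
  -- The relation gives no information at the single point `x = α(y)`; continuity of the derivative
  -- fills it in.
  have hzero : ∀ x ∈ Metric.ball (0 : ℂ) r, deriv D x = 0 := by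
    intro x hx
    by_contra hne
    have hc : ContinuousAt (deriv D) x :=
      ((hdo.deriv Metric.isOpen_ball).differentiableAt
        (Metric.isOpen_ball.mem_nhds hx)).continuousAt
    have h1 : ∀ᶠ t in 𝓝 x, t = valueAt α y := by
      filter_upwards [hc.eventually_ne hne, Metric.isOpen_ball.mem_nhds hx] with t ht ht2
      exact sub_eq_zero.1 ((mul_eq_zero.1 (hder t ht2)).resolve_right ht)
    have h2 : ∀ᶠ t in 𝓝[≠] x, t = x := by
      filter_upwards [h1.filter_mono nhdsWithin_le_nhds] with t ht
      rw [ht, h1.self_of_nhds]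
    obtain ⟨t, ht, ht2⟩ := (h2.and self_mem_nhdsWithin).exists
    exact ht2 ht
  have hconst := Metric.isOpen_ball.is_const_of_deriv_eq_zero
    (convex_ball (0 : ℂ) r).isPreconnected hdo hzero
    (show z ∈ Metric.ball (0 : ℂ) r by simpa using hz) (Metric.mem_ball_self hr)
  have h0 := (H 0 y (by simpa using hr) hy).1.2.2
  simp only [hD] at hconst
  simp only at h0 ⊢
  linear_combination hconst - h0

/-- Products of a form in `y` with a regular hyperlogarithm of length at most `n`. -/
def stripForms (F : Subfield ℂ) (n : ℕ) : Set (ℂ × ℂ → ℂ) :=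
  {A | ∃ (c : ℂ → ℂ) (v : List (RatFunc ℂ)), EvSpan slitNhds (hyperlogForms F) c ∧
    (∀ β ∈ v, β ∈ FLT F) ∧ v.length ≤ n ∧ A = fun p => c p.2 * regHyp v p}

lemma stripForms_mul {F : Subfield ℂ} {n : ℕ} {c : ℂ → ℂ} {v : List (RatFunc ℂ)}
    (hc : EvSpan slitNhds (hyperlogForms F) c) (hv : ∀ β ∈ v, β ∈ FLT F) (hn : v.length ≤ n) :
    EvSpan strip (stripForms F n) (fun p => c p.2 * regHyp v p) :=
  EvSpan.of_mem ⟨c, v, hc, hv, hn, rfl⟩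

lemma exists_integrates {F : Subfield ℂ} {α : RatFunc ℂ} (hα : α ∈ FLT F) {n : ℕ}
    {Y : ℂ × ℂ → ℂ} (hY : EvSpan strip (stripForms F n) Y) :
    ∃ B, EvSpan strip (stripForms F (n + 1)) B ∧ Integrates α Y B := by
  refine hY.induction
    (P := fun Y => ∃ B, EvSpan strip (stripForms F (n + 1)) B ∧ Integrates α Y B) ?_ ?_ ?_ ?_ ?_
  · rintro f g ⟨B, hB, h⟩ e
    exact ⟨B, hB, h.congr e⟩
  · rintro _ ⟨c, v, hc, hv, hn, rfl⟩
    refine ⟨_, stripForms_mul hc (v := α :: v) ?_ (by simpa using hn),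
      (integrates_regHyp α v).coeff_mul c⟩
    simpa using ⟨hα, hv⟩
  · refine ⟨_, EvSpan.zero _ _, ?_⟩
    refine Eventually.of_forall fun p => ⟨differentiableAt_const _, ?_, rfl⟩
    simp [dz, evalAt_zero]
  · rintro f g ⟨B, hB, h⟩ ⟨C, hC, h'⟩
    exact ⟨_, hB.add hC, h.add h'⟩
  · rintro c f ⟨B, hB, h⟩
    exact ⟨_, hB.const_mul c, h.coeff_mul fun _ => c⟩

lemma evalAt_stripForms {F : Subfield ℂ} {γ : RatFunc ℂ} {n : ℕ}
    (hE : ∀ w : List (RatFunc ℂ), w.length ≤ n → (∀ β ∈ w, β ∈ FLT F) →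
      EvSpan slitNhds (hyperlogs F) (evalAt γ (regHyp w)))
    {A : ℂ × ℂ → ℂ} (hA : EvSpan strip (stripForms F n) A) :
    EvSpan slitNhds (hyperlogForms F) (evalAt γ A) := by
  refine hA.induction (P := fun A => EvSpan slitNhds (hyperlogForms F) (evalAt γ A)) ?_ ?_ ?_ ?_ ?_
  · exact fun f g hf e => hf.congr (evalAt_congr γ e)
  · rintro _ ⟨c, v, hc, hv, hn, rfl⟩
    refine (hyperlogForms_mul (hE v hn hv) hc).congr (Eventually.of_forall fun y => ?_)
    rw [evalAt_coeff_mul, mul_comm]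
  · exact (EvSpan.zero _ _).congr (Eventually.of_forall fun y => evalAt_zero γ y)
  · exact fun f g hf hg => (hf.add hg).congr (Eventually.of_forall fun y => evalAt_add γ f g y)
  · exact fun c f hf => (hf.const_mul c).congr
      (Eventually.of_forall fun y => evalAt_coeff_mul γ (fun _ => c) f y)

/-- The regularized integral for the letter `α` of the derivative of a regular hyperlogarithm that
ends with `δ`. -/
lemma exists_integrates_dz {F : Subfield ℂ} (hsqrt : ∀ x : ℂ, x ^ 2 ∈ F → x ∈ F)
    {α δ : RatFunc ℂ} (hα : α ∈ FLT F) (hδ : δ ∈ FLT F) {u : List (RatFunc ℂ)}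
    (hu : ∀ β ∈ u, β ∈ FLT F) (hE : EvSpan slitNhds (hyperlogs F) (evalAt δ (regHyp u))) :
    ∃ B, EvSpan strip (stripForms F (u.length + 1)) B ∧ Integrates α
      (fun p => (deriv (valueAt α) p.2 - deriv (valueAt δ) p.2) * dz (regHyp (δ :: u)) p) B := by
  by_cases hne : α = δ
  · subst hne
    refine ⟨_, EvSpan.zero _ _, ?_⟩
    refine Eventually.of_forall fun p => ⟨differentiableAt_const _, ?_, rfl⟩
    simp [dz, evalAt_zero]
  · obtain ⟨hq, hq0⟩ := simplePoles_logDeriv_valueAt_sub hsqrt hα hδ hne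
    set q : ℂ → ℂ := fun y =>
      (deriv (valueAt α) y - deriv (valueAt δ) y) / (valueAt α y - valueAt δ y) with hqdef
    have hqf : EvSpan slitNhds (hyperlogForms F) q :=
      (simplePoles_mul (hyperlogs_const F 1) hq).congr
        (Eventually.of_forall fun y => (one_mul _).symm)
    -- Partial fractions for `1/((z - α)(z - δ))` give `B = q (t_{uα} - t_{uδ} - t_u(δ) t_α)` with
    -- `q = (α' - δ')/(α - δ)`. The last term corrects for the value subtracted in `∂_z t_{uδ}`.
    have hB := ((stripForms_mul (n := u.length + 1) hqf (v := α :: u) (by simpa using ⟨hα, hu⟩)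
      (by simp)).sub (stripForms_mul (n := u.length + 1) hqf (v := δ :: u)
        (by simpa using ⟨hδ, hu⟩) (by simp))).sub (stripForms_mul (n := u.length + 1)
        (simplePoles_mul hE hq) (v := [α]) (by simpa using hα) (by simp))
    refine ⟨_, hB, ?_⟩
    have hrel := eventually_strip_dz_regHyp δ u
    have hcurve : ∀ᶠ y in slitNhds, (valueAt α y - valueAt δ y) * evalAt α (dz (regHyp (δ :: u))) y
        = evalAt α (regHyp u) y - evalAt δ (regHyp u) y * evalAt α (regHyp []) y := by
      by_cases h : α.num.eval 0 = 0
      · filter_upwards [(tendsto_curve_strip h).eventually hrel] with y hy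
        simpa only [evalAt_of_small h, regHyp, mul_one] using hy.self_of_nhds
      · exact Eventually.of_forall fun y => by simp only [evalAt_of_not_small h]; ring
    filter_upwards [integrates_regHyp α u, eventually_strip_regHyp (δ :: u),
      integrates_regHyp α [], eventually_strip_of_snd hcurve, hrel,
      eventually_strip_of_snd (nhdsWithin_slitPlane_le hq0)] with p h1 h2 h3 h4 h5 h6
    have d2 := (hasDerivAt_fst h2.differentiableAt).differentiableAt
    refine ⟨((h1.1.const_mul _).fun_sub (d2.const_mul _)).fun_sub (h3.1.const_mul _), ?_, ?_⟩
    · have e : dz (fun p => q p.2 * regHyp (α :: u) p - q p.2 * regHyp (δ :: u) p -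
          evalAt δ (regHyp u) p.2 * q p.2 * regHyp [α] p) p =
          q p.2 * dz (regHyp (α :: u)) p - q p.2 * dz (regHyp (δ :: u)) p -
          evalAt δ (regHyp u) p.2 * q p.2 * dz (regHyp [α]) p := by
        exact (((h1.1.hasDerivAt.const_mul (q p.2)).fun_sub
          (d2.hasDerivAt.const_mul (q p.2))).fun_sub
          (h3.1.hasDerivAt.const_mul (evalAt δ (regHyp u) p.2 * q p.2))).deriv
      have h7 := sub_ne_zero.2 h6
      have hqv : q p.2 * (valueAt α p.2 - valueAt δ p.2) =
          deriv (valueAt α) p.2 - deriv (valueAt δ) p.2 := div_mul_cancel₀ _ h7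
      have h5' := h5.self_of_nhds
      have h3' := h3.2.1
      have h30 : regHyp [] p = 1 := rfl
      rw [h30] at h3'
      rw [e, evalAt_coeff_mul α (fun y => deriv (valueAt α) y - deriv (valueAt δ) y), ← hqv]
      linear_combination q p.2 * h1.2.1 - q p.2 * h5' -
        evalAt δ (regHyp u) p.2 * q p.2 * h3' + q p.2 * h4
    · simp [h1.2.2, h3.2.2, regHyp_cons_zero]

/-- The derivative of a regular hyperlogarithm along its last letter. -/
lemma alongDeriv_regHyp_step {F : Subfield ℂ} (hsqrt : ∀ x : ℂ, x ^ 2 ∈ F → x ∈ F)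
    {α : RatFunc ℂ} (hα : α ∈ FLT F) {u : List (RatFunc ℂ)}
    (hE : EvSpan slitNhds (hyperlogs F) (evalAt α (regHyp u)))
    {B : ℂ × ℂ → ℂ} (hB : EvSpan strip (stripForms F u.length) B)
    (hint : Integrates α (alongDeriv α (regHyp u)) B) :
    EvSpan strip (stripForms F u.length) (alongDeriv α (regHyp (α :: u))) := by
  have hstep := isStep_regHyp α u
  have hd : ∀ᶠ p in strip,
      DifferentiableAt ℂ (fun z => alongDeriv α (regHyp (α :: u)) (z, p.2)) p.1 := by
    filter_upwards [eventually_strip_regHyp (α :: u)] with p hp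
    exact (hasDerivAt_fst (AnalyticAt.dy hp).differentiableAt).differentiableAt.fun_add
      ((hasDerivAt_fst (AnalyticAt.dz hp).differentiableAt).differentiableAt.const_mul
          (deriv (valueAt α) p.2))
  -- The derivative of `t_{uα}` along `α` satisfies the integral relation of `B`, so the two differ
  -- only by the value at `z = 0`.
  have heq := hint.eq_add (hd.and (dz_alongDeriv_step (analyticAt_regHyp u) hstep))
  -- the value at `z = 0`
  have hzero : EvSpan strip (stripForms F u.length)
      (fun p => alongDeriv α (regHyp (α :: u)) (0, p.2)) := by
    have hdy : ∀ y, dy (regHyp (α :: u)) (0, y) = 0 := fun y => by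
      have : (fun y => regHyp (α :: u) (0, y)) = fun _ => 0 := funext (regHyp_cons_zero α u)
      simp only [dy, this, deriv_const]
    by_cases h0 : α = 0
    · subst h0
      refine (EvSpan.zero _ _).congr (Eventually.of_forall fun p => ?_)
      have : valueAt 0 = fun _ => 0 := funext valueAt_zero
      simp [alongDeriv, hdy, this]
    · obtain ⟨hq, hq0⟩ := simplePoles_logDeriv_valueAt_sub hsqrt hα (zero_mem_FLT F) h0
      have hv0 : valueAt 0 = fun _ => 0 := funext valueAt_zero
      simp only [hv0, deriv_const, sub_zero] at hq hq0
      have hu0 : ∃ c : ℂ, ∀ y, regHyp u (0, y) = c := by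
        cases u with
        | nil => exact ⟨1, fun _ => rfl⟩
        | cons β u => exact ⟨0, regHyp_cons_zero β u⟩
      obtain ⟨c, hc⟩ := hu0
      -- At `z = 0` the `y`-derivative vanishes, and the defining relation leaves `(t_u(α) - t_u(0))
      -- α'/α`, where `t_u(0)` is the constant `c`.
      refine (stripForms_mul (v := []) (simplePoles_mul (hE.sub (hyperlogs_const F c)) hq) (by simp)
        (by simp)).congr ?_
      have hrel : ∀ᶠ y in slitNhds, -valueAt α y * dz (regHyp (α :: u)) (0, y) =
          c - evalAt α (regHyp u) y := by
        obtain ⟨r, hr, H⟩ := eventually_strip_iff.1 (eventually_strip_dz_regHyp α u)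
        filter_upwards [slitBall_mem_nhdsWithin hr] with y hy
        have := (H 0 y (by simpa using hr) hy).self_of_nhds
        simpa [hc] using this
      filter_upwards [eventually_strip_of_snd hrel,
        eventually_strip_of_snd (nhdsWithin_slitPlane_le hq0)] with p h1 h2
      have h3 : regHyp [] p = 1 := rfl
      rw [alongDeriv, hdy, h3]
      field_simp
      linear_combination (-deriv (valueAt α) p.2) * h1
  exact (hB.add hzero).congr heq

/-- Joint induction on the length. Derivatives along the last letter have coefficients built from
curve values of shorter words; curve values are in turn primitives of such derivatives evaluated on
the curve. The derivative along the last letter does not increase the length beyond that of the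
remaining word, which lets the induction close. -/
theorem regHyp_spec {F : Subfield ℂ} (hsqrt : ∀ x : ℂ, x ^ 2 ∈ F → x ∈ F) (n : ℕ) :
    (∀ w : List (RatFunc ℂ), w.length ≤ n → (∀ β ∈ w, β ∈ FLT F) → ∀ γ ∈ FLT F,
      EvSpan slitNhds (hyperlogs F) (evalAt γ (regHyp w))) ∧
    (∀ u : List (RatFunc ℂ), u.length < n → (∀ β ∈ u, β ∈ FLT F) → ∀ α ∈ FLT F,
      EvSpan strip (stripForms F u.length) (alongDeriv α (regHyp (α :: u)))) := by
  have hnil : ∀ γ : RatFunc ℂ, EvSpan slitNhds (hyperlogs F) (evalAt γ (regHyp [])) := by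
    intro γ
    by_cases h : γ.num.eval 0 = 0
    · exact (hyperlogs_const F 1).congr (Eventually.of_forall fun y => evalAt_of_small h _ _)
    · exact (hyperlogs_const F 0).congr (Eventually.of_forall fun y => evalAt_of_not_small h _ _)
  induction n with
  | zero =>
    refine ⟨fun w hw _ γ _ => ?_, fun u hu => absurd hu (by simp)⟩
    rw [List.length_eq_zero_iff.1 (Nat.le_zero.1 hw)]
    exact hnil γ
  | succ n ih =>
    obtain ⟨ihE, ihD⟩ := ih
    have hD : ∀ u : List (RatFunc ℂ), u.length < n + 1 → (∀ β ∈ u, β ∈ FLT F) → ∀ α ∈ FLT F,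
        EvSpan strip (stripForms F u.length) (alongDeriv α (regHyp (α :: u))) := by
      intro u hu huF α hα
      have hEu := ihE u (Nat.lt_succ_iff.1 hu) huF α hα
      cases u with
      | nil =>
        refine alongDeriv_regHyp_step hsqrt hα hEu (EvSpan.zero _ _) ?_
        have : ∀ p, alongDeriv α (regHyp []) p = 0 := fun p => by
          simp [alongDeriv, dz, dy, regHyp]
        rw [funext this]
        refine Eventually.of_forall fun p => ⟨differentiableAt_const _, ?_, rfl⟩
        simp [dz, evalAt_zero]
      | cons δ u =>
        have hδ : δ ∈ FLT F := huF δ (by simp)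
        have huF' : ∀ β ∈ u, β ∈ FLT F := fun β hβ => huF β (by simp [hβ])
        have hlen : u.length < n := by simpa using hu
        -- Split the derivative along `α` into the one along the last letter `δ` of the inner word,
        -- known by induction, and `(α' - δ') ∂_z`, integrated by partial fractions.
        obtain ⟨B₁, hB₁, hi₁⟩ := exists_integrates hα (ihD u hlen huF' δ hδ)
        obtain ⟨B₂, hB₂, hi₂⟩ := exists_integrates_dz hsqrt hα hδ huF' (ihE u hlen.le huF' δ hδ)
        refine alongDeriv_regHyp_step hsqrt hα hEu (hB₁.add hB₂) ((hi₁.add hi₂).congr ?_)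
        refine Eventually.of_forall fun p => ?_
        simp only [alongDeriv]
        ring
    refine ⟨fun w hw hwF γ hγ => ?_, hD⟩
    cases w with
    | nil => exact hnil γ
    | cons α u =>
      have hα : α ∈ FLT F := hwF α (by simp)
      have huF : ∀ β ∈ u, β ∈ FLT F := fun β hβ => hwF β (by simp [hβ])
      have hlen : u.length ≤ n := by simpa using hw
      by_cases hsm : γ.num.eval 0 = 0
      swap
      · exact (hyperlogs_const F 0).congr
          (Eventually.of_forall fun y => evalAt_of_not_small hsm _ _)
      have h1 := evalAt_stripForms (γ := γ)
        (fun v hv hvF => ihE v (hv.trans hlen) hvF γ hγ) (hD u (Nat.lt_succ_iff.2 hlen) huF α hα)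
      refine hyperlogs_primitive ?_ (eventually_hasDerivAt_evalAt γ (analyticAt_regHyp (α :: u)))
      by_cases hne : γ = α
      · rw [hne] at h1 ⊢
        exact h1
      -- On `z = γ(y)` the derivatives along `γ` and `α` differ by `(γ' - α') ∂_z t_{uα} = (t_u(γ) -
      -- t_u(α)) (γ' - α')/(γ - α)`.
      · obtain ⟨hq, hq0⟩ := simplePoles_logDeriv_valueAt_sub hsqrt hγ hα hne
        refine (h1.add (simplePoles_mul ((ihE u hlen huF γ hγ).sub (ihE u hlen huF α hα)) hq)).congr
          ?_
        filter_upwards [(tendsto_curve_strip hsm).eventually (eventually_strip_dz_regHyp α u),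
          nhdsWithin_slitPlane_le hq0] with y h2 h3
        have h4 := h2.self_of_nhds
        have h5 := sub_ne_zero.2 h3
        simp only [evalAt_of_small hsm, alongDeriv] at h4 ⊢
        field_simp
        linear_combination (deriv (valueAt γ) y - deriv (valueAt α) y) * h4

/-- Values of regular hyperlogarithms on curves through the origin are hyperlogarithms. -/
theorem hyperlogs_evalAt_regHyp {F : Subfield ℂ} (hsqrt : ∀ x : ℂ, x ^ 2 ∈ F → x ∈ F)
    {w : List (RatFunc ℂ)} (hw : ∀ β ∈ w, β ∈ FLT F) {γ : RatFunc ℂ} (hγ : γ ∈ FLT F) :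
    EvSpan slitNhds (hyperlogs F) (evalAt γ (regHyp w)) :=
  (regHyp_spec hsqrt w.length).1 w le_rfl hw γ hγ

/-! ### The region `|z| ≪ |y| ≪ 1` -/

lemma eventually_baseFilter_iff {P : ℂ × ℂ → Prop} :
    (∀ᶠ p in baseFilter, P p) ↔
      ∃ δ > 0, ∀ y ∈ slitBall δ, ∀ z ∈ slitBall (δ * ‖y‖), P (z, y) := by
  have hb : (𝓝 ((0 : ℂ), (0 : ℂ))).HasBasis (fun ε : ℝ => 0 < ε) (Metric.ball (0, 0)) :=
    Metric.nhds_basis_ball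
  have hbase := (hb.comap fun p : ℂ × ℂ => (p.2, p.1 / p.2)).inf_principal
    {p : ℂ × ℂ | p.1 ∈ Complex.slitPlane ∧ p.2 ∈ Complex.slitPlane}
  rw [baseFilter, hbase.eventually_iff]
  have hdiv : ∀ (δ : ℝ) (y : ℂ), y ∈ Complex.slitPlane → ∀ z : ℂ,
      ‖z / y‖ < δ ↔ ‖z‖ < δ * ‖y‖ := fun δ y hy z => by
    rw [norm_div, div_lt_iff₀ (norm_pos_iff.2 (Complex.slitPlane_ne_zero hy))]
  constructor
  · rintro ⟨δ, hδ, H⟩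
    refine ⟨δ, hδ, fun y hy z hz => H ⟨?_, hz.1, hy.1⟩⟩
    have h1 := norm_lt_of_mem_slitBall hy
    have h2 := (hdiv δ y hy.1 z).2 (norm_lt_of_mem_slitBall hz)
    show dist (y, z / y) (0, 0) < δ
    rw [Prod.dist_eq, max_lt_iff]
    simpa only [dist_zero_right] using And.intro h1 h2
  · rintro ⟨δ, hδ, H⟩
    refine ⟨δ, hδ, ?_⟩
    rintro ⟨z, y⟩ ⟨h, hz, hy⟩
    have h' : ‖y‖ < δ ∧ ‖z / y‖ < δ := by
      have h1 : dist (y, z / y) (0, 0) < δ := h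
      rw [Prod.dist_eq, max_lt_iff] at h1
      simpa only [dist_zero_right] using h1
    exact H y ⟨hy, by simpa using h'.1⟩ z ⟨hz, by simpa using (hdiv δ y hy z).1 h'.2⟩

lemma baseFilter_le_strip : baseFilter ≤ strip := by
  intro s hs
  obtain ⟨r, hr, H⟩ := eventually_strip_iff.1 (show ∀ᶠ p in strip, p ∈ s from hs)
  refine eventually_baseFilter_iff.2 ⟨min r 1, lt_min hr one_pos, fun y hy z hz => ?_⟩
  refine H z y ?_ (slitBall_mono (min_le_left _ _) hy)
  have h1 := norm_lt_of_mem_slitBall hy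
  have h2 := norm_lt_of_mem_slitBall hz
  have h3 : min r 1 * ‖y‖ ≤ 1 * ‖y‖ :=
    mul_le_mul_of_nonneg_right (min_le_right _ _) (norm_nonneg _)
  linarith [min_le_left r 1]

lemma eventually_baseFilter_of_snd {P : ℂ → Prop} (h : ∀ᶠ y in slitNhds, P y) :
    ∀ᶠ p in baseFilter, P p.2 := baseFilter_le_strip (eventually_strip_of_snd h)

lemma eventually_baseFilter_mem :
    ∀ᶠ p in baseFilter, p.1 ∈ Complex.slitPlane ∧ p.2 ∈ Complex.slitPlane :=
  eventually_baseFilter_iff.2 ⟨1, one_pos, fun _ hy _ hz => ⟨hz.1, hy.1⟩⟩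

/-- For small `y`, all non-zero letters have absolute value at least `δ |y|`. -/
lemma exists_letters_bound {F : Subfield ℂ} {S : Set (RatFunc ℂ)} (hfin : S.Finite)
    (hS : S ⊆ FLT F) : ∃ δ > 0, ∀ y ∈ slitBall δ, ∀ β ∈ S, β ≠ 0 → δ * ‖y‖ ≤ ‖valueAt β y‖ := by
  induction S, hfin using Set.Finite.induction_on with
  | empty => exact ⟨1, one_pos, by simp⟩
  | @insert a T _ _ ih =>
    obtain ⟨δ, hδ, H⟩ := ih (fun β hβ => hS (Set.mem_insert_of_mem _ hβ))
    by_cases ha : a = 0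
    · refine ⟨δ, hδ, fun y hy β hβ h0 => ?_⟩
      rcases hβ with rfl | hβ
      · exact absurd ha h0
      · exact H y hy β hβ h0
    · obtain ⟨c, hc, h⟩ := FLT.exists_le_norm_valueAt (hS (Set.mem_insert _ _)) ha
      obtain ⟨ρ, hρ, h'⟩ := mem_nhdsWithin_slitPlane_iff.1 (nhdsWithin_slitPlane_le h)
      refine ⟨min δ (min c ρ), by positivity, fun y hy β hβ h0 => ?_⟩
      rcases hβ with rfl | hβ
      · refine le_trans ?_ (h' (slitBall_mono ((min_le_right _ _).trans (min_le_right _ _)) hy))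
        exact mul_le_mul_of_nonneg_right ((min_le_right _ _).trans (min_le_left _ _))
          (norm_nonneg _)
      · refine le_trans ?_ (H y (slitBall_mono (min_le_left _ _) hy) β hβ h0)
        exact mul_le_mul_of_nonneg_right (min_le_left _ _) (norm_nonneg _)

/-! ### Primitives in the first variable -/

/-- `B` is a primitive of `D` in the first variable that tends to `0` for `z → 0`. -/
def ZPrim (D B : ℂ × ℂ → ℂ) : Prop :=
  (∀ᶠ p in baseFilter, HasDerivAt (fun z => B (z, p.2)) (D p) p.1) ∧
    ∀ᶠ y in slitNhds, Tendsto (fun z => B (z, y)) slitNhds (𝓝 0)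

lemma ZPrim.congr {D E B : ℂ × ℂ → ℂ} (h : ZPrim D B) (e : ∀ᶠ p in baseFilter, E p = D p) :
    ZPrim E B := by
  refine ⟨?_, h.2⟩
  filter_upwards [h.1, e] with p h1 h2
  rwa [h2]

lemma ZPrim.add {D E B C : ℂ × ℂ → ℂ} (h : ZPrim D B) (h' : ZPrim E C) :
    ZPrim (fun p => D p + E p) (fun p => B p + C p) := by
  constructor
  · filter_upwards [h.1, h'.1] with p h1 h2 using h1.fun_add h2
  · filter_upwards [h.2, h'.2] with y h1 h2 using by simpa using h1.add h2

lemma ZPrim.coeff_mul {D B : ℂ × ℂ → ℂ} (c : ℂ → ℂ) (h : ZPrim D B) :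
    ZPrim (fun p => c p.2 * D p) (fun p => c p.2 * B p) := by
  constructor
  · filter_upwards [h.1] with p h1 using h1.const_mul (c p.2)
  · filter_upwards [h.2] with y h1 using by simpa using h1.const_mul (c y)

lemma ZPrim.zero : ZPrim (fun _ => 0) (fun _ => 0) :=
  ⟨Eventually.of_forall fun p => hasDerivAt_const p.1 (0 : ℂ),
    Eventually.of_forall fun _ => tendsto_const_nhds⟩

lemma ZPrim.unique {D B C : ℂ × ℂ → ℂ} (h : ZPrim D B) (h' : ZPrim D C) :
    ∀ᶠ p in baseFilter, B p = C p := by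
  obtain ⟨δ, hδ, H⟩ := eventually_baseFilter_iff.1 (h.1.and h'.1)
  obtain ⟨ρ, hρ, H'⟩ := mem_nhdsWithin_slitPlane_iff.1 (h.2.and h'.2)
  refine eventually_baseFilter_iff.2 ⟨min δ ρ, lt_min hδ hρ, fun y hy z hz => ?_⟩
  have hy1 := slitBall_mono (min_le_left _ _) hy
  have hy2 := H' (slitBall_mono (min_le_right _ _) hy)
  have hy0 : 0 < δ * ‖y‖ := mul_pos hδ (norm_pos_iff.2 (slitBall_ne_zero hy))
  exact eqOn_slitBall_of_hasDerivAt hy0 (f := fun z => B (z, y)) (g := fun z => C (z, y))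
    (fun x hx => (H y hy1 x hx).1) (fun x hx => (H y hy1 x hx).2) hy2.1 hy2.2 z
    (slitBall_mono (mul_le_mul_of_nonneg_right (min_le_left _ _) (norm_nonneg _)) hz)

/-- The function of `(z, y)` whose germ is `hyperlogZ w`. -/
def hyperlogFun (w : List (RatFunc ℂ)) (p : ℂ × ℂ) : ℂ :=
  hyperlog (w.map fun β => valueAt β p.2) p.1

/-- All non-zero letters stay at distance at least `δ |y|` from `0`, so the one-variable theory
applies on the slit disc of that radius, which is the fibre of the region over `y`. -/
lemma zPrim_hyperlogFun {F : Subfield ℂ} {w : List (RatFunc ℂ)} {α : RatFunc ℂ}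
    (hw : ∀ β ∈ w ++ [α], β ∈ FLT F) (h0 : ∃ β ∈ w ++ [α], β ≠ 0) :
    ZPrim (fun p => hyperlogFun w p / (p.1 - valueAt α p.2)) (hyperlogFun (w ++ [α])) := by
  obtain ⟨δ, hδ, H⟩ := exists_letters_bound (S := {β | β ∈ w ++ [α]})
    (List.finite_toSet _) hw
  constructor
  · refine eventually_baseFilter_iff.2 ⟨δ, hδ, fun y hy z hz => ?_⟩
    have hy0 : 0 < δ * ‖y‖ := mul_pos hδ (norm_pos_iff.2 (slitBall_ne_zero hy))
    simp only [hyperlogFun, List.map_append, List.map_cons, List.map_nil]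
    refine hasDerivAt_hyperlog hy0 (fun b hb hb0 => ?_) hz
    obtain ⟨β, hβ, rfl⟩ : ∃ β ∈ w ++ [α], valueAt β y = b := by
      rw [← List.mem_map]
      simpa using hb
    exact H y hy β hβ fun h => hb0 (by rw [h, valueAt_zero])
  · filter_upwards [slitBall_mem_nhdsWithin hδ] with y hy
    obtain ⟨β, hβ, hβ0⟩ := h0
    refine tendsto_hyperlog ⟨valueAt β y, List.mem_map.2 ⟨β, hβ, rfl⟩, ?_⟩
    have h1 := H y hy β hβ hβ0
    have h2 : 0 < δ * ‖y‖ := mul_pos hδ (norm_pos_iff.2 (slitBall_ne_zero hy))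
    exact norm_pos_iff.1 (h2.trans_le h1)

/-! ### Decomposition of hyperlogarithms -/

/-- Products of a power of `log z` with a regular hyperlogarithm of a non-empty word. -/
def regForms (F : Subfield ℂ) : Set (ℂ × ℂ → ℂ) :=
  {f | ∃ (k : ℕ) (v : List (RatFunc ℂ)), v ≠ [] ∧ (∀ β ∈ v, β ∈ FLT F) ∧
    f = fun p => Complex.log p.1 ^ k * regHyp v p}

/-- Singular hyperlogarithms, multiplied by values of regular ones. -/
def singForms (F : Subfield ℂ) (S : Set (RatFunc ℂ)) : Set (ℂ × ℂ → ℂ) :=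
  {f | ∃ (γ : RatFunc ℂ) (v : List (RatFunc ℂ)) (l : ℕ) (β : RatFunc ℂ) (u : List (RatFunc ℂ)),
    γ ∈ FLT F ∧ (∀ δ ∈ v, δ ∈ FLT F) ∧ β ∈ S ∧ VanishesAtZero β ∧ (∀ δ ∈ u, δ ∈ S) ∧
    f = fun p => evalAt γ (regHyp v) p.2 * hyperlogFun (List.replicate l 0 ++ β :: u) p}

lemma EvSpan.mono {ι : Type*} {l : Filter ι} {X Y : Set (ι → ℂ)} (h : X ⊆ Y) {f : ι → ℂ}
    (hf : EvSpan l X f) : EvSpan l Y f := by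
  obtain ⟨g, hg, e⟩ := hf
  exact ⟨g, Submodule.span_mono h hg, e⟩

lemma EvSpan.exists_add {ι : Type*} {l : Filter ι} {X Y : Set (ι → ℂ)} {f : ι → ℂ}
    (hf : EvSpan l (X ∪ Y) f) :
    ∃ r s, EvSpan l X r ∧ EvSpan l Y s ∧ ∀ᶠ p in l, f p = r p + s p := by
  obtain ⟨g, hg, e⟩ := hf
  rw [Submodule.span_union] at hg
  obtain ⟨r, hr, s, hs, rfl⟩ := Submodule.mem_sup.1 hg
  exact ⟨r, s, ⟨r, hr, EventuallyEq.rfl⟩, ⟨s, hs, EventuallyEq.rfl⟩, e⟩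

/-- For a non-empty word the regular hyperlogarithm is `O(z)`, which beats every power of the
logarithm. -/
lemma tendsto_log_pow_mul_regHyp (k : ℕ) (β : RatFunc ℂ) (v : List (RatFunc ℂ)) :
    ∀ᶠ y in slitNhds,
      Tendsto (fun z => Complex.log z ^ k * regHyp (β :: v) (z, y)) slitNhds (𝓝 0) := by
  obtain ⟨r, hr, H⟩ := eventually_strip_iff.1 (eventually_strip_regHyp (β :: v))
  filter_upwards [slitBall_mem_nhdsWithin hr] with y hy
  have h1 := hasDerivAt_fst (H 0 y (by simpa using hr) hy).differentiableAt
  have h2 : (fun z => regHyp (β :: v) (z, y)) =O[slitNhds] fun z => z := by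
    simpa [regHyp_cons_zero] using h1.isBigO_sub.mono nhdsWithin_le_nhds
  exact ((Asymptotics.isBigO_refl (fun z => Complex.log z ^ k) slitNhds).mul h2).trans_tendsto
    (tendsto_log_pow_mul_self k)

/-- Powers of `log z` times the derivative of a regular hyperlogarithm have regular primitives. -/
lemma exists_zPrim_log_pow_mul_dz {F : Subfield ℂ} (k : ℕ) (β : RatFunc ℂ) (v : List (RatFunc ℂ))
    (hv : ∀ δ ∈ β :: v, δ ∈ FLT F) :
    ∃ B, EvSpan baseFilter (regForms F) B ∧
      ZPrim (fun p => Complex.log p.1 ^ k * dz (regHyp (β :: v)) p) B := by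
  have hd : ∀ᶠ p in baseFilter, HasDerivAt (fun z => regHyp (β :: v) (z, p.2))
      (dz (regHyp (β :: v)) p) p.1 := by
    filter_upwards [baseFilter_le_strip (eventually_strip_regHyp (β :: v))] with p hp
    exact (hasDerivAt_fst hp.differentiableAt).differentiableAt.hasDerivAt
  induction k generalizing β v with
  | zero =>
    refine ⟨_, EvSpan.of_mem ⟨0, β :: v, by simp, hv, rfl⟩, ?_, tendsto_log_pow_mul_regHyp 0 β v⟩
    simpa using hd
  | succ k ih =>
    have hv' : ∀ δ ∈ 0 :: β :: v, δ ∈ FLT F := by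
      exact List.forall_mem_cons.2 (And.intro (zero_mem_FLT F) hv)
    -- Integration by parts leaves `(log z)^k t/z`. Since `t` vanishes for `z = 0`, `t/z` is the
    -- `z`-derivative of the regular hyperlogarithm with one more letter `0`.
    obtain ⟨B, hB, hp⟩ := ih 0 (β :: v) hv' (by
      filter_upwards [baseFilter_le_strip (eventually_strip_regHyp (0 :: β :: v))] with p hp
      exact (hasDerivAt_fst hp.differentiableAt).differentiableAt.hasDerivAt)
    refine ⟨_, (EvSpan.of_mem (X := regForms F) ⟨k + 1, β :: v, by simp, hv, rfl⟩).add
      (hB.const_mul (-(k + 1 : ℂ))), ?_⟩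
    have h1 := hp.coeff_mul fun _ => -(k + 1 : ℂ)
    refine ⟨?_, ?_⟩
    · filter_upwards [h1.1, hd, eventually_baseFilter_mem,
        baseFilter_le_strip (eventually_strip_dz_regHyp 0 (β :: v))] with p h2 h3 h4 h5
      refine ((((Complex.hasDerivAt_log h4.1).pow (k + 1)).fun_mul h3).fun_add h2).congr_deriv ?_
      have h6 : p.1 ≠ 0 := Complex.slitPlane_ne_zero h4.1
      have h7 : p.1 * dz (regHyp (0 :: β :: v)) p = regHyp (β :: v) p := by
        have := h5.self_of_nhds
        rw [valueAt_zero, sub_zero, evalAt_of_small (by simp), valueAt_zero,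
          regHyp_cons_zero, sub_zero] at this
        exact this
      have h8 : dz (regHyp (0 :: β :: v)) p = p.1⁻¹ * regHyp (β :: v) p := by
        rw [← h7, inv_mul_cancel_left₀ h6]
      rw [h8]
      simp only [Nat.cast_add, Nat.cast_one, Nat.add_sub_cancel, Pi.pow_apply]
      ring
    · filter_upwards [tendsto_log_pow_mul_regHyp (k + 1) β v, h1.2] with y h2 h3
      simpa using h2.add h3

/-- Primitives of `(log z)^k t_w(z) / (z - α)`, where `w` is non-empty if `α = 0`. -/
lemma exists_zPrim_log_pow_mul_regHyp {F : Subfield ℂ} {S : Set (RatFunc ℂ)} (hS : S ⊆ FLT F)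
    {α : RatFunc ℂ} (hα : α ∈ S) (k : ℕ) {w : List (RatFunc ℂ)} (hw : ∀ β ∈ w, β ∈ FLT F)
    (h0 : w ≠ [] ∨ α ≠ 0) :
    ∃ B, EvSpan baseFilter (regForms F ∪ singForms F S) B ∧
      ZPrim (fun p => Complex.log p.1 ^ k * regHyp w p / (p.1 - valueAt α p.2)) B := by
  obtain ⟨B₁, hB₁, hp₁⟩ := exists_zPrim_log_pow_mul_dz (F := F) k α w
    (List.forall_mem_cons.2 (And.intro (hS hα) hw))
  -- This is the term removed by the regularization. It produces a singular hyperlogarithm exactly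
  -- for letters with `α ≠ 0 = α(0)`; otherwise its coefficient vanishes.
  have h2 : ∃ B, EvSpan baseFilter (singForms F S) B ∧ ZPrim (fun p =>
      evalAt α (regHyp w) p.2 * (Complex.log p.1 ^ k / (p.1 - valueAt α p.2))) B := by
    by_cases hsing : VanishesAtZero α
    · refine ⟨_, (EvSpan.of_mem (X := singForms F S)
        ⟨α, w, k, α, [], hS hα, hw, hα, hsing, by simp, rfl⟩).const_mul
        (k.factorial : ℂ), ?_⟩
      have h3 := ((zPrim_hyperlogFun (F := F) (w := List.replicate k 0) (α := α) (by
        intro β hβ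
        rcases List.mem_append.1 hβ with h | h
        · rw [List.eq_of_mem_replicate h]; exact zero_mem_FLT F
        · rw [List.mem_singleton.1 h]; exact hS hα) ⟨α, by simp, hsing.1⟩).coeff_mul
        (evalAt α (regHyp w))).coeff_mul (fun _ => (k.factorial : ℂ))
      refine h3.congr (Eventually.of_forall fun p => ?_)
      have : hyperlogFun (List.replicate k 0) p = Complex.log p.1 ^ k / (k.factorial : ℂ) := by
        simp [hyperlogFun, hyperlog_replicate_zero]
      rw [this]
      have : (k.factorial : ℂ) ≠ 0 := by exact_mod_cast k.factorial_ne_zero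
      field_simp
    · refine ⟨_, EvSpan.zero _ _, ZPrim.zero.congr (Eventually.of_forall fun p => ?_)⟩
      -- Either the curve misses the origin and nothing was subtracted, or `α = 0` and `t_w`
      -- vanishes for `z = 0`, the word being non-empty.
      have : evalAt α (regHyp w) p.2 = 0 := by
        by_cases h : α.num.eval 0 = 0
        · have hα0 : α = 0 := by
            by_contra h'
            exact hsing ⟨h', h⟩
          obtain ⟨β, v, rfl⟩ := List.exists_cons_of_ne_nil (h0.resolve_right (not_not.2 hα0))
          rw [evalAt_of_small h, hα0, valueAt_zero, regHyp_cons_zero]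
        · exact evalAt_of_not_small h _ _
      rw [this, zero_mul]
  obtain ⟨B₂, hB₂, hp₂⟩ := h2
  refine ⟨_, (hB₁.mono Set.subset_union_left).add (hB₂.mono Set.subset_union_right),
    (hp₁.add hp₂).congr ?_⟩
  have hne : ∀ᶠ p in baseFilter, p.1 - valueAt α p.2 ≠ 0 := by
    by_cases h : α = 0
    · filter_upwards [eventually_baseFilter_mem] with p hp
      simpa [h] using Complex.slitPlane_ne_zero hp.1
    · obtain ⟨δ, hδ, H⟩ := exists_letters_bound (S := {α}) (Set.finite_singleton α)
        (by simpa using hS hα)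
      refine eventually_baseFilter_iff.2 ⟨δ, hδ, fun y hy z hz => sub_ne_zero.2 fun e => ?_⟩
      have h1 := H y hy α rfl h
      have h2 := norm_lt_of_mem_slitBall hz
      simp only at e
      rw [e] at h2
      exact h2.not_ge h1
  filter_upwards [hne, baseFilter_le_strip (eventually_strip_dz_regHyp α w)] with p h3 h4
  have h5 := h4.self_of_nhds
  field_simp
  linear_combination (-Complex.log p.1 ^ k) * h5

/-- Hyperlogarithms of words with a non-zero letter are sums of regular and singular terms. -/
theorem hyperlogFun_decomposition {F : Subfield ℂ} {S : Set (RatFunc ℂ)} (hS : S ⊆ FLT F)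
    (w : List (RatFunc ℂ)) (hw : ∀ β ∈ w, β ∈ S) (h0 : ∃ β ∈ w, β ≠ 0) :
    EvSpan baseFilter (regForms F ∪ singForms F S) (hyperlogFun w) := by
  induction w using List.reverseRecOn with
  | nil => simp at h0
  | append_singleton w α ih =>
    have hα : α ∈ S := hw α (by simp)
    have hw' : ∀ β ∈ w, β ∈ S := fun β hβ => hw β (by simp [hβ])
    have key : ∃ B, EvSpan baseFilter (regForms F ∪ singForms F S) B ∧
        ZPrim (fun p => hyperlogFun w p / (p.1 - valueAt α p.2)) B := by
      -- The decomposition of `L_w` is integrated term by term, and a letter appended to a singular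
      -- word leaves it singular. If `w` has only zeros, `L_w` is a power of the logarithm, and `α ≠
      -- 0` supplies the non-zero letter.
      by_cases h : ∃ β ∈ w, β ≠ 0
      · refine (ih hw' h).induction (P := fun f => ∃ B,
          EvSpan baseFilter (regForms F ∪ singForms F S) B ∧
          ZPrim (fun p => f p / (p.1 - valueAt α p.2)) B) ?_ ?_ ?_ ?_ ?_
        · rintro f g ⟨B, hB, hp⟩ e
          exact ⟨B, hB, hp.congr (e.mono fun p hp => by rw [hp])⟩
        · rintro f (⟨k, v, hv0, hv, rfl⟩ | ⟨γ, v, l, β, u, hγ, hv, hβ, hβ0, hu, rfl⟩)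
          · exact exists_zPrim_log_pow_mul_regHyp hS hα k hv (Or.inl hv0)
          · refine ⟨_, EvSpan.of_mem (Or.inr ⟨γ, v, l, β, u ++ [α], hγ, hv, hβ, hβ0, ?_, rfl⟩), ?_⟩
            · intro δ hδ
              rcases List.mem_append.1 hδ with h | h
              · exact hu δ h
              · rwa [List.mem_singleton.1 h]
            · have h3 := (zPrim_hyperlogFun (F := F) (w := List.replicate l 0 ++ β :: u)
                (α := α) (by
                intro δ hδ
                simp only [List.mem_append, List.mem_cons] at hδ
                rcases hδ with (h | h | h) | h | h
                · rw [List.eq_of_mem_replicate h]; exact zero_mem_FLT F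
                · rw [h]; exact hS hβ
                · exact hS (hu δ h)
                · rw [h]; exact hS hα
                · simp at h) ⟨β, by simp, hβ0.1⟩).coeff_mul (evalAt γ (regHyp v))
              simp only [List.append_assoc, List.cons_append] at h3
              exact h3.congr (Eventually.of_forall fun p => by rw [mul_div_assoc])
        · exact ⟨_, EvSpan.zero _ _, ZPrim.zero.congr (Eventually.of_forall fun p => zero_div _)⟩
        · rintro f g ⟨B, hB, hp⟩ ⟨C, hC, hq⟩
          exact ⟨_, hB.add hC, (hp.add hq).congr (Eventually.of_forall fun p => add_div _ _ _)⟩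
        · rintro c f ⟨B, hB, hp⟩
          exact ⟨_, hB.const_mul c, (hp.coeff_mul fun _ => c).congr
            (Eventually.of_forall fun p => mul_div_assoc _ _ _)⟩
      · push Not at h
        have hα0 : α ≠ 0 := by
          rintro rfl
          obtain ⟨β, hβ, hβ0⟩ := h0
          rcases List.mem_append.1 hβ with h1 | h1
          · exact hβ0 (h β h1)
          · exact hβ0 (List.mem_singleton.1 h1)
        obtain ⟨B, hB, hp⟩ := exists_zPrim_log_pow_mul_regHyp hS hα w.length (w := []) (by simp)
          (Or.inr hα0)
        refine ⟨_, hB.const_mul (w.length.factorial : ℂ)⁻¹,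
          (hp.coeff_mul fun _ => (w.length.factorial : ℂ)⁻¹).congr
          (Eventually.of_forall fun p => ?_)⟩
        have e1 : hyperlogFun w p = Complex.log p.1 ^ w.length / (w.length.factorial : ℂ) := by
          rw [hyperlogFun, List.eq_replicate_of_mem h]
          simp [hyperlog_replicate_zero]
        have e2 : regHyp [] p = 1 := rfl
        rw [e1, e2]
        ring
    obtain ⟨B, hB, hp⟩ := key
    exact hB.congr ((zPrim_hyperlogFun (fun β hβ => hS (hw β hβ)) h0).unique hp)

/-! ### Germs -/

lemma toGerm_eq_iff {f g : ℂ × ℂ → ℂ} :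
    toGerm f = toGerm g ↔ ∀ᶠ p in baseFilter, f p = g p := Germ.coe_eq

lemma toGerm_mul (f g : ℂ × ℂ → ℂ) : toGerm f * toGerm g = toGerm fun p => f p * g p := rfl

lemma toGerm_add (f g : ℂ × ℂ → ℂ) : toGerm f + toGerm g = toGerm fun p => f p + g p := rfl

lemma smul_toGerm (c : ℂ) (f : ℂ × ℂ → ℂ) : c • toGerm f = toGerm fun p => c * f p := rfl

lemma toGerm_zero : toGerm (fun _ => 0) = 0 := rfl

/-- If the products of `m` with the elements of `X` are in `M`, so are those with `EvSpan`. -/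
lemma EvSpan.toGerm_mul_mem {M : Submodule ℂ BiGerm} {X : Set (ℂ × ℂ → ℂ)} {m f : ℂ × ℂ → ℂ}
    (h : ∀ x ∈ X, toGerm (fun p => m p * x p) ∈ M) (hf : EvSpan baseFilter X f) :
    toGerm (fun p => m p * f p) ∈ M := by
  refine hf.induction (P := fun f => toGerm (fun p => m p * f p) ∈ M) ?_ h ?_ ?_ ?_
  · intro f g hf e
    rwa [toGerm_eq_iff.2 (e.mono fun p hp => by rw [hp] : ∀ᶠ p in baseFilter,
      m p * g p = m p * f p)]
  · simp only [mul_zero]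
    exact M.zero_mem
  · intro f g hf hg
    simp only [mul_add]
    exact M.add_mem hf hg
  · intro c f hf
    simp only [mul_left_comm _ c]
    exact M.smul_mem c hf

lemma EvSpan.comp_snd {X : Set (ℂ → ℂ)} {c : ℂ → ℂ} (hc : EvSpan slitNhds X c) :
    EvSpan baseFilter ((fun (f : ℂ → ℂ) (p : ℂ × ℂ) => f p.2) '' X) (fun p => c p.2) := by
  refine hc.induction (P := fun c => EvSpan baseFilter
    ((fun (f : ℂ → ℂ) (p : ℂ × ℂ) => f p.2) '' X) (fun p => c p.2)) ?_ ?_ ?_ ?_ ?_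
  · exact fun f g hf e => hf.congr (eventually_baseFilter_of_snd e)
  · exact fun f hf => EvSpan.of_mem ⟨f, hf, rfl⟩
  · exact EvSpan.zero _ _
  · exact fun f g hf hg => hf.add hg
  · exact fun c f hf => hf.const_mul c

/-! ### The unions over all finite sets of letters -/

lemma regularRing_mono {S T : Set (RatFunc ℂ)} (h : S ⊆ T) : regularRing S ≤ regularRing T := by
  refine Algebra.adjoin_mono ?_
  rintro φ (((hφ | ⟨β, hβ, hφ⟩) | hφ) | ⟨b, hb, hφ⟩)
  · exact Or.inl (Or.inl (Or.inl hφ))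
  · exact Or.inl (Or.inl (Or.inr ⟨β, h hβ, hφ⟩))
  · exact Or.inl (Or.inr hφ)
  · exact Or.inr ⟨b, h hb, hφ⟩

lemma hyperlogProducts_mono {S T : Set (RatFunc ℂ)} (h : S ⊆ T) :
    hyperlogProducts S ⊆ hyperlogProducts T := by
  rintro f ⟨v, w, hv, hw, rfl⟩
  exact ⟨v, w, fun x hx => (hv x hx).imp fun b hb => ⟨h hb.1, hb.2⟩, fun β hβ => h (hw β hβ), rfl⟩

lemma GHC_mono {S T : Set (RatFunc ℂ)} (h : S ⊆ T) : GHC S ≤ GHC T :=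
  Submodule.span_mono (hyperlogProducts_mono h)

lemma mul_mem_GH {S : Set (RatFunc ℂ)} {φ x : BiGerm} (hφ : φ ∈ regularRing S) (hx : x ∈ GH S) :
    φ * x ∈ GH S :=
  (GH S).smul_mem (⟨φ, hφ⟩ : regularRing S) hx

lemma GH_induction {S : Set (RatFunc ℂ)} {P : BiGerm → Prop}
    (mem : ∀ x ∈ hyperlogProducts S, P x) (zero : P 0) (add : ∀ x y, P x → P y → P (x + y))
    (mul : ∀ φ ∈ regularRing S, ∀ x, P x → P (φ * x)) {f : BiGerm} (hf : f ∈ GH S) : P f :=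
  Submodule.span_induction (p := fun x _ => P x) mem zero (fun x y _ _ => add x y)
    (fun a x _ => mul a.1 a.2 x) hf

lemma GH_mono {S T : Set (RatFunc ℂ)} (h : S ⊆ T) {f : BiGerm} (hf : f ∈ GH S) : f ∈ GH T :=
  GH_induction (fun _ hx => Submodule.subset_span (hyperlogProducts_mono h hx)) (GH T).zero_mem
    (fun _ _ => (GH T).add_mem) (fun _ hφ _ => mul_mem_GH (regularRing_mono h hφ)) hf

lemma algebraMap_mul (c : ℂ) (x : BiGerm) : algebraMap ℂ BiGerm c * x = c • x := by
  rw [Algebra.smul_def]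

lemma smul_mem_GH {S : Set (RatFunc ℂ)} (c : ℂ) {x : BiGerm} (hx : x ∈ GH S) : c • x ∈ GH S := by
  rw [← algebraMap_mul]
  exact mul_mem_GH ((regularRing S).algebraMap_mem c) hx

lemma GH_of_GHC {S : Set (RatFunc ℂ)} {f : BiGerm} (hf : f ∈ GHC S) : f ∈ GH S :=
  Submodule.span_induction (p := fun x _ => x ∈ GH S) (fun _ hx => Submodule.subset_span hx)
    (GH S).zero_mem (fun _ _ _ _ => (GH S).add_mem) (fun c _ _ => smul_mem_GH c) hf

/-- `GH_F^ℂ` as a submodule. -/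
def GHCSubmodule (F : Subfield ℂ) : Submodule ℂ BiGerm where
  carrier := GHCUnion F
  zero_mem' := ⟨∅, Set.finite_empty, Set.empty_subset _, Submodule.zero_mem _⟩
  add_mem' := by
    rintro f g ⟨S, hS, hSF, hf⟩ ⟨T, hT, hTF, hg⟩
    exact ⟨S ∪ T, hS.union hT, Set.union_subset hSF hTF,
      Submodule.add_mem _ (GHC_mono Set.subset_union_left hf) (GHC_mono Set.subset_union_right hg)⟩
  smul_mem' := by
    rintro c f ⟨S, hS, hSF, hf⟩
    exact ⟨S, hS, hSF, Submodule.smul_mem _ c hf⟩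

/-- `GH_F` as a submodule. -/
def GHSubmodule (F : Subfield ℂ) : Submodule ℂ BiGerm where
  carrier := GHUnion F
  zero_mem' := ⟨∅, Set.finite_empty, Set.empty_subset _, Submodule.zero_mem _⟩
  add_mem' := by
    rintro f g ⟨S, hS, hSF, hf⟩ ⟨T, hT, hTF, hg⟩
    exact ⟨S ∪ T, hS.union hT, Set.union_subset hSF hTF,
      Submodule.add_mem _ (GH_mono Set.subset_union_left hf) (GH_mono Set.subset_union_right hg)⟩
  smul_mem' := by
    rintro c f ⟨S, hS, hSF, hf⟩
    exact ⟨S, hS, hSF, smul_mem_GH c hf⟩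

lemma mul_mem_GHSubmodule {F : Subfield ℂ} {S : Set (RatFunc ℂ)} (hfin : S.Finite)
    (hS : S ⊆ FLT F) {φ x : BiGerm} (hφ : φ ∈ regularRing S) (hx : x ∈ GHSubmodule F) :
    φ * x ∈ GHSubmodule F := by
  obtain ⟨T, hT, hTF, hg⟩ := hx
  exact ⟨S ∪ T, hfin.union hT, Set.union_subset hS hTF,
    mul_mem_GH (regularRing_mono Set.subset_union_left hφ) (GH_mono Set.subset_union_right hg)⟩

lemma GHSubmodule_of_GHCSubmodule {F : Subfield ℂ} {x : BiGerm} (hx : x ∈ GHCSubmodule F) :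
    x ∈ GHSubmodule F := by
  obtain ⟨T, hT, hTF, hg⟩ := hx
  exact ⟨T, hT, hTF, GH_of_GHC hg⟩

/-- The letters of `L_v(z̄)` must be conjugates of constants in the letter set; a letter `b` is the
conjugate of `b̄`, which lies in `F` by closure under conjugation. -/
lemma hyperlog_mul_hyperlogFun_mem {F : Subfield ℂ} (hconj : ∀ x ∈ F, starRingEnd ℂ x ∈ F)
    {v : List ℂ} (hv : ∀ b ∈ v, b ∈ F) {w : List (RatFunc ℂ)} (hw : ∀ β ∈ w, β ∈ FLT F) :
    toGerm (fun p => hyperlog v p.2 * hyperlogFun w p) ∈ GHCSubmodule F := by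
  refine ⟨{β | β ∈ w} ∪ (fun b => RatFunc.C (starRingEnd ℂ b)) '' {b | b ∈ v},
    (List.finite_toSet w).union ((List.finite_toSet v).image _), ?_,
    Submodule.subset_span ⟨v, w, fun x hx => ⟨starRingEnd ℂ x, ?_, by simp⟩,
      fun β hβ => Or.inl hβ, rfl⟩⟩
  · rintro _ (h | ⟨b, hb, rfl⟩)
    · exact hw _ h
    · exact C_mem_FLT (hconj b (hv b hb))
  · exact Or.inr ⟨x, hx, rfl⟩

lemma coeff_mul_hyperlogFun_mem {F : Subfield ℂ} (hconj : ∀ x ∈ F, starRingEnd ℂ x ∈ F)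
    {c : ℂ → ℂ} (hc : EvSpan slitNhds (hyperlogs F) c) {w : List (RatFunc ℂ)}
    (hw : ∀ β ∈ w, β ∈ FLT F) :
    toGerm (fun p => c p.2 * hyperlogFun w p) ∈ GHCSubmodule F := by
  simp only [mul_comm (c _)]
  refine hc.comp_snd.toGerm_mul_mem (m := hyperlogFun w) ?_
  rintro _ ⟨_, ⟨v, hv, rfl⟩, rfl⟩
  simp only [mul_comm (hyperlogFun w _)]
  exact hyperlog_mul_hyperlogFun_mem hconj hv hw

/-! ### Log-Laurent expansions -/

/-- Germs of polynomials in `log z` and `log y` whose coefficients are analytic at the origin. -/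
def logAnalytic : Submodule ℂ BiGerm :=
  Submodule.span ℂ {x | ∃ (k l : ℕ) (h : ℂ × ℂ → ℂ), AnalyticAt ℂ h (0, 0) ∧
    x = toGerm fun p => Complex.log p.1 ^ k * Complex.log p.2 ^ l * h p}

lemma hasSum_prod_of_fintype {ι κ : Type*} [Fintype ι] {f : ι × κ → ℂ} {s : ι → ℂ}
    (h : ∀ a, HasSum (fun b => f (a, b)) (s a)) : HasSum f (∑ a, s a) := by
  classical
  have h1 : ∀ a ∈ Finset.univ, HasSum (fun q : ι × κ => if q.1 = a then f q else 0) (s a) := by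
    intro a _
    refine ((Prod.mk_right_injective a).hasSum_iff fun q hq => if_neg fun e => hq ?_).1 ?_
    · exact ⟨q.2, by rw [← e]⟩
    · simpa [Function.comp_def] using h a
  simpa using hasSum_sum h1

/-- Asking for all large cut-offs `N`, with coefficients independent of `N`, lets two expansions be
added without padding. -/
lemma logAnalytic_expansion {x : BiGerm} (hx : x ∈ logAnalytic) :
    ∃ h : ℕ → ℕ → ℂ × ℂ → ℂ, (∀ k l, AnalyticAt ℂ (h k l) (0, 0)) ∧
      ∀ᶠ N in atTop, x = toGerm fun p => ∑ k ∈ Finset.range N, ∑ l ∈ Finset.range N,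
        Complex.log p.1 ^ k * Complex.log p.2 ^ l * h k l p := by
  refine Submodule.span_induction (p := fun x _ => ∃ h : ℕ → ℕ → ℂ × ℂ → ℂ,
    (∀ k l, AnalyticAt ℂ (h k l) (0, 0)) ∧
      ∀ᶠ N in atTop, x = toGerm fun p => ∑ k ∈ Finset.range N, ∑ l ∈ Finset.range N,
        Complex.log p.1 ^ k * Complex.log p.2 ^ l * h k l p) ?_ ?_ ?_ ?_ hx
  · rintro _ ⟨k, l, h, hh, rfl⟩
    refine ⟨fun k' l' p => if k' = k ∧ l' = l then h p else 0, fun k' l' => ?_, ?_⟩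
    · by_cases e : k' = k ∧ l' = l
      · simpa only [e, and_self, if_true] using hh
      · simpa only [e, if_false] using analyticAt_const
    · filter_upwards [eventually_gt_atTop k, eventually_gt_atTop l] with N hk hl
      congr 1
      funext p
      rw [Finset.sum_eq_single k, Finset.sum_eq_single l]
      · simp
      · intro b _ hb
        simp [hb]
      · exact fun hb => absurd (Finset.mem_range.2 hl) hb
      · intro b _ hb
        simp [hb]
      · exact fun hb => absurd (Finset.mem_range.2 hk) hb
  · exact ⟨fun _ _ _ => 0, fun _ _ => analyticAt_const, Eventually.of_forall fun N => by
      simp [toGerm_zero]⟩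
  · rintro x y _ _ ⟨h, hh, e⟩ ⟨g, hg, e'⟩
    refine ⟨fun k l p => h k l p + g k l p, fun k l => (hh k l).add (hg k l), ?_⟩
    filter_upwards [e, e'] with N h1 h2
    rw [h1, h2, toGerm_add]
    simp only [mul_add, Finset.sum_add_distrib]
  · rintro c x _ ⟨h, hh, e⟩
    refine ⟨fun k l p => c * h k l p, fun k l => analyticAt_const.mul (hh k l), ?_⟩
    filter_upwards [e] with N h1
    rw [h1, smul_toGerm]
    simp only [Finset.mul_sum, mul_left_comm c]

lemma logAnalytic_le_R0 {x : BiGerm} (hx : x ∈ logAnalytic) : x ∈ R0 := by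
  obtain ⟨h, hh, e⟩ := logAnalytic_expansion hx
  -- The cut-off is taken of the form `L + 1` to match powers of the logarithms running from `0` to
  -- `L`.
  obtain ⟨L, hL⟩ := ((tendsto_add_atTop_nat 1).eventually e).exists
  choose c r hr _ hsum using fun k l => AnalyticAt.exists_doubleSeries (hh k l)
  set ρ : Fin (L + 1) × Fin (L + 1) → ℝ := fun q => r q.1 q.2
  refine ⟨L, 0, fun k l i j => c k l (i, j), Finset.univ.inf' ⟨(0, 0), Finset.mem_univ _⟩ ρ, _,
    (Finset.lt_inf'_iff _).2 fun q _ => hr _ _, hL, fun z _ y _ hz hy => ?_⟩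
  simp only [Finset.sum_range]
  refine hasSum_prod_of_fintype fun k => hasSum_prod_of_fintype fun l => ?_
  have hle : Finset.univ.inf' ⟨(0, 0), Finset.mem_univ _⟩ ρ ≤ r k l :=
    Finset.inf'_le ρ (Finset.mem_univ (k, l))
  have h1 := (hsum k l (z, y) (hz.le.trans hle) (hy.le.trans hle)).mul_left
    (Complex.log z ^ (k : ℕ) * Complex.log y ^ (l : ℕ))
  refine h1.congr_fun ?_
  rintro ⟨i, j⟩
  simp only [zero_add, zpow_natCast]
  ring

lemma hyperlogZbar_mul_mem_logAnalytic (v : List ℂ) (k : ℕ) {h : ℂ × ℂ → ℂ}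
    (hh : AnalyticAt ℂ h (0, 0)) :
    toGerm (fun p => hyperlog v p.2 * (Complex.log p.1 ^ k * h p)) ∈ logAnalytic := by
  obtain ⟨ρ, hρ, hv⟩ := exists_radius v
  obtain ⟨N, g, hg, -, hsum⟩ := isLogHol_hyperlog hρ hv
  have h1 : toGerm (fun p => hyperlog v p.2 * (Complex.log p.1 ^ k * h p)) =
      ∑ l ∈ Finset.range N,
        toGerm (fun p => Complex.log p.1 ^ k * Complex.log p.2 ^ l * (g l p.2 * h p)) := by
    have h2 : ∀ (s : Finset ℕ) (f : ℕ → ℂ × ℂ → ℂ),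
        ∑ l ∈ s, toGerm (f l) = toGerm fun p => ∑ l ∈ s, f l p := by
      intro s f
      classical
      induction s using Finset.induction_on with
      | empty => simp [toGerm_zero]
      | insert a s ha ih => rw [Finset.sum_insert ha, ih, toGerm_add]; simp [Finset.sum_insert ha]
    rw [h2, toGerm_eq_iff]
    filter_upwards [eventually_baseFilter_of_snd (slitBall_mem_nhdsWithin hρ)] with p hp
    rw [hsum p.2 hp, Finset.sum_mul]
    exact Finset.sum_congr rfl fun l _ => by ring
  rw [h1]
  refine Submodule.sum_mem _ fun l _ => Submodule.subset_span ⟨k, l, _, ?_, rfl⟩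
  have h3 : AnalyticAt ℂ (g l) 0 :=
    (hg l).analyticAt (Metric.isOpen_ball.mem_nhds (Metric.mem_ball_self hρ))
  have h4 : AnalyticAt ℂ (fun p : ℂ × ℂ => g l p.2) (0, 0) :=
    AnalyticAt.fun_comp (g := g l) h3 analyticAt_snd
  exact h4.mul hh

/-! ### Decomposition of the generators -/

/-- The singular part is a generalized hyperlogarithm because its coefficients, curve values times
`L_v(z̄)`, are hyperlogarithms in `z̄` with letters in `F`. For the regular part this follows by
subtraction. A word of zeros in `z` is regular by itself. -/
theorem hyperlogProducts_decomposition {F : Subfield ℂ} (hconj : ∀ x ∈ F, starRingEnd ℂ x ∈ F)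
    (hsqrt : ∀ x : ℂ, x ^ 2 ∈ F → x ∈ F) {S : Set (RatFunc ℂ)} (hfin : S.Finite)
    (hS : S ⊆ FLT F) {f : BiGerm} (hf : f ∈ hyperlogProducts S) :
    ∃ r s, f = r + s ∧ (r ∈ logAnalytic ∧ r ∈ GHCSubmodule F) ∧
      (s ∈ S0 S ∧ s ∈ GHCSubmodule F) := by
  have hf' : f ∈ GHCSubmodule F := ⟨S, hfin, hS, Submodule.subset_span hf⟩
  obtain ⟨v, w, hv, hw, rfl⟩ := hf
  have hvF : ∀ b ∈ v, b ∈ F := fun b hb => by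
    obtain ⟨a, ha, rfl⟩ := hv b hb
    exact hconj a (mem_of_C_mem_FLT (hS ha))
  suffices h : ∃ r s, hyperlogZbar v * hyperlogZ w = r + s ∧ r ∈ logAnalytic ∧
      (s ∈ S0 S ∧ s ∈ GHCSubmodule F) by
    obtain ⟨r, s, e, hr, hs⟩ := h
    refine ⟨r, s, e, ⟨hr, ?_⟩, hs⟩
    rw [eq_sub_iff_add_eq.2 e.symm]
    exact Submodule.sub_mem _ hf' hs.2
  by_cases h0 : ∃ β ∈ w, β ≠ 0
  · obtain ⟨r, s, hr, hs, e⟩ := (hyperlogFun_decomposition hS w hw h0).exists_add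
    refine ⟨toGerm fun p => hyperlog v p.2 * r p, toGerm fun p => hyperlog v p.2 * s p, ?_, ?_,
      ?_, ?_⟩
    · rw [toGerm_add]
      exact toGerm_eq_iff.2 (e.mono fun p hp => by rw [← mul_add, ← hp]; rfl)
    · refine hr.toGerm_mul_mem (m := fun p => hyperlog v p.2) ?_
      rintro _ ⟨k, u, -, -, rfl⟩
      exact hyperlogZbar_mul_mem_logAnalytic v k (analyticAt_regHyp u)
    · refine hs.toGerm_mul_mem (m := fun p => hyperlog v p.2) ?_
      rintro _ ⟨γ, u, l, β, t, hγ, hu, hβ, hβ0, ht, rfl⟩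
      refine Submodule.subset_span ⟨toGerm fun p => hyperlog v p.2 * evalAt γ (regHyp u) p.2,
        ⟨?_, fun y => hyperlog v y * evalAt γ (regHyp u) y, rfl⟩, l, β, t, hβ, hβ0, ht, ?_⟩
      · have h1 := hyperlogZbar_mul_mem_logAnalytic v 0 (AnalyticAt.fun_comp
          (g := evalAt γ (regHyp u)) (analyticAt_evalAt (analyticAt_regHyp u))
          (analyticAt_snd (p := ((0 : ℂ), (0 : ℂ)))))
        simp only [pow_zero, one_mul] at h1
        exact logAnalytic_le_R0 h1
      · rw [hyperlogZ, toGerm_mul]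
        exact toGerm_eq_iff.2 (Eventually.of_forall fun p => (mul_assoc _ _ _).symm)
    · refine hs.toGerm_mul_mem (m := fun p => hyperlog v p.2) ?_
      rintro _ ⟨γ, u, l, β, t, hγ, hu, hβ, hβ0, ht, rfl⟩
      have h1 := coeff_mul_hyperlogFun_mem hconj (hyperlogs_mul (EvSpan.of_mem ⟨v, hvF, rfl⟩)
        (hyperlogs_evalAt_regHyp hsqrt hu hγ)) (w := List.replicate l 0 ++ β :: t) (by
          intro δ hδ
          rcases List.mem_append.1 hδ with h | h
          · rw [List.eq_of_mem_replicate h]; exact zero_mem_FLT F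
          · rcases List.mem_cons.1 h with h | h
            · rw [h]; exact hS hβ
            · exact hS (ht δ h))
      simpa only [mul_assoc] using h1
  · push Not at h0
    refine ⟨_, 0, (add_zero _).symm, ?_, Submodule.zero_mem _, Submodule.zero_mem _⟩
    have h1 := hyperlogZbar_mul_mem_logAnalytic v w.length
      (analyticAt_const (v := (w.length.factorial : ℂ)⁻¹))
    have h2 : hyperlogZbar v * hyperlogZ w = toGerm fun p => hyperlog v p.2 *
        (Complex.log p.1 ^ w.length * (w.length.factorial : ℂ)⁻¹) := by
      rw [hyperlogZbar, hyperlogZ, toGerm_mul, List.eq_replicate_of_mem h0]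
      simp [hyperlog_replicate_zero, div_eq_mul_inv]
    rwa [h2]

/-! ### Functions of `z` for a fixed small `y` -/

lemma eventually_forall_slitBall_iff {P : ℂ → Prop} :
    (∀ᶠ δ in 𝓝[>] (0 : ℝ), ∀ y ∈ slitBall δ, P y) ↔ ∀ᶠ y in slitNhds, P y := by
  constructor
  · intro h
    obtain ⟨δ, h1, hδ⟩ := (h.and self_mem_nhdsWithin).exists
    exact mem_nhdsWithin_slitPlane_iff.2 ⟨δ, hδ, h1⟩
  · intro h
    obtain ⟨ρ, hρ, H⟩ := mem_nhdsWithin_slitPlane_iff.1 h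
    filter_upwards [Ioo_mem_nhdsGT hρ] with δ hδ y hy using H (slitBall_mono hδ.2.le hy)

lemma eventually_forall_region_iff {P : ℂ × ℂ → Prop} :
    (∀ᶠ δ in 𝓝[>] (0 : ℝ), ∀ y ∈ slitBall δ, ∀ z ∈ slitBall (δ * ‖y‖), P (z, y)) ↔
      ∀ᶠ p in baseFilter, P p := by
  rw [eventually_baseFilter_iff]
  constructor
  · intro h
    obtain ⟨δ, h1, hδ⟩ := (h.and self_mem_nhdsWithin).exists
    exact ⟨δ, hδ, h1⟩
  · rintro ⟨ρ, hρ, H⟩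
    filter_upwards [Ioo_mem_nhdsGT hρ] with δ hδ y hy z hz
    exact H y (slitBall_mono hδ.2.le hy) z
      (slitBall_mono (mul_le_mul_of_nonneg_right hδ.2.le (norm_nonneg _)) hz)

/-- Meromorphic functions which are analytic for `0 < |z| < ρ`. -/
structure IsCoeff (ρ : ℝ) (m : ℂ → ℂ) : Prop where
  meromorphic : Meromorphic m
  analyticAt : ∀ z, z ≠ 0 → ‖z‖ < ρ → AnalyticAt ℂ m z

lemma IsCoeff.const (ρ : ℝ) (c : ℂ) : IsCoeff ρ fun _ => c :=
  ⟨fun _ => MeromorphicAt.const c _, fun _ _ _ => analyticAt_const⟩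

lemma IsCoeff.add {ρ : ℝ} {m n : ℂ → ℂ} (hm : IsCoeff ρ m) (hn : IsCoeff ρ n) :
    IsCoeff ρ fun z => m z + n z :=
  ⟨fun x => (hm.1 x).fun_add (hn.1 x), fun z h0 hz => (hm.2 z h0 hz).fun_add (hn.2 z h0 hz)⟩

lemma IsCoeff.mul {ρ : ℝ} {m n : ℂ → ℂ} (hm : IsCoeff ρ m) (hn : IsCoeff ρ n) :
    IsCoeff ρ fun z => m z * n z :=
  ⟨fun x => (hm.1 x).fun_mul (hn.1 x), fun z h0 hz => (hm.2 z h0 hz).fun_mul (hn.2 z h0 hz)⟩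

/-- For fixed small `y`, the function `g` is meromorphic and analytic for `0 < |z| ≪ |y|`. -/
def RationalLike (g : ℂ × ℂ → ℂ) : Prop :=
  ∀ᶠ δ in 𝓝[>] (0 : ℝ), ∀ y ∈ slitBall δ, IsCoeff (δ * ‖y‖) fun z => g (z, y)

lemma exists_rationalLike_of_mem_regularRing {F : Subfield ℂ} {S : Set (RatFunc ℂ)}
    (hS : S ⊆ FLT F) {φ : BiGerm} (hφ : φ ∈ regularRing S) :
    ∃ g, φ = toGerm g ∧ RationalLike g := by
  refine Algebra.adjoin_induction (p := fun φ _ => ∃ g, φ = toGerm g ∧ RationalLike g)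
    ?_ ?_ ?_ ?_ hφ
  · rintro φ (((rfl | ⟨β, hβ, rfl⟩) | rfl) | ⟨b, hb, rfl⟩)
    · exact ⟨_, rfl, Eventually.of_forall fun δ y _ =>
        ⟨fun x => MeromorphicAt.id x, fun z _ _ => analyticAt_id⟩⟩
    · refine ⟨_, rfl, ?_⟩
      have key : ∀ᶠ δ in 𝓝[>] (0 : ℝ), ∀ y ∈ slitBall δ, ∀ z : ℂ, z ≠ 0 → ‖z‖ < δ * ‖y‖ →
          z ≠ valueAt β y := by
        by_cases h : β = 0
        · exact Eventually.of_forall fun δ y _ z h0 _ => by simpa [h] using h0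
        · obtain ⟨ρ, hρ, H⟩ := exists_letters_bound (S := {β}) (Set.finite_singleton β)
            (by simpa using hS hβ)
          filter_upwards [Ioo_mem_nhdsGT hρ] with δ hδ y hy z _ hz e
          have h1 := H y (slitBall_mono hδ.2.le hy) β rfl h
          have h2 := mul_le_mul_of_nonneg_right hδ.2.le (norm_nonneg y)
          rw [e] at hz
          exact absurd (hz.trans_le (h2.trans h1)) (lt_irrefl _)
      filter_upwards [key] with δ hδ y hy
      refine ⟨fun x => ((MeromorphicAt.id x).fun_sub (MeromorphicAt.const _ _)).fun_inv,
        fun z h0 hz => ?_⟩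
      exact (analyticAt_id.fun_sub analyticAt_const).fun_inv (sub_ne_zero.2 (hδ y hy z h0 hz))
    · exact ⟨_, rfl, Eventually.of_forall fun δ y _ => IsCoeff.const _ y⟩
    · exact ⟨_, rfl, Eventually.of_forall fun δ y _ => IsCoeff.const _ (y - starRingEnd ℂ b)⁻¹⟩
  · intro c
    refine ⟨fun _ => c, ?_, Eventually.of_forall fun δ y _ => IsCoeff.const _ _⟩
    rw [Algebra.algebraMap_eq_smul_one]
    change toGerm (fun _ => c * 1) = _
    simp only [mul_one]
  · rintro _ _ _ _ ⟨g, rfl, hg⟩ ⟨h, rfl, hh⟩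
    refine ⟨_, toGerm_add g h, ?_⟩
    filter_upwards [hg, hh] with δ h1 h2 y hy using (h1 y hy).add (h2 y hy)
  · rintro _ _ _ _ ⟨g, rfl, hg⟩ ⟨h, rfl, hh⟩
    refine ⟨_, toGerm_mul g h, ?_⟩
    filter_upwards [hg, hh] with δ h1 h2 y hy using (h1 y hy).mul (h2 y hy)

/-- For fixed small `y`, the function `g` is a polynomial in `log z` with meromorphic
coefficients on a disc whose radius does not depend on `y`. -/
def LogMeromorphic (g : ℂ × ℂ → ℂ) : Prop :=
  ∀ᶠ ε in 𝓝[>] (0 : ℝ), ∀ᶠ δ in 𝓝[>] (0 : ℝ), ∀ y ∈ slitBall δ, ∃ h : ℕ → ℂ → ℂ,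
    (∀ k, MeromorphicOn (h k) (Metric.ball 0 ε)) ∧
    ∀ᶠ N in atTop, ∀ z ∈ slitBall (δ * ‖y‖),
      g (z, y) = ∑ k ∈ Finset.range N, Complex.log z ^ k * h k z

lemma LogMeromorphic.add {f g : ℂ × ℂ → ℂ} (hf : LogMeromorphic f) (hg : LogMeromorphic g) :
    LogMeromorphic fun p => f p + g p := by
  filter_upwards [hf, hg] with ε h1 h2
  filter_upwards [h1, h2] with δ h3 h4 y hy
  obtain ⟨a, ha, ha'⟩ := h3 y hy
  obtain ⟨b, hb, hb'⟩ := h4 y hy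
  refine ⟨fun k z => a k z + b k z, fun k x hx => (ha k x hx).fun_add (hb k x hx), ?_⟩
  filter_upwards [ha', hb'] with N h5 h6 z hz
  rw [h5 z hz, h6 z hz]
  simp only [mul_add, Finset.sum_add_distrib]

lemma LogMeromorphic.mul {m g : ℂ × ℂ → ℂ} (hm : RationalLike m) (hg : LogMeromorphic g) :
    LogMeromorphic fun p => m p * g p := by
  filter_upwards [hg] with ε h2
  filter_upwards [hm, h2] with δ h3 h4 y hy
  obtain ⟨b, hb, hb'⟩ := h4 y hy
  refine ⟨fun k z => m (z, y) * b k z, fun k x hx => ((h3 y hy).1 x).fun_mul (hb k x hx), ?_⟩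
  filter_upwards [hb'] with N h6 z hz
  rw [h6 z hz, Finset.mul_sum]
  exact Finset.sum_congr rfl fun k _ => mul_left_comm _ _ _

/-- Summation over `y` of a log-Laurent series. -/
lemma exists_logMeromorphic_of_hasSum {L : ℕ} {M : ℤ}
    {c : Fin (L + 1) → Fin (L + 1) → ℕ → ℕ → ℂ} {t : ℝ} (ht : 0 < t) (ht1 : t < 1) {y : ℂ}
    {g : ℂ → ℂ} (H : ∀ z ∈ Complex.slitPlane, ‖z‖ ≤ t →
      HasSum (fun q : Fin (L + 1) × Fin (L + 1) × ℕ × ℕ =>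
        c q.1 q.2.1 q.2.2.1 q.2.2.2 * Complex.log z ^ (q.1 : ℕ) * Complex.log y ^ (q.2.1 : ℕ) *
          z ^ (M + (q.2.2.1 : ℤ)) * y ^ (M + (q.2.2.2 : ℤ))) (g z)) :
    ∃ h : Fin (L + 1) → ℂ → ℂ, (∀ k, MeromorphicOn (h k) (Metric.ball 0 t)) ∧
      ∀ z ∈ slitBall t, g z = ∑ k : Fin (L + 1), Complex.log z ^ (k : ℕ) * h k z := by
  set a : Fin (L + 1) → ℕ → ℂ := fun k i =>
    ∑' q : Fin (L + 1) × ℕ, c k q.1 i q.2 * Complex.log y ^ (q.1 : ℕ) * y ^ (M + (q.2 : ℤ)) with ha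
  -- the series summed in the order `k`, `i`, `(l, j)`
  have key : ∀ z ∈ Complex.slitPlane, ‖z‖ ≤ t →
      (∀ k : Fin (L + 1), Summable fun i => Complex.log z ^ (k : ℕ) * z ^ M * (a k i * z ^ i)) ∧
      g z = ∑ k : Fin (L + 1), ∑' i, Complex.log z ^ (k : ℕ) * z ^ M * (a k i * z ^ i) := by
    intro z hz hzt
    have hz0 := Complex.slitPlane_ne_zero hz
    let e : Fin (L + 1) × ℕ × Fin (L + 1) × ℕ ≃ Fin (L + 1) × Fin (L + 1) × ℕ × ℕ :=
      ⟨fun q => (q.1, q.2.2.1, q.2.1, q.2.2.2), fun q => (q.1, q.2.2.1, q.2.1, q.2.2.2),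
        fun _ => rfl, fun _ => rfl⟩
    have h1 := e.hasSum_iff.2 (H z hz hzt)
    set T : Fin (L + 1) × ℕ × Fin (L + 1) × ℕ → ℂ := _ ∘ e with hT
    have hk : ∀ k, Summable fun b => T (k, b) := fun k => h1.summable.prod_factor k
    have hki : ∀ (k : Fin (L + 1)) (i : ℕ), ∑' q, T (k, i, q) =
        Complex.log z ^ (k : ℕ) * z ^ M * (a k i * z ^ i) := by
      intro k i
      have : ∀ q, T (k, i, q) = (Complex.log z ^ (k : ℕ) * z ^ M * z ^ i) *
          (c k q.1 i q.2 * Complex.log y ^ (q.1 : ℕ) * y ^ (M + (q.2 : ℤ))) := fun q => by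
        simp only [hT, Function.comp_apply, e, Equiv.coe_fn_mk, zpow_add₀ hz0, zpow_natCast]
        ring
      simp only [this, tsum_mul_left]
      ring
    refine ⟨fun k => ?_, ?_⟩
    · simpa only [hki] using (hk k).prod
    · have h2 := (h1.prod_fiberwise fun k => (hk k).hasSum).tsum_eq
      rw [← h2, tsum_fintype]
      refine Finset.sum_congr rfl fun k _ => ?_
      rw [(hk k).tsum_prod]
      exact tsum_congr (hki k)
  -- At the real point `z = t < 1` the factor `(log t)^k t^M` is non-zero and can be divided out.
  -- Summability at this one point gives holomorphy of the coefficient series on the whole disc `|z|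
  -- < t`.
  have hts : (t : ℂ) ∈ Complex.slitPlane := Complex.ofReal_mem_slitPlane.2 ht
  have hlog : Complex.log t ≠ 0 := by
    rw [← Complex.ofReal_log ht.le]
    exact_mod_cast (Real.log_neg ht ht1).ne
  have hsum : ∀ k, Summable fun i => ‖a k i‖ * t ^ i := by
    intro k
    have h1 := (key t hts (by simp [abs_of_pos ht])).1 k
    have h0 : Complex.log t ^ (k : ℕ) * (t : ℂ) ^ M ≠ 0 :=
      mul_ne_zero (pow_ne_zero _ hlog) (zpow_ne_zero _ (Complex.slitPlane_ne_zero hts))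
    have h2 := ((summable_mul_left_iff h0).1 h1).norm
    simpa [abs_of_pos ht] using h2
  have hdiff : ∀ k, DifferentiableOn ℂ (fun z => ∑' i, a k i * z ^ i) (Metric.ball 0 t) := by
    intro k
    refine Complex.differentiableOn_tsum_of_summable_norm (hsum k)
      (fun i => by fun_prop) Metric.isOpen_ball fun i z hz => ?_
    rw [norm_mul, norm_pow]
    have : ‖z‖ < t := by simpa using hz
    gcongr
  refine ⟨fun k z => z ^ M * ∑' i, a k i * z ^ i, fun k x hx => ?_, fun z hz => ?_⟩
  · exact ((MeromorphicAt.id x).fun_zpow M).fun_mul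
      ((hdiff k).analyticAt (Metric.isOpen_ball.mem_nhds hx)).meromorphicAt
  · rw [(key z hz.1 (norm_lt_of_mem_slitBall hz).le).2]
    refine Finset.sum_congr rfl fun k _ => ?_
    rw [tsum_mul_left, mul_assoc]

lemma exists_logMeromorphic_of_mem_R0 {x : BiGerm} (hx : x ∈ R0) :
    ∃ g, x = toGerm g ∧ LogMeromorphic g := by
  obtain ⟨L, M, c, ε₀, g, hε₀, rfl, H⟩ := hx
  refine ⟨g, rfl, ?_⟩
  filter_upwards [Ioo_mem_nhdsGT (lt_min hε₀ one_pos)] with t ht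
  have ht0 : t < ε₀ := ht.2.trans_le (min_le_left _ _)
  filter_upwards [Ioo_mem_nhdsGT (lt_min ht.1 one_pos)] with δ hδ y hy
  have hδt : δ < t := hδ.2.trans_le (min_le_left _ _)
  have hyδ := norm_lt_of_mem_slitBall hy
  obtain ⟨h, hh, hsum⟩ := exists_logMeromorphic_of_hasSum ht.1 (ht.2.trans_le (min_le_right _ _))
    (g := fun z => g (z, y)) fun z hz hzt => H z hz y hy.1 (hzt.trans_lt ht0)
      ((hyδ.trans hδt).trans ht0)
  refine ⟨fun k => if hk : k < L + 1 then h ⟨k, hk⟩ else fun _ => 0, fun k => ?_, ?_⟩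
  · by_cases hk : k < L + 1
    · simpa only [hk, dif_pos] using hh ⟨k, hk⟩
    · simp only [hk, dif_neg, not_false_eq_true]
      exact fun x _ => MeromorphicAt.const 0 x
  · filter_upwards [eventually_ge_atTop (L + 1)] with N hN z hz
    have hle : δ * ‖y‖ ≤ t := by
      have h1 : δ ≤ 1 := (hδ.2.trans_le (min_le_right _ _)).le
      have h2 := mul_le_of_le_one_left (norm_nonneg y) h1
      linarith
    have h1 := hsum z (slitBall_mono hle hz)
    rw [h1, ← Finset.sum_subset (Finset.range_subset_range.2 hN), Finset.sum_range]
    · exact Finset.sum_congr rfl fun k _ => by rw [dif_pos k.2]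
    · intro k _ hk
      rw [dif_neg (by simpa using hk), mul_zero]

/-- For fixed small `y`, the function `g` is a combination of singular hyperlogarithms. -/
def SingLike (g : ℂ × ℂ → ℂ) : Prop :=
  ∀ᶠ ε in 𝓝[>] (0 : ℝ), ∀ᶠ δ in 𝓝[>] (0 : ℝ), ∀ y ∈ slitBall δ,
    ∃ (W : Finset (List ℂ)) (φ : List ℂ → ℂ → ℂ),
      (∀ w ∈ W, IsSingWord ε w) ∧ (∀ w, IsCoeff (δ * ‖y‖) (φ w)) ∧ (∀ w, w ∉ W → φ w = 0) ∧
      ∀ z ∈ slitBall (δ * ‖y‖), g (z, y) = ∑ w ∈ W, φ w z * hyperlog w z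

/-- The index set consists of words of complex numbers for the given `y`, so words of rational
functions that coincide at `y` simply add their coefficients. Coefficients are zero off the index
set, which permits unions. -/
lemma SingLike.add {f g : ℂ × ℂ → ℂ} (hf : SingLike f) (hg : SingLike g) :
    SingLike fun p => f p + g p := by
  classical
  filter_upwards [hf, hg] with ε h1 h2
  filter_upwards [h1, h2] with δ h3 h4 y hy
  obtain ⟨W, φ, hW, hφ, h0, hs⟩ := h3 y hy
  obtain ⟨V, ψ, hV, hψ, h0', hs'⟩ := h4 y hy
  refine ⟨W ∪ V, fun w z => φ w z + ψ w z, fun w hw => ?_, fun w => (hφ w).add (hψ w),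
    fun w hw => ?_, fun z hz => ?_⟩
  · exact (Finset.mem_union.1 hw).elim (hW w) (hV w)
  · rw [Finset.mem_union, not_or] at hw
    exact funext fun z => by simp [h0 w hw.1, h0' w hw.2]
  · simp only [hs z hz, hs' z hz, add_mul, Finset.sum_add_distrib]
    congr 1
    · exact Finset.sum_subset Finset.subset_union_left fun w _ hw => by simp [h0 w hw]
    · exact Finset.sum_subset Finset.subset_union_right fun w _ hw => by simp [h0' w hw]

lemma SingLike.mul {m g : ℂ × ℂ → ℂ} (hm : RationalLike m) (hg : SingLike g) :
    SingLike fun p => m p * g p := by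
  filter_upwards [hg] with ε h2
  filter_upwards [hm, h2] with δ h3 h4 y hy
  obtain ⟨W, φ, hW, hφ, h0, hs⟩ := h4 y hy
  refine ⟨W, fun w z => m (z, y) * φ w z, hW, fun w => (h3 y hy).mul (hφ w), fun w hw => ?_,
    fun z hz => ?_⟩
  · exact funext fun z => by simp [h0 w hw]
  · simp only [hs z hz, Finset.mul_sum, mul_assoc]

lemma RationalLike.coeff (c : ℂ → ℂ) : RationalLike fun p => c p.2 :=
  Eventually.of_forall fun _ y _ => IsCoeff.const _ (c y)

/-- `β(0) = 0` gives `|β(y)| < ε` for small `y`, and `β ≠ 0` keeps `β(y)` non-zero. The letters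
after `β` are unrestricted. -/
lemma singLike_hyperlogFun {F : Subfield ℂ} {β : RatFunc ℂ} (hβ : β ∈ FLT F)
    (h0 : VanishesAtZero β) (l : ℕ) (v : List (RatFunc ℂ)) :
    SingLike (hyperlogFun (List.replicate l 0 ++ β :: v)) := by
  classical
  filter_upwards [self_mem_nhdsWithin] with ε hε
  have h1 : ∀ᶠ y in slitNhds, ‖valueAt β y‖ < ε := by
    have h := (analyticAt_valueAt_zero h0.2).continuousAt.norm
    refine (h.eventually_lt_const ?_).filter_mono nhdsWithin_le_nhds
    simpa [valueAt_at_zero h0.2] using hε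
  have h2 : ∀ᶠ y in slitNhds, valueAt β y ≠ 0 := by
    obtain ⟨c, hc, h⟩ := FLT.exists_le_norm_valueAt hβ h0.1
    filter_upwards [nhdsWithin_slitPlane_le h, self_mem_nhdsWithin] with y hy hy2
    have := mul_pos hc (norm_pos_iff.2 (Complex.slitPlane_ne_zero hy2))
    exact norm_pos_iff.1 (this.trans_le hy)
  filter_upwards [eventually_forall_slitBall_iff.2 (h1.and h2)] with δ hδ y hy
  refine ⟨{(List.replicate l 0 ++ β :: v).map fun β => valueAt β y},
    fun w _ => if w = (List.replicate l 0 ++ β :: v).map fun β => valueAt β y then 1 else 0,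
    fun w hw => ?_, fun w => IsCoeff.const _ _, fun w hw => ?_, fun z hz => ?_⟩
  · rw [Finset.mem_singleton.1 hw]
    exact ⟨l, valueAt β y, v.map fun β => valueAt β y, by simp, (hδ y hy).2, (hδ y hy).1⟩
  · exact funext fun z => if_neg (by simpa using hw)
  · simp [hyperlogFun]

lemma prodSpan_induction {A X : Set BiGerm} {P : (ℂ × ℂ → ℂ) → Prop}
    (mul : ∀ φ ∈ A, ∀ x ∈ X, ∃ g, φ * x = toGerm g ∧ P g) (zero : P fun _ => 0)
    (add : ∀ f g, P f → P g → P fun p => f p + g p)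
    (smul : ∀ (c : ℂ) f, P f → P fun p => c * f p) {x : BiGerm} (hx : x ∈ prodSpan A X) :
    ∃ g, x = toGerm g ∧ P g := by
  refine Submodule.span_induction (p := fun x _ => ∃ g, x = toGerm g ∧ P g) ?_ ⟨_, rfl, zero⟩
    ?_ ?_ hx
  · rintro _ ⟨φ, hφ, x, hx, rfl⟩
    exact mul φ hφ x hx
  · rintro _ _ _ _ ⟨f, rfl, hf⟩ ⟨g, rfl, hg⟩
    exact ⟨_, toGerm_add f g, add f g hf hg⟩
  · rintro c _ _ ⟨f, rfl, hf⟩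
    exact ⟨_, smul_toGerm c f, smul c f hf⟩

lemma exists_logMeromorphic {F : Subfield ℂ} {x : BiGerm}
    (hx : x ∈ prodSpan (regularRingUnion F) R0) : ∃ g, x = toGerm g ∧ LogMeromorphic g := by
  refine prodSpan_induction ?_ ?_ (fun f g => LogMeromorphic.add)
    (fun c f => LogMeromorphic.mul (RationalLike.coeff fun _ => c)) hx
  · rintro φ ⟨T, -, hT, hφ⟩ x hx
    obtain ⟨m, rfl, hm⟩ := exists_rationalLike_of_mem_regularRing hT hφ
    obtain ⟨g, rfl, hg⟩ := exists_logMeromorphic_of_mem_R0 hx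
    exact ⟨_, toGerm_mul m g, hg.mul hm⟩
  · exact Eventually.of_forall fun ε => Eventually.of_forall fun δ y _ =>
      ⟨fun _ _ => 0, fun _ _ _ => MeromorphicAt.const 0 _,
          Eventually.of_forall fun N z _ => by simp⟩

lemma exists_singLike {F : Subfield ℂ} {S : Set (RatFunc ℂ)} (hS : S ⊆ FLT F) {x : BiGerm}
    (hx : x ∈ prodSpan (regularRingUnion F) (S0 S : Set BiGerm)) :
    ∃ g, x = toGerm g ∧ SingLike g := by
  have hzero : SingLike fun _ => 0 :=
    Eventually.of_forall fun ε => Eventually.of_forall fun δ y _ =>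
      ⟨∅, fun _ _ => 0, by simp, fun _ => IsCoeff.const _ _, fun _ _ => rfl, by simp⟩
  refine prodSpan_induction ?_ hzero (fun f g => SingLike.add)
    (fun c f => SingLike.mul (RationalLike.coeff fun _ => c)) hx
  rintro φ ⟨T, -, hT, hφ⟩ x hx
  obtain ⟨m, rfl, hm⟩ := exists_rationalLike_of_mem_regularRing hT hφ
  obtain ⟨g, rfl, hg⟩ : ∃ g, x = toGerm g ∧ SingLike g := by
    refine Submodule.span_induction (p := fun x _ => ∃ g, x = toGerm g ∧ SingLike g) ?_
      ⟨_, rfl, hzero⟩ ?_ ?_ hx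
    · rintro _ ⟨r, ⟨-, h, rfl⟩, l, β, v, hβ, h0, -, rfl⟩
      exact ⟨_, toGerm_mul _ _,
        (singLike_hyperlogFun (hS hβ) h0 l v).mul (RationalLike.coeff h)⟩
    · rintro _ _ _ _ ⟨f, rfl, hf⟩ ⟨g, rfl, hg⟩
      exact ⟨_, toGerm_add f g, hf.add hg⟩
    · rintro c _ _ ⟨f, rfl, hf⟩
      exact ⟨_, smul_toGerm c f, hf.mul (RationalLike.coeff fun _ => c)⟩
  exact ⟨_, toGerm_mul m g, hg.mul hm⟩

/-- Independence gives vanishing only for `z` in a neighbourhood of `0` whose size may depend on `y`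
in an uncontrolled way. Analyticity spreads it over the slit disc of radius `δ |y|`, as needed for
the germ to vanish. -/
lemma IsCoeff.eqOn_zero {ρ : ℝ} (hρ : 0 < ρ) {m : ℂ → ℂ} (hm : IsCoeff ρ m)
    (h : ∀ᶠ z in 𝓝[≠] (0 : ℂ), m z = 0) : ∀ z ∈ slitBall ρ, m z = 0 := by
  have ha : AnalyticOnNhd ℂ m (slitBall ρ) := fun z hz =>
    hm.2 z (slitBall_ne_zero hz) (norm_lt_of_mem_slitBall hz)
  have h1 : ∀ᶠ z in slitNhds, m =ᶠ[𝓝 z] 0 := by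
    have h2 := nhdsWithin_slitPlane_le (eventually_eventually_nhdsWithin.2 h)
    filter_upwards [h2, self_mem_nhdsWithin] with z hz hz2
    rwa [isOpen_compl_singleton.nhdsWithin_eq (Complex.slitPlane_ne_zero hz2)] at hz
  obtain ⟨z₀, hz₀, hz₀'⟩ := (h1.and (slitBall_mem_nhdsWithin hρ)).exists
  exact ha.eqOn_zero_of_preconnected_of_eventuallyEq_zero (isPreconnected_slitBall hρ) hz₀' hz₀

/-- For each fixed small `y` the equality of the singular and the regular representation is a
relation excluded by `singular_hyperlog_independent`, so all singular coefficients vanish. -/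
theorem eq_zero_of_mem_prodSpan {F : Subfield ℂ} {S : Set (RatFunc ℂ)} (hS : S ⊆ FLT F)
    {x : BiGerm} (hs : x ∈ prodSpan (regularRingUnion F) (S0 S : Set BiGerm))
    (hr : x ∈ prodSpan (regularRingUnion F) R0) : x = 0 := by
  obtain ⟨s, rfl, hs'⟩ := exists_singLike hS hs
  obtain ⟨r, e, hr'⟩ := exists_logMeromorphic hr
  -- `ε` is fixed before `y`: the regular side is meromorphic on the disc of radius `ε` uniformly in
  -- `y`, so shrinking `y` brings the letters `β(y)` inside.
  obtain ⟨ε, ⟨hsε, hrε⟩, hε⟩ := ((hs'.and hr').and self_mem_nhdsWithin).exists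
  rw [← toGerm_zero, toGerm_eq_iff, ← eventually_forall_region_iff]
  filter_upwards [hsε, hrε, eventually_forall_region_iff.2 (toGerm_eq_iff.1 e),
    self_mem_nhdsWithin] with δ h1 h2 h3 hδ y hy
  have hpos : 0 < δ * ‖y‖ := mul_pos hδ (norm_pos_iff.2 (slitBall_ne_zero hy))
  obtain ⟨W, φ, hW, hφ, -, hsum⟩ := h1 y hy
  obtain ⟨h, hh, hev⟩ := h2 y hy
  obtain ⟨N, hN⟩ := hev.exists
  have hzero := singular_hyperlog_independent hε W φ N h hW (fun w => (hφ w).1) hh (by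
    filter_upwards [slitBall_mem_nhdsWithin hpos] with z hz
    rw [← hsum z hz, ← hN z hz, h3 y hy z hz])
  intro z hz
  rw [hsum z hz]
  exact Finset.sum_eq_zero fun w hw => by
    rw [(hφ w).eqOn_zero hpos (hzero w hw) z hz, zero_mul]

/-! ### The decomposition -/

lemma prodSpan_mono {A B X : Set BiGerm} (h : A ⊆ B) : prodSpan A X ≤ prodSpan B X := by
  refine Submodule.span_mono ?_
  rintro _ ⟨φ, hφ, x, hx, rfl⟩
  exact ⟨φ, h hφ, x, hx, rfl⟩

lemma mem_prodSpan_of_mem (S : Set (RatFunc ℂ)) {X : Set BiGerm} {x : BiGerm} (hx : x ∈ X) :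
    x ∈ prodSpan (regularRing S : Set BiGerm) X :=
  Submodule.subset_span ⟨1, (regularRing S).one_mem, x, hx, (one_mul x).symm⟩

lemma mul_mem_prodSpan {S : Set (RatFunc ℂ)} {X : Set BiGerm} {φ x : BiGerm}
    (hφ : φ ∈ regularRing S) (hx : x ∈ prodSpan (regularRing S : Set BiGerm) X) :
    φ * x ∈ prodSpan (regularRing S : Set BiGerm) X := by
  refine Submodule.span_induction
    (p := fun x _ => φ * x ∈ prodSpan (regularRing S : Set BiGerm) X) ?_ ?_ ?_ ?_ hx
  · rintro _ ⟨ψ, hψ, x, hx, rfl⟩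
    exact Submodule.subset_span ⟨φ * ψ, (regularRing S).mul_mem hφ hψ, x, hx,
      (mul_assoc _ _ _).symm⟩
  · rw [mul_zero]
    exact Submodule.zero_mem _
  · intro x y _ _ hx hy
    rw [mul_add]
    exact Submodule.add_mem _ hx hy
  · intro c x _ hx
    rw [mul_smul_comm]
    exact Submodule.smul_mem _ c hx

theorem exists_isDecomposition {F : Subfield ℂ} (hconj : ∀ x ∈ F, starRingEnd ℂ x ∈ F)
    (hsqrt : ∀ x : ℂ, x ^ 2 ∈ F → x ∈ F) {S : Set (RatFunc ℂ)} (hfin : S.Finite)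
    (hS : S ⊆ FLT F) {f : BiGerm} (hf : f ∈ GH S) : ∃ r s, IsDecomposition F S f r s := by
  refine GH_induction (P := fun f => ∃ r s, IsDecomposition F S f r s) ?_ ?_ ?_ ?_ hf
  · intro x hx
    obtain ⟨r, s, e, ⟨hr, hr'⟩, hs, hs'⟩ := hyperlogProducts_decomposition hconj hsqrt hfin hS hx
    exact ⟨r, s, e, ⟨mem_prodSpan_of_mem S (logAnalytic_le_R0 hr), GHSubmodule_of_GHCSubmodule hr'⟩,
      mem_prodSpan_of_mem S hs, GHSubmodule_of_GHCSubmodule hs'⟩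
  · exact ⟨0, 0, (add_zero 0).symm, ⟨Submodule.zero_mem _, (GHSubmodule F).zero_mem⟩,
      Submodule.zero_mem _, (GHSubmodule F).zero_mem⟩
  · rintro x y ⟨r, s, e, ⟨hr, hr'⟩, hs, hs'⟩ ⟨t, u, e', ⟨ht, ht'⟩, hu, hu'⟩
    exact ⟨r + t, s + u, by rw [e, e', add_add_add_comm],
      ⟨Submodule.add_mem _ hr ht, (GHSubmodule F).add_mem hr' ht'⟩,
      Submodule.add_mem _ hs hu, (GHSubmodule F).add_mem hs' hu'⟩
  · rintro φ hφ x ⟨r, s, e, ⟨hr, hr'⟩, hs, hs'⟩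
    exact ⟨φ * r, φ * s, by rw [e, mul_add],
      ⟨mul_mem_prodSpan hφ hr, mul_mem_GHSubmodule hfin hS hφ hr'⟩,
      mul_mem_prodSpan hφ hs, mul_mem_GHSubmodule hfin hS hφ hs'⟩

theorem isDecomposition_unique {F : Subfield ℂ} {S : Set (RatFunc ℂ)} (hfin : S.Finite)
    (hS : S ⊆ FLT F) {f r s r' s' : BiGerm} (h : IsDecomposition F S f r s)
    (h' : IsDecomposition F S f r' s') : r = r' ∧ s = s' := by
  obtain ⟨e, ⟨hr, -⟩, hs, -⟩ := h
  obtain ⟨e', ⟨hr', -⟩, hs', -⟩ := h'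
  have hsub : (regularRing S : Set BiGerm) ⊆ regularRingUnion F := fun φ hφ => ⟨S, hfin, hS, hφ⟩
  have h1 : r - r' = s' - s := by
    rw [sub_eq_sub_iff_add_eq_add, ← e, e', add_comm]
  have h2 : r - r' = 0 := by
    refine eq_zero_of_mem_prodSpan hS ?_ (prodSpan_mono hsub (Submodule.sub_mem _ hr hr'))
    rw [h1]
    exact prodSpan_mono hsub (Submodule.sub_mem _ hs' hs)
  exact ⟨sub_eq_zero.1 h2, (sub_eq_zero.1 (h1 ▸ h2)).symm⟩

theorem exists_decomposition_of_GHC {F : Subfield ℂ} (hconj : ∀ x ∈ F, starRingEnd ℂ x ∈ F)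
    (hsqrt : ∀ x : ℂ, x ^ 2 ∈ F → x ∈ F) {S : Set (RatFunc ℂ)} (hfin : S.Finite)
    (hS : S ⊆ FLT F) {f : BiGerm} (hf : f ∈ GHC S) :
    ∃ r s, f = r + s ∧ (r ∈ logAnalytic ∧ r ∈ GHCSubmodule F) ∧
      (s ∈ S0 S ∧ s ∈ GHCSubmodule F) := by
  refine Submodule.span_induction (p := fun f _ => ∃ r s, f = r + s ∧
    (r ∈ logAnalytic ∧ r ∈ GHCSubmodule F) ∧ (s ∈ S0 S ∧ s ∈ GHCSubmodule F)) ?_ ?_ ?_ ?_ hf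
  · exact fun x hx => hyperlogProducts_decomposition hconj hsqrt hfin hS hx
  · exact ⟨0, 0, (add_zero 0).symm, ⟨Submodule.zero_mem _, Submodule.zero_mem _⟩,
      Submodule.zero_mem _, Submodule.zero_mem _⟩
  · rintro x y _ _ ⟨r, s, e, ⟨hr, hr'⟩, hs, hs'⟩ ⟨t, u, e', ⟨ht, ht'⟩, hu, hu'⟩
    exact ⟨r + t, s + u, by rw [e, e', add_add_add_comm],
      ⟨Submodule.add_mem _ hr ht, Submodule.add_mem _ hr' ht'⟩,
      Submodule.add_mem _ hs hu, Submodule.add_mem _ hs' hu'⟩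
  · rintro c x _ ⟨r, s, e, ⟨hr, hr'⟩, hs, hs'⟩
    exact ⟨c • r, c • s, by rw [e, smul_add],
      ⟨Submodule.smul_mem _ c hr, Submodule.smul_mem _ c hr'⟩,
      Submodule.smul_mem _ c hs, Submodule.smul_mem _ c hs'⟩

end

end GenHyp

theorem mainTheorem6 (F : Subfield ℂ) (hconj : ∀ x ∈ F, starRingEnd ℂ x ∈ F)
    (hsqrt : ∀ x : ℂ, x ^ 2 ∈ F → x ∈ F)
    (S : Set (RatFunc ℂ)) (hfin : S.Finite) (hS : S ⊆ GenHyp.FLT F) :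
    (∀ f ∈ GenHyp.GH S,
      ∃! p : GenHyp.BiGerm × GenHyp.BiGerm, GenHyp.IsDecomposition F S f p.1 p.2) ∧
    (∀ f ∈ GenHyp.GHC S, ∀ r s : GenHyp.BiGerm, GenHyp.IsDecomposition F S f r s →
      (r ∈ GenHyp.R0 ∧ r ∈ GenHyp.GHCUnion F) ∧
        (s ∈ GenHyp.S0 S ∧ s ∈ GenHyp.GHCUnion F)) ∧
    ((GenHyp.prodSpan (GenHyp.regularRingUnion F) (GenHyp.S0 S : Set GenHyp.BiGerm) :
        Set GenHyp.BiGerm) ∩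
      (GenHyp.prodSpan (GenHyp.regularRingUnion F) GenHyp.R0 : Set GenHyp.BiGerm) ∩
      GenHyp.GHUnion F = {0}) := by
  refine ⟨fun f hf => ?_, fun f hf r s h => ?_, ?_⟩
  · obtain ⟨r, s, h⟩ := GenHyp.exists_isDecomposition hconj hsqrt hfin hS hf
    refine ⟨(r, s), h, fun p hp => ?_⟩
    obtain ⟨h1, h2⟩ := GenHyp.isDecomposition_unique hfin hS hp h
    exact Prod.ext h1 h2
  · obtain ⟨r', s', e, ⟨hr, hr'⟩, hs, hs'⟩ :=
      GenHyp.exists_decomposition_of_GHC hconj hsqrt hfin hS hf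
    have hR := GenHyp.logAnalytic_le_R0 hr
    -- The decomposition with constant coefficients is also one over the ring `O_Σ`, so uniqueness
    -- identifies it with the given one.
    have h' : GenHyp.IsDecomposition F S f r' s' :=
      ⟨e, ⟨GenHyp.mem_prodSpan_of_mem S hR, GenHyp.GHSubmodule_of_GHCSubmodule hr'⟩,
        GenHyp.mem_prodSpan_of_mem S hs, GenHyp.GHSubmodule_of_GHCSubmodule hs'⟩
    obtain ⟨rfl, rfl⟩ := GenHyp.isDecomposition_unique hfin hS h h'
    exact ⟨⟨hR, hr'⟩, hs, hs'⟩
  · refine Set.eq_singleton_iff_unique_mem.2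
      ⟨⟨⟨Submodule.zero_mem _, Submodule.zero_mem _⟩, (GenHyp.GHSubmodule F).zero_mem⟩, ?_⟩
    rintro x ⟨⟨hs, hr⟩, -⟩
    exact GenHyp.eq_zero_of_mem_prodSpan hS hs hr
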